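/- Let $Q(\mathbf n)=6n_1^2-4n_2^2$ on $\mathbb R^2$, with associated bilinear form $B(\mathbf n,\mathbf m)=12n_1m_1-8n_2m_2$, and put $\mathbf c(t)=\left(\tfrac{\sinh t}{\sqrt6},\tfrac{\cosh t}{2}\right)^T$, $\mathbf c^\perp(t)=\left(\tfrac{\cosh t}{\sqrt6},\tfrac{\sinh t}{2}\right)^T$ for $t\in\mathbb R$. Let $\mathbf c_1=\tfrac1{2\sqrt3}(-2,3)^T$, $\mathbf c_2=\tfrac1{2\sqrt3}(2,3)^T$, let $t_j$ be the real number with $\mathbf c(t_j)=\mathbf c_j$, and let $\mathbf c_j^\perp=\mathbf c^\perp(t_j)$. For $x>0$ let $K_0(x)=\int_0^\infty e^{-x\cosh t}\,dt$; let $\operatorname{sgn}(0)=0$, and read $0\cdot K_0(x)$ as $0$ for every $x$. For $\tau=\tau_1+i\tau_2$ in the upper half-plane $\mathbb H$, $q=e^{2\pi i\tau}$ and $\boldsymbol\mu\in\mathbb R^2$ define $$\begin{aligned}\Theta_{\boldsymbol\mu}(\tau)={}&\tfrac12\operatorname{sgn}(t_2-t_1)\sqrt{\tau_2}\sum_{\mathbf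 n\in\mathbb Z^2+\boldsymbol\mu,\ \mathbf n\ne\mathbf 0}\bigl(1-\operatorname{sgn}(B(\mathbf n,\mathbf c_1))\operatorname{sgn}(B(\mathbf n,\mathbf c_2))\bigr)K_0(2\pi Q(\mathbf n)\tau_2)\,e^{2\pi iQ(\mathbf n)\tau_1}\\&+\tfrac12\operatorname{sgn}(t_2-t_1)\sqrt{\tau_2}\sum_{\mathbf n\in\mathbb Z^2+\boldsymbol\mu,\ \mathbf n\ne\mathbf 0}\bigl(1-\operatorname{sgn}(B(\mathbf n,\mathbf c_1^\perp))\operatorname{sgn}(B(\mathbf n,\mathbf c_2^\perp))\bigr)K_0(-2\pi Q(\mathbf n)\tau_2)\,e^{2\pi iQ(\mathbf n)\tau_1}\\&+(t_2-t_1)\sqrt{\tau_2}\,\delta_{\boldsymbol\mu\in\mathbb Z^2},\end{aligned}$$ $$\widehat\Theta_{\boldsymbol\mu}(\tau)=\sqrt{\tau_2}\sum_{\mathbf n\in\mathbb Z^2+\boldsymbol\mu}q^{Q(\mathbf n)}\int_{t_1}^{t_2}e^{-\pi B(\mathbf n,\mathbf c(t))^2\tau_2}\,dt .$$ For $j\in\{0,1,2,3\}$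 let $\boldsymbol\mu_j=(\tfrac j6,\tfrac18)^T$, $\boldsymbol\lambda=(\tfrac12,\tfrac12)^T$, $H_j=\Theta_{\boldsymbol\mu_j}+\Theta_{\boldsymbol\mu_j+\boldsymbol\lambda}$ and $\widehat H_j=\widehat\Theta_{\boldsymbol\mu_j}+\widehat\Theta_{\boldsymbol\mu_j+\boldsymbol\lambda}$. Then all the series defining these functions converge absolutely, and the following hold. 1. $H_j=\widehat H_j$ on $\mathbb H$ for every $j\in\{0,1,2,3\}$. 2. $(H_0,H_1,H_2,H_3)$ is a vector-valued Maass form on $\Gamma_0(2)$ with Laplace eigenvalue $\tfrac14$. That is: each $H_j$ is smooth on $\mathbb H$; $-\tau_2^2(\partial_{\tau_1}^2+\partial_{\tau_2}^2)H_j=\tfrac14H_j$; for every $g\in\mathrm{SL}_2(\mathbb Z)$ the function $H_j(g\tau)$ grows at most polynomially in $\tau_2$, uniformly in $\tau_1$, as $\tau_2\to\infty$; and there is a representation $M\mapsto\Omega_M$ of $\Gamma_0(2)$ by complex $4\times4$ matrices, diagonal on the elements $\pm\begin{pmatrix}1&n\\0&1\end{pmatrix}$ with $n\in\mathbb Z$,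 such that $$H_j\!\left(\frac{a\tau+b}{c\tau+d}\right)=\sum_{k=0}^3\Omega_M(j,k)\,H_k(\tau)\qquad\text{for all }M=\begin{pmatrix}a&b\\c&d\end{pmatrix}\in\Gamma_0(2),\ \tau\in\mathbb H,$$ and such that, for $T=\begin{pmatrix}1&1\\0&1\end{pmatrix}$, $R=\begin{pmatrix}1&0\\2&1\end{pmatrix}$ and $\zeta_n=e^{2\pi i/n}$, $$\Omega_T=\operatorname{diag}\left(\zeta_{16}^{15},\zeta_{48}^{5},\zeta_{48}^{29},\zeta_{16}^{7}\right),$$ $$\Omega_R=\sqrt{\frac{2-\sqrt2}{12}}\begin{pmatrix}\zeta_{16}^{15}&2(1+\sqrt2)\zeta_{48}&2\zeta_{48}^{13}&(1+\sqrt2)\zeta_{16}^{11}\\(1+\sqrt2)\zeta_{48}&\zeta_{48}^{5}&(1+\sqrt2)\zeta_{48}^{41}&\zeta_{48}^{13}\\\zeta_{48}^{13}&(1+\sqrt2)\zeta_{48}^{41}&\zeta_{48}^{5}&(1+\sqrt2)\zeta_{48}\\(1+\sqrt2)\zeta_{16}^{11}&2\zeta_{48}^{13}&2(1+\sqrt2)\zeta_{48}&\zeta_{16}^{15}\end{pmatrix}.$$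 -/

import Mathlib

open scoped MatrixGroups ContDiff

namespace MockMaass

noncomputable section

/-! ### Indefinite binary quadratic forms and their hyperbolic parametrization -/

/-- The bilinear form `B(n, m) = nᵀ A m`. -/
def bilin (A : Matrix (Fin 2) (Fin 2) ℝ) (n m : Fin 2 → ℝ) : ℝ := n ⬝ᵥ (A.mulVec m)

/-- The quadratic form `Q(n) = (1/2) nᵀ A n`. -/
def quad (A : Matrix (Fin 2) (Fin 2) ℝ) (n : Fin 2 → ℝ) : ℝ := bilin A n n / 2

/-- The parametrization `c(t) = P⁻¹ (sinh t, cosh t)ᵀ` of `C_Q`. -/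
def cvec (P : Matrix (Fin 2) (Fin 2) ℝ) (t : ℝ) : Fin 2 → ℝ :=
  P⁻¹.mulVec ![Real.sinh t, Real.cosh t]

/-- The parametrization `c^⊥(t) = P⁻¹ (cosh t, sinh t)ᵀ` of `C_Q^⊥`. -/
def cperp (P : Matrix (Fin 2) (Fin 2) ℝ) (t : ℝ) : Fin 2 → ℝ :=
  P⁻¹.mulVec ![Real.cosh t, Real.sinh t]

/-- The parameter `t` of a vector `c ∈ C_Q`, i.e. the real number with `c(t) = c`
(see `cvec_param`). -/
def param (P : Matrix (Fin 2) (Fin 2) ℝ) (c : Fin 2 → ℝ) : ℝ :=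
  Real.arsinh (P.mulVec c 0)

/-- If `P c` lies on the upper branch of `x² - y² = -1`, then `c(param c) = c`. -/
theorem cvec_param (P : Matrix (Fin 2) (Fin 2) ℝ) (hP : IsUnit P.det) (c : Fin 2 → ℝ)
    (hc : P.mulVec c 0 ^ 2 - P.mulVec c 1 ^ 2 = -1) (hpos : 0 < P.mulVec c 1) :
    cvec P (param P c) = c := by
  have h : ![Real.sinh (param P c), Real.cosh (param P c)] = P.mulVec c := by
    ext i
    fin_cases i
    · simp [param]
    · have h1 : Real.cosh (param P c) = P.mulVec c 1 := by
        rw [param, Real.cosh_arsinh, show 1 + P.mulVec c 0 ^ 2 = P.mulVec c 1 ^ 2 by linarith,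
          Real.sqrt_sq hpos.le]
      simpa using h1
  rw [cvec, h, Matrix.mulVec_mulVec, Matrix.nonsing_inv_mul _ hP, Matrix.one_mulVec]

/-- The shifted lattice `ℤ² + μ`. -/
def shiftedLattice (μ : Fin 2 → ℝ) : Set (Fin 2 → ℝ) :=
  {n | ∃ m : Fin 2 → ℤ, ∀ i, n i = (m i : ℝ) + μ i}

/-! ### Mock Maass theta functions and their completions -/

/-- The modified Bessel function `K₀(x) = ∫₀^∞ exp(-x cosh t) dt`, for `x > 0`. -/
def besselK0 (x : ℝ) : ℝ := ∫ t in Set.Ioi (0 : ℝ), Real.exp (-x * Real.cosh t)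

/-- The exponential `exp(2πi x)`. -/
def e (x : ℝ) : ℂ := Complex.exp (2 * (Real.pi : ℂ) * Complex.I * (x : ℂ))

/-- The summand
`(1 - sgn B(n,c₁) sgn B(n,c₂)) K₀(2π Q(n) τ₂) exp(2πi Q(n) τ₁)`. Where `Q(n) ≤ 0` and `n ≠ 0` the
first factor vanishes, if `c₁, c₂ ∈ C_Q` and `Q` is anisotropic. -/
def thetaPosTerm (A : Matrix (Fin 2) (Fin 2) ℝ) (c₁ c₂ : Fin 2 → ℝ) (τ : UpperHalfPlane)
    (n : Fin 2 → ℝ) : ℂ :=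
  ((1 - Real.sign (bilin A n c₁) * Real.sign (bilin A n c₂) : ℝ) : ℂ)
    * (besselK0 (2 * Real.pi * quad A n * τ.im) : ℂ) * e (quad A n * τ.re)

/-- The summand
`(1 - sgn B(n,c₁^⊥) sgn B(n,c₂^⊥)) K₀(-2π Q(n) τ₂) exp(2πi Q(n) τ₁)`, with
`c_j^⊥ = c^⊥(t_j)`. -/
def thetaNegTerm (A P : Matrix (Fin 2) (Fin 2) ℝ) (c₁ c₂ : Fin 2 → ℝ) (τ : UpperHalfPlane)
    (n : Fin 2 → ℝ) : ℂ :=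
  ((1 - Real.sign (bilin A n (cperp P (param P c₁)))
      * Real.sign (bilin A n (cperp P (param P c₂))) : ℝ) : ℂ)
    * (besselK0 (-2 * Real.pi * quad A n * τ.im) : ℂ) * e (quad A n * τ.re)

open Classical in
/-- The mock Maass theta function `Θ_μ^{[c₁,c₂]}(τ)`. -/
def theta (A P : Matrix (Fin 2) (Fin 2) ℝ) (c₁ c₂ μ : Fin 2 → ℝ) (τ : UpperHalfPlane) : ℂ :=
  (1 / 2 : ℂ) * (Real.sign (param P c₂ - param P c₁) : ℂ) * (Real.sqrt τ.im : ℂ)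
      * (∑' n : ↥(shiftedLattice μ \ {0}), thetaPosTerm A c₁ c₂ τ (n : Fin 2 → ℝ))
    + (1 / 2 : ℂ) * (Real.sign (param P c₂ - param P c₁) : ℂ) * (Real.sqrt τ.im : ℂ)
      * (∑' n : ↥(shiftedLattice μ \ {0}), thetaNegTerm A P c₁ c₂ τ (n : Fin 2 → ℝ))
    + (if ∃ m : Fin 2 → ℤ, ∀ i, μ i = (m i : ℝ) then
        ((param P c₂ - param P c₁ : ℝ) : ℂ) * (Real.sqrt τ.im : ℂ) else 0)

/-- The summand `q^{Q(n)} ∫_{t₁}^{t₂} exp(-π B(n,c(t))² τ₂) dt`, with `q = exp(2πiτ)`. -/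
def thetaHatTerm (A P : Matrix (Fin 2) (Fin 2) ℝ) (c₁ c₂ : Fin 2 → ℝ) (τ : UpperHalfPlane)
    (n : Fin 2 → ℝ) : ℂ :=
  Complex.exp (2 * (Real.pi : ℂ) * Complex.I * (quad A n : ℂ) * (τ : ℂ))
    * ((∫ t in (param P c₁)..(param P c₂),
          Real.exp (-Real.pi * bilin A n (cvec P t) ^ 2 * τ.im) : ℝ) : ℂ)

/-- The completed mock Maass theta function `Θ̂_μ^{[c₁,c₂]}(τ)`. -/
def thetaHat (A P : Matrix (Fin 2) (Fin 2) ℝ) (c₁ c₂ μ : Fin 2 → ℝ) (τ : UpperHalfPlane) : ℂ :=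
  (Real.sqrt τ.im : ℂ) * ∑' n : ↥(shiftedLattice μ), thetaHatTerm A P c₁ c₂ τ (n : Fin 2 → ℝ)

/-! ### Vector-valued Maass forms -/

/-- The hyperbolic Laplacian `-τ₂² (∂²/∂τ₁² + ∂²/∂τ₂²)`. -/
def hypLaplacian (f : UpperHalfPlane → ℂ) (τ : UpperHalfPlane) : ℂ :=
  -((τ.im : ℂ) ^ 2) * Laplacian.laplacian (f ∘ UpperHalfPlane.ofComplex) (τ : ℂ)

/-- `U_1, …, U_N` is a vector-valued Maass form for `Γ ⊆ SL₂(ℤ)` with multiplier system `Ψ`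
(a representation of `Γ`) and Laplace eigenvalue `lam`. -/
structure IsVectorMaassForm {N : ℕ} (Γ : Subgroup SL(2, ℤ)) (Ψ : Γ →* Matrix (Fin N) (Fin N) ℂ)
    (lam : ℂ) (U : Fin N → UpperHalfPlane → ℂ) : Prop where
  smooth : ∀ j, ContDiffOn ℝ ∞ (U j ∘ UpperHalfPlane.ofComplex) {z : ℂ | 0 < z.im}
  transform : ∀ (M : Γ) (j : Fin N) (τ : UpperHalfPlane),
    U j ((M : SL(2, ℤ)) • τ) = ∑ k, Ψ M j k * U k τ
  /-- `Ψ` is diagonal on the elements of `Γ` of the form `±(1 n; 0 1)`. -/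
  diagonal : ∀ M : Γ, (M : SL(2, ℤ)) 1 0 = 0 → (Ψ M).IsDiag
  eigen : ∀ j τ, hypLaplacian (U j) τ = lam * U j τ
  /-- At most polynomial growth near every cusp. -/
  growth : ∀ (j : Fin N) (g : SL(2, ℤ)), ∃ (C Y : ℝ) (m : ℕ), ∀ τ : UpperHalfPlane,
    Y ≤ τ.im → ‖U j (g • τ)‖ ≤ C * τ.im ^ m

/-! ### The form `Q(n) = 6 n₁² - 4 n₂²` and the functions `H_j` -/

/-- The Gram matrix of `Q(n) = 6 n₁² - 4 n₂²`. -/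
def A6 : Matrix (Fin 2) (Fin 2) ℝ := !![12, 0; 0, -8]

/-- The matrix `P = diag(√6, √4)`, with `A = Pᵀ diag(2, -2) P`. -/
def P6 : Matrix (Fin 2) (Fin 2) ℝ := !![Real.sqrt 6, 0; 0, 2]

/-- `c₁ = (-2, 3)ᵀ / (2√3)`. -/
def c1 : Fin 2 → ℝ := (1 / (2 * Real.sqrt 3)) • ![-2, 3]

/-- `c₂ = (2, 3)ᵀ / (2√3)`. -/
def c2 : Fin 2 → ℝ := (1 / (2 * Real.sqrt 3)) • ![2, 3]

/-- `μ_j = (j/6, 1/8)ᵀ`. -/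
def muVec (j : Fin 4) : Fin 2 → ℝ := ![((j : ℕ) : ℝ) / 6, 1 / 8]

/-- `λ = (1/2, 1/2)ᵀ`. -/
def lamVec : Fin 2 → ℝ := ![1 / 2, 1 / 2]

/-- `H_j = Θ_{μ_j} + Θ_{μ_j + λ}`. -/
def H (j : Fin 4) (τ : UpperHalfPlane) : ℂ :=
  theta A6 P6 c1 c2 (muVec j) τ + theta A6 P6 c1 c2 (muVec j + lamVec) τ

/-- `Ĥ_j = Θ̂_{μ_j} + Θ̂_{μ_j + λ}`. -/
def Hhat (j : Fin 4) (τ : UpperHalfPlane) : ℂ :=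
  thetaHat A6 P6 c1 c2 (muVec j) τ + thetaHat A6 P6 c1 c2 (muVec j + lamVec) τ

theorem quad_A6 (n : Fin 2 → ℝ) : quad A6 n = 6 * n 0 ^ 2 - 4 * n 1 ^ 2 := by
  simp [quad, bilin, A6, dotProduct, Matrix.mulVec, Fin.sum_univ_two]
  ring

/-- `c₁` and `c₂` are the points of `C_Q` with the parameters used in the theta functions. -/
theorem cvec_param_c1_c2 : cvec P6 (param P6 c1) = c1 ∧ cvec P6 (param P6 c2) = c2 := by
  have h3 : Real.sqrt 3 ^ 2 = 3 := Real.sq_sqrt (by norm_num)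
  have h6 : Real.sqrt 6 ^ 2 = 6 := Real.sq_sqrt (by norm_num)
  have h3' : 0 < Real.sqrt 3 := Real.sqrt_pos.mpr (by norm_num)
  have h6' : 0 < Real.sqrt 6 := Real.sqrt_pos.mpr (by norm_num)
  have hdet : IsUnit P6.det := by
    simp [P6, Matrix.det_fin_two_of]
  constructor
  · apply cvec_param _ hdet
    · simp [P6, c1, Matrix.mulVec, dotProduct, Fin.sum_univ_two]
      field_simp
      rw [h3, h6]
      norm_num
    · simp [P6, c1, Matrix.mulVec, dotProduct, Fin.sum_univ_two]
  · apply cvec_param _ hdet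
    · simp [P6, c2, Matrix.mulVec, dotProduct, Fin.sum_univ_two]
      field_simp
      rw [h3, h6]
      norm_num
    · simp [P6, c2, Matrix.mulVec, dotProduct, Fin.sum_univ_two]

/-- The matrix `(1 0; 2 1)` in `SL₂(ℤ)`. -/
def matR : SL(2, ℤ) := ⟨!![1, 0; 2, 1], by simp [Matrix.det_fin_two_of]⟩

/-- `T = (1 1; 0 1)` as an element of `Γ₀(2)`. -/
def T : CongruenceSubgroup.Gamma0 2 :=
  ⟨ModularGroup.T, by rw [CongruenceSubgroup.Gamma0_mem]; simp [ModularGroup.T]⟩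

/-- `R = (1 0; 2 1)` as an element of `Γ₀(2)`. -/
def R : CongruenceSubgroup.Gamma0 2 :=
  ⟨matR, by rw [CongruenceSubgroup.Gamma0_mem]; simp [matR]; rfl⟩

/-- `ζ_n = exp(2πi/n)`. -/
def zeta (n : ℕ) : ℂ := Complex.exp (2 * (Real.pi : ℂ) * Complex.I / (n : ℂ))

/-- The matrix `Ω_T`. -/
def OmegaT : Matrix (Fin 4) (Fin 4) ℂ :=
  Matrix.diagonal ![zeta 16 ^ 15, zeta 48 ^ 5, zeta 48 ^ 29, zeta 16 ^ 7]

/-- The real number `1 + √2`, as a complex number. -/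
def r : ℂ := ((1 + Real.sqrt 2 : ℝ) : ℂ)

/-- The matrix `Ω_R`. -/
def OmegaR : Matrix (Fin 4) (Fin 4) ℂ :=
  ((Real.sqrt ((2 - Real.sqrt 2) / 12) : ℝ) : ℂ) •
    !![zeta 16 ^ 15, 2 * r * zeta 48, 2 * zeta 48 ^ 13, r * zeta 16 ^ 11;
       r * zeta 48, zeta 48 ^ 5, r * zeta 48 ^ 41, zeta 48 ^ 13;
       zeta 48 ^ 13, r * zeta 48 ^ 41, zeta 48 ^ 5, r * zeta 48;
       r * zeta 16 ^ 11, 2 * zeta 48 ^ 13, 2 * r * zeta 48, zeta 16 ^ 15]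

end

end MockMaass

namespace MockMaass
open Complex Real

/-! ### Poisson summation for binary Gaussians -/

/-! The two descriptions of the functions complement each other. The completed side is modular by
construction, the Bessel side consists termwise of eigenfunctions of the Laplacian, and the equality
of the two gives all the properties at once.

The vectors `c1`, `c2` have parameters `∓T` with `sinh T = √2`, `cosh T = √3`. Write `(X, Y)` for
the image of `(√6 n₁, 2 n₂)` under the boost by `t`; then `Q = X² - Y²` and `B(n, c(t)) = -2Y`, so
the summand of `Θ̂` is the integral over `[-T, T]` of the Siegel Gaussian `exp(2πi(τX² - τ̄Y²))` of
signature `(1, 1)`. Poisson summation holds for each `t` with the `t`-independent factor `|τ|/√96`,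
which `√τ₂` turns into weight 0 (`tsum_gauss_neg_inv`). As `Rτ = S T⁻² S τ`, two Poisson summations
express `Ĥ(Rτ)` by Gauss sums modulo 12 and 8 (`tsum_gint_R`), and the entries of `Ω_R` are then
checked in `ℚ(ζ₄₈)` (`classSum_R`).

For `H = Ĥ`, the norm of the Gaussian is `exp(-2πτ₂|Q| cosh(2t - θ))`, with `θ` twice the hyperbolic
angle of `n`. Integration over `[-T, T]` gives `K₀` with its sign factor plus an odd function of `2t
- θ` at each endpoint (`thetaHatTerm_eq_add_tailTerm`). The integral reflection of `Q` that fixes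
`c_j` exchanges `ℤ² + μ_j` and `ℤ² + μ_j + λ` and changes the sign of `2t_j - θ`, so the endpoint
terms cancel in the sum over the two cosets (`tsum_tailTerm`). Smoothness and the eigenvalue
equation follow by differentiating `∑ c K₀` under one integral sign.

For the representation, `T` acts on the four components by distinct scalars and `Ĥ_j(i) ≠ 0`, so a
Vandermonde argument makes the components linearly independent (`eq_zero_of_sum_mul_Hhat_eq_zero`).
The matrix attached to an element is therefore unique, hence multiplicative; it exists because `T`,
`R` and the upper triangular matrices exhaust `Γ₀(2)` by a Euclidean descent. -/

theorem summable_exp_neg_sq {c : ℝ} (hc : 0 < c) (μ : ℝ) :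
    Summable fun n : ℤ => Real.exp (-c * ((n : ℝ) + μ) ^ 2) := by
  have hτ : 0 < ((c / π : ℝ) * I : ℂ).im := by
    simpa using div_pos hc Real.pi_pos
  have h := ((summable_jacobiTheta₂_term_iff ((c * μ / π : ℝ) * I) ((c / π : ℝ) * I)).2
    hτ).norm.mul_left (Real.exp (-c * μ ^ 2))
  refine h.congr fun n => ?_
  rw [norm_jacobiTheta₂_term, ← Real.exp_add]
  congr 1
  simp only [mul_I_im, ofReal_re]
  field_simp
  ring

theorem summable_prod_of_norm_le_exp {f : ℤ × ℤ → ℂ} {c : ℝ} (hc : 0 < c) (C μ ν : ℝ)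
    (hf : ∀ p : ℤ × ℤ,
      ‖f p‖ ≤ C * Real.exp (-c * (((p.1 : ℝ) + μ) ^ 2 + ((p.2 : ℝ) + ν) ^ 2))) :
    Summable f := by
  refine Summable.of_norm_bounded (((summable_exp_neg_sq hc μ).mul_of_nonneg
    (summable_exp_neg_sq hc ν) (fun _ => (Real.exp_pos _).le)
    (fun _ => (Real.exp_pos _).le)).mul_left C) fun p => (hf p).trans_eq ?_
  rw [← Real.exp_add]
  congr 2
  ring

/-- Up to an exponential factor the sum is `jacobiTheta₂` at `aμ + b`, so the functional equation of
the latter is Poisson summation for a shifted Gaussian. -/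
theorem tsum_gaussian_shift (a b : ℂ) (μ : ℝ) (ha : 0 < a.im) :
    ∑' n : ℤ, cexp (π * I * (a * (n + μ) ^ 2 + 2 * b * (n + μ))) =
      1 / (-I * a) ^ (1 / 2 : ℂ) *
        ∑' m : ℤ, cexp (2 * π * I * m * μ) * cexp (-π * I * (m - b) ^ 2 / a) := by
  have ha0 : a ≠ 0 := fun h => by simp [h] at ha
  have h1 : ∑' n : ℤ, cexp (π * I * (a * (n + μ) ^ 2 + 2 * b * (n + μ))) =
      cexp (π * I * (a * μ ^ 2 + 2 * b * μ)) * jacobiTheta₂ (a * μ + b) a := by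
    rw [jacobiTheta₂, ← tsum_mul_left]
    refine tsum_congr fun n => ?_
    rw [jacobiTheta₂_term, ← Complex.exp_add]
    congr 1
    ring
  rw [h1, jacobiTheta₂_functional_equation, jacobiTheta₂, ← tsum_mul_left, ← tsum_mul_left,
    ← tsum_mul_left]
  refine tsum_congr fun n => ?_
  rw [jacobiTheta₂_term]
  have h2 : cexp (2 * π * I * n * μ) * cexp (-π * I * (n - b) ^ 2 / a) =
      cexp (π * I * (a * μ ^ 2 + 2 * b * μ)) * (cexp (-π * I * (a * μ + b) ^ 2 / a) *
        cexp (2 * π * I * n * ((a * μ + b) / a) + π * I * n ^ 2 * (-1 / a))) := by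
    rw [← Complex.exp_add, ← Complex.exp_add, ← Complex.exp_add]
    congr 1
    field_simp
    ring
  rw [h2]
  ring

/-- The norm of the partial Fourier transform of a binary Gaussian. -/
theorem norm_partial_gaussian_le {α β δ : ℂ} (hα : 0 < α.im) (hβ : β.im ^ 2 < α.im * δ.im) :
    ∃ c > 0, ∀ m v : ℝ,
      ‖cexp (π * I * (δ * v ^ 2 - (m - β * v) ^ 2 / α))‖ ≤ Real.exp (-c * (m ^ 2 + v ^ 2)) := by
  have hN : 0 < normSq α := normSq_pos.2 fun h => by simp [h] at hα
  set A := α.im / normSq α with hA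
  set s := β.re - β.im * α.re / α.im with hs
  set B := δ.im - β.im ^ 2 / α.im with hB
  have hA0 : 0 < A := div_pos hα hN
  have hB0 : 0 < B := by
    rw [hB, sub_pos, div_lt_iff₀ hα]; linarith
  -- Chosen so that `K` times the form `A(m - sv)² + Bv²` dominates `m² + v²`, by `m² ≤ 2(m - sv)² +
  -- 2s²v²`.
  set K := 2 / A + (2 * s ^ 2 + 1) / B with hK
  have hK0 : 0 < K := by positivity
  refine ⟨π / K, by positivity, fun m v => ?_⟩
  have him : (δ * v ^ 2 - (m - β * v) ^ 2 / α).im = A * (m - s * v) ^ 2 + B * v ^ 2 := by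
    have h1 : ((m - β * v) ^ 2 / α).im =
        (2 * (m - β.re * v) * (-(β.im * v)) * α.re
          - ((m - β.re * v) ^ 2 - (β.im * v) ^ 2) * α.im) / normSq α := by
      rw [Complex.div_im]
      simp [pow_two]
      field_simp
      ring
    rw [Complex.sub_im, h1]
    have h2 : (δ * v ^ 2).im = δ.im * v ^ 2 := by
      rw [← ofReal_pow, Complex.im_mul_ofReal]
    rw [h2, hA, hs, hB]
    rw [normSq_apply] at hN ⊢
    field_simp
    ring
  rw [Complex.norm_exp]
  have hre : (π * I * (δ * v ^ 2 - (m - β * v) ^ 2 / α)).re =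
      -π * (δ * v ^ 2 - (m - β * v) ^ 2 / α).im := by
    rw [show (π * I * (δ * v ^ 2 - (m - β * v) ^ 2 / α) : ℂ) =
      (π : ℝ) * (I * (δ * v ^ 2 - (m - β * v) ^ 2 / α)) by ring, Complex.re_ofReal_mul, I_mul_re]
    ring
  rw [hre, him]
  apply Real.exp_le_exp.2
  have key : m ^ 2 + v ^ 2 ≤ K * (A * (m - s * v) ^ 2 + B * v ^ 2) := by
    have e1 : K * (A * (m - s * v) ^ 2 + B * v ^ 2) =
        2 * (m - s * v) ^ 2 + (2 * s ^ 2 + 1) * v ^ 2 + 2 / A * (B * v ^ 2)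
          + (2 * s ^ 2 + 1) / B * (A * (m - s * v) ^ 2) := by
      rw [hK]; field_simp; ring
    have e2 : 0 ≤ 2 / A * (B * v ^ 2) := by positivity
    have e3 : 0 ≤ (2 * s ^ 2 + 1) / B * (A * (m - s * v) ^ 2) := by positivity
    nlinarith [sq_nonneg (m - 2 * s * v)]
  have : π / K * (m ^ 2 + v ^ 2) ≤ π * (A * (m - s * v) ^ 2 + B * v ^ 2) := by
    rw [div_mul_eq_mul_div, div_le_iff₀ hK0]
    nlinarith [Real.pi_pos]
  linarith

/-- Poisson summation in one variable at a time. After the first, the Gaussian in the second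
variable has as parameter the Schur complement `δ - β²/α`. The mixed series, transformed in one
variable only, converges absolutely by `norm_partial_gaussian_le`, which permits the change of order
between the two steps. -/
theorem tsum_binary_gaussian {α β δ : ℂ} (μ ν : ℝ) (hα : 0 < α.im)
    (hβ : β.im ^ 2 < α.im * δ.im)
    (hs : Summable fun p : ℤ × ℤ => cexp (π * I * (α * (p.1 + μ) ^ 2
      + 2 * β * (p.1 + μ) * (p.2 + ν) + δ * (p.2 + ν) ^ 2)))
    (hs' : Summable fun p : ℤ × ℤ => cexp (2 * π * I * (p.1 * μ + p.2 * ν)) *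
      cexp (-π * I * (δ * p.1 ^ 2 - 2 * β * p.1 * p.2 + α * p.2 ^ 2) / (α * δ - β ^ 2))) :
    ∑' p : ℤ × ℤ, cexp (π * I * (α * (p.1 + μ) ^ 2
      + 2 * β * (p.1 + μ) * (p.2 + ν) + δ * (p.2 + ν) ^ 2)) =
    1 / (-I * α) ^ (1 / 2 : ℂ) * (1 / (-I * (δ - β ^ 2 / α)) ^ (1 / 2 : ℂ)) *
      ∑' p : ℤ × ℤ, cexp (2 * π * I * (p.1 * μ + p.2 * ν)) *
        cexp (-π * I * (δ * p.1 ^ 2 - 2 * β * p.1 * p.2 + α * p.2 ^ 2) / (α * δ - β ^ 2)) := by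
  have hα0 : α ≠ 0 := fun h => by simp [h] at hα
  have hN : 0 < normSq α := normSq_pos.2 hα0
  -- Read off from the decay of the partial transform at `(m, v) = (0, 1)`.
  have hδ' : 0 < (δ - β ^ 2 / α).im := by
    obtain ⟨c, hc, h⟩ := norm_partial_gaussian_le hα hβ
    have h1 := h 0 1
    rw [Complex.norm_exp] at h1
    have h2 := Real.exp_le_exp.1 h1
    have h3 : (π * I * (δ * (1 : ℝ) ^ 2 - ((0 : ℝ) - β * (1 : ℝ)) ^ 2 / α) : ℂ) =
      (π : ℝ) * (I * (δ - β ^ 2 / α)) := by push_cast; ring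
    rw [h3, Complex.re_ofReal_mul, I_mul_re] at h2
    have : 0 < π * (δ - β ^ 2 / α).im := by nlinarith
    exact pos_of_mul_pos_right this Real.pi_pos.le
  set D := δ - β ^ 2 / α with hD
  have hD0 : D ≠ 0 := fun h => by simp [h] at hδ'
  have hdet : α * δ - β ^ 2 = α * D := by rw [hD]; field_simp
  have hdet0 : α * δ - β ^ 2 ≠ 0 := by rw [hdet]; exact mul_ne_zero hα0 hD0
  have hmid : Summable fun p : ℤ × ℤ => cexp (2 * π * I * p.1 * μ) *
      cexp (π * I * (δ * (p.2 + ν) ^ 2 - (p.1 - β * (p.2 + ν)) ^ 2 / α)) := by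
    obtain ⟨c, hc, h⟩ := norm_partial_gaussian_le hα hβ
    refine summable_prod_of_norm_le_exp hc 1 0 ν fun p => ?_
    have h1 : ‖cexp (2 * π * I * p.1 * μ)‖ = 1 := by
      rw [show (2 * π * I * p.1 * μ : ℂ) = ((2 * π * p.1 * μ : ℝ) : ℂ) * I by push_cast; ring,
        Complex.norm_exp_ofReal_mul_I]
    rw [norm_mul, h1, one_mul, one_mul]
    have h2 := h p.1 (p.2 + ν)
    push_cast at h2
    simpa using h2
  rw [hs.tsum_prod, hs'.tsum_prod]
  calc ∑' (m : ℤ) (n : ℤ), cexp (π * I * (α * (m + μ) ^ 2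
      + 2 * β * (m + μ) * (n + ν) + δ * (n + ν) ^ 2))
      = ∑' (n : ℤ) (m : ℤ), cexp (π * I * (α * (m + μ) ^ 2
      + 2 * β * (m + μ) * (n + ν) + δ * (n + ν) ^ 2)) := by
        rw [Summable.tsum_comm]
        exact hs.prod_symm
    _ = ∑' n : ℤ, 1 / (-I * α) ^ (1 / 2 : ℂ) * ∑' m : ℤ, cexp (2 * π * I * m * μ) *
          cexp (π * I * (δ * (n + ν) ^ 2 - (m - β * (n + ν)) ^ 2 / α)) := by
        refine tsum_congr fun n => ?_
        have h := tsum_gaussian_shift α (β * (n + ν)) μ hα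
        have h' : ∀ m : ℤ, cexp (π * I * (α * (m + μ) ^ 2
            + 2 * β * (m + μ) * (n + ν) + δ * (n + ν) ^ 2)) =
            cexp (π * I * (δ * (n + ν) ^ 2)) *
              cexp (π * I * (α * (m + μ) ^ 2 + 2 * (β * (n + ν)) * (m + μ))) := fun m => by
          rw [← Complex.exp_add]; congr 1; ring
        simp_rw [h']
        rw [tsum_mul_left, h, ← mul_assoc, mul_comm (cexp _), mul_assoc, ← tsum_mul_left]
        congr 1
        refine tsum_congr fun m => ?_
        rw [mul_left_comm, ← Complex.exp_add]
        congr 2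
        ring
    _ = 1 / (-I * α) ^ (1 / 2 : ℂ) * ∑' (m : ℤ) (n : ℤ), cexp (2 * π * I * m * μ) *
          cexp (π * I * (δ * (n + ν) ^ 2 - (m - β * (n + ν)) ^ 2 / α)) := by
        rw [tsum_mul_left, Summable.tsum_comm]
        exact hmid
    _ = 1 / (-I * α) ^ (1 / 2 : ℂ) * ∑' m : ℤ, 1 / (-I * D) ^ (1 / 2 : ℂ) *
          ∑' n : ℤ, cexp (2 * π * I * (m * μ + n * ν)) *
        cexp (-π * I * (δ * m ^ 2 - 2 * β * m * n + α * n ^ 2) / (α * δ - β ^ 2)) := by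
        congr 1
        refine tsum_congr fun m => ?_
        have h := tsum_gaussian_shift D (m * β / α) ν hδ'
        have h' : ∀ n : ℤ, cexp (2 * π * I * m * μ) *
            cexp (π * I * (δ * (n + ν) ^ 2 - (m - β * (n + ν)) ^ 2 / α)) =
            cexp (2 * π * I * m * μ - π * I * m ^ 2 / α) *
              cexp (π * I * (D * (n + ν) ^ 2 + 2 * (m * β / α) * (n + ν))) := fun n => by
          rw [← Complex.exp_add, ← Complex.exp_add]
          congr 1
          rw [hD]
          field_simp
          ring
        simp_rw [h']
        rw [tsum_mul_left, h, ← mul_assoc, mul_comm (cexp _), mul_assoc, ← tsum_mul_left]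
        congr 1
        refine tsum_congr fun n => ?_
        rw [← Complex.exp_add, ← Complex.exp_add, ← Complex.exp_add]
        congr 1
        have hδe : δ = D + β ^ 2 / α := by rw [hD]; ring
        rw [hdet, hδe]
        field_simp
        ring
    _ = _ := by
        rw [tsum_mul_left]
        ring

/-- Since `uv > 0`, `v` is a positive multiple of the conjugate of `u`. Both lie in the right
half-plane, so no branch of the logarithm is crossed. -/
theorem cpow_half_mul_cpow_half {u v : ℂ} {ρ : ℝ} (hu : 0 < u.re) (hρ : 0 < ρ)
    (huv : u * v = ρ) : u ^ (1 / 2 : ℂ) * v ^ (1 / 2 : ℂ) = √ρ := by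
  have hu0 : u ≠ 0 := fun h => by simp [h] at hu
  have hv : v = (ρ / normSq u : ℝ) * (starRingEnd ℂ) u := by
    have h := Complex.mul_conj u
    have hN : ((normSq u : ℝ) : ℂ) ≠ 0 := by exact_mod_cast (normSq_pos.2 hu0).ne'
    apply mul_left_cancel₀ hu0
    rw [huv, mul_left_comm, h]
    push_cast
    field_simp
  have hvre : 0 < v.re := by
    rw [hv, Complex.re_ofReal_mul, conj_re]
    exact mul_pos (div_pos hρ (normSq_pos.2 hu0)) hu
  have hv0 : v ≠ 0 := fun h => by simp [h] at hvre
  have h1 := abs_lt.1 (abs_arg_lt_pi_div_two_iff.2 (Or.inl hu))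
  have h2 := abs_lt.1 (abs_arg_lt_pi_div_two_iff.2 (Or.inl hvre))
  have h3 : u ^ (1 / 2 : ℂ) * v ^ (1 / 2 : ℂ) = (u * v) ^ (1 / 2 : ℂ) := by
    rw [Complex.cpow_def_of_ne_zero hu0, Complex.cpow_def_of_ne_zero hv0,
      Complex.cpow_def_of_ne_zero (mul_ne_zero hu0 hv0), ← Complex.exp_add,
      Complex.log_mul hu0 hv0 ⟨by linarith, by linarith⟩]
    congr 1
    ring
  rw [h3, huv, Real.sqrt_eq_rpow, Complex.ofReal_cpow hρ.le]
  norm_num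

/-! ### The Siegel Gaussian of signature `(1, 1)` -/

/-- `exp(2πi(τ X² - conj τ Y²))`, where `(X, Y)` is the image of `(√6 a, 2 b)` under the boost of
parameter `t`. -/
noncomputable def gauss (t : ℝ) (τ : ℂ) (a b : ℝ) : ℂ :=
  cexp (2 * π * I * (τ * ((√6 * a * Real.cosh t - 2 * b * Real.sinh t : ℝ) : ℂ) ^ 2
    - (starRingEnd ℂ) τ * ((2 * b * Real.cosh t - √6 * a * Real.sinh t : ℝ) : ℂ) ^ 2))

theorem norm_gauss (t : ℝ) (τ : ℂ) (a b : ℝ) :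
    ‖gauss t τ a b‖ = Real.exp (-(2 * π * τ.im) * ((√6 * a * Real.cosh t - 2 * b * Real.sinh t) ^ 2
      + (2 * b * Real.cosh t - √6 * a * Real.sinh t) ^ 2)) := by
  rw [gauss, Complex.norm_exp]
  generalize √6 * a * Real.cosh t - 2 * b * Real.sinh t = x
  generalize 2 * b * Real.cosh t - √6 * a * Real.sinh t = y
  congr 1
  rw [← ofReal_pow, ← ofReal_pow]
  simp [Complex.mul_re, Complex.mul_im, -ofReal_pow]
  ring

/-- In the light-cone coordinates `x ∓ y` the boost is diagonal with entries `e^{±t}`. -/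
theorem exp_neg_mul_le_boost (t x y : ℝ) :
    Real.exp (-2 * |t|) * (x ^ 2 + y ^ 2) ≤
      (x * Real.cosh t - y * Real.sinh t) ^ 2 + (y * Real.cosh t - x * Real.sinh t) ^ 2 := by
  have h1 : (x * Real.cosh t - y * Real.sinh t) ^ 2 + (y * Real.cosh t - x * Real.sinh t) ^ 2 =
      (Real.exp (2 * t) * (x - y) ^ 2 + Real.exp (-(2 * t)) * (x + y) ^ 2) / 2 := by
    rw [Real.cosh_eq, Real.sinh_eq, two_mul t, neg_add, Real.exp_add, Real.exp_add]
    ring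
  have h2 : Real.exp (-2 * |t|) ≤ Real.exp (2 * t) :=
    Real.exp_le_exp.2 (by linarith [neg_abs_le t])
  have h3 : Real.exp (-2 * |t|) ≤ Real.exp (-(2 * t)) :=
    Real.exp_le_exp.2 (by linarith [le_abs_self t])
  rw [h1]
  nlinarith [sq_nonneg (x - y), sq_nonneg (x + y)]

/-- A bound uniform over `|t| ≤ T`, as needed to integrate series over `t`. The constant is `8π = 2π
· 4`, from `6a² + 4b² ≥ 4(a² + b²)`. -/
theorem norm_gauss_le {t T : ℝ} (ht : |t| ≤ T) {τ : ℂ} (hτ : 0 < τ.im) (a b : ℝ) :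
    ‖gauss t τ a b‖ ≤ Real.exp (-(8 * π * Real.exp (-2 * T) * τ.im) * (a ^ 2 + b ^ 2)) := by
  rw [norm_gauss]
  apply Real.exp_le_exp.2
  have h1 := exp_neg_mul_le_boost t (√6 * a) (2 * b)
  have h6 : √6 ^ 2 = 6 := Real.sq_sqrt (by norm_num)
  have h2 : Real.exp (-2 * T) ≤ Real.exp (-2 * |t|) := Real.exp_le_exp.2 (by linarith)
  have h3 : Real.exp (-2 * T) * (4 * (a ^ 2 + b ^ 2)) ≤
      Real.exp (-2 * |t|) * ((√6 * a) ^ 2 + (2 * b) ^ 2) := by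
    apply mul_le_mul h2 _ (by positivity) (Real.exp_pos _).le
    rw [mul_pow, h6]
    nlinarith [sq_nonneg a]
  have h4 := mul_le_mul_of_nonneg_left (h3.trans h1) (by positivity : 0 ≤ 2 * π * τ.im)
  linarith

/-- The boost preserves `X² - Y² = Q`, so a real translation only produces a phase, which does not
depend on `t`. -/
theorem gauss_add_real (t : ℝ) (τ : ℂ) (s a b : ℝ) :
    gauss t (τ + s) a b = e (s * (6 * a ^ 2 - 4 * b ^ 2)) * gauss t τ a b := by
  rw [gauss, gauss, e, ← Complex.exp_add]
  congr 1
  have h6 : ((√6 : ℝ) : ℂ) ^ 2 = 6 := by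
    rw [← ofReal_pow, Real.sq_sqrt (by norm_num)]; norm_num
  have hc : ((Real.cosh t : ℝ) : ℂ) ^ 2 = ((Real.sinh t : ℝ) : ℂ) ^ 2 + 1 := by
    exact_mod_cast Real.cosh_sq t
  rw [map_add, conj_ofReal]
  simp only [ofReal_sub, ofReal_mul, ofReal_pow, ofReal_ofNat]
  linear_combination (2 * π * I * s * ((√6 : ℝ) ^ 2 * a ^ 2 - 4 * b ^ 2) : ℂ) * hc +
    (2 * π * I * s * a ^ 2 : ℂ) * h6

theorem continuous_gauss (τ : ℂ) (a b : ℝ) : Continuous fun t => gauss t τ a b := by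
  unfold gauss
  have h1 := Real.continuous_cosh
  have h2 := Real.continuous_sinh
  fun_prop

theorem gauss_neg_left (t : ℝ) (τ : ℂ) (a b : ℝ) : gauss t τ (-a) b = gauss (-t) τ a b := by
  simp only [gauss, Real.cosh_neg, Real.sinh_neg]
  congr 1
  push_cast
  ring

theorem gauss_neg_neg (t : ℝ) (τ : ℂ) (a b : ℝ) : gauss t τ (-a) (-b) = gauss t τ a b := by
  simp only [gauss]
  congr 1
  push_cast
  ring

theorem summable_gauss (t : ℝ) {τ : ℂ} (hτ : 0 < τ.im) (μ ν : ℝ) :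
    Summable fun p : ℤ × ℤ => gauss t τ (p.1 + μ) (p.2 + ν) :=
  summable_prod_of_norm_le_exp (c := 8 * π * Real.exp (-2 * |t|) * τ.im) (by positivity) 1 μ ν
    fun p => by rw [one_mul]; exact norm_gauss_le le_rfl hτ _ _

theorem summable_mul_gauss_div (t : ℝ) {τ : ℂ} (hτ : 0 < τ.im) {w : ℤ × ℤ → ℂ}
    (hw : ∀ p, ‖w p‖ ≤ 1) :
    Summable fun p : ℤ × ℤ => w p * gauss t τ (p.1 / 12) (p.2 / 8) := by
  refine summable_prod_of_norm_le_exp (c := 8 * π * Real.exp (-2 * |t|) * τ.im / 144)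
    (by positivity) 1 0 0 fun p => ?_
  rw [norm_mul, one_mul]
  refine (mul_le_of_le_one_left (norm_nonneg _) (hw p)).trans
    ((norm_gauss_le le_rfl hτ _ _).trans (Real.exp_le_exp.2 ?_))
  have : (0 : ℝ) ≤ 8 * π * Real.exp (-2 * |t|) * τ.im := by positivity
  nlinarith [mul_nonneg this (sq_nonneg (p.2 : ℝ))]

theorem e_add (x y : ℝ) : e (x + y) = e x * e y := by
  rw [e, e, e, ← Complex.exp_add]; congr 1; push_cast; ring

theorem norm_e (x : ℝ) : ‖e x‖ = 1 := by
  rw [e, show (2 * π * I * x : ℂ) = ((2 * π * x : ℝ) : ℂ) * I by push_cast; ring,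
    Complex.norm_exp_ofReal_mul_I]

theorem e_intCast (n : ℤ) : e n = 1 := by
  rw [e, ← Complex.exp_int_mul_two_pi_mul_I n]
  congr 1
  push_cast
  ring

/-- The Gaussian at `-1/τ` is a binary Gaussian with matrix entries `α, β, δ`. Its inverse form is
again a Siegel Gaussian with the same boost, now at `τ` and on the dual lattice `(1/12)ℤ × (1/8)ℤ`;
the factor comes from a determinant that does not depend on `t`. -/
theorem tsum_gauss_neg_inv (t : ℝ) {τ : ℂ} (hτ : 0 < τ.im) (μ ν : ℝ) :
    ∑' p : ℤ × ℤ, gauss t (-1 / τ) (p.1 + μ) (p.2 + ν) =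
      (‖τ‖ / √96 : ℝ) * ∑' p : ℤ × ℤ, e (p.1 * μ - p.2 * ν) * gauss t τ (p.1 / 12) (p.2 / 8) := by
  have hτ0 : τ ≠ 0 := fun h => by simp [h] at hτ
  have hcτ0 : (starRingEnd ℂ) τ ≠ 0 := (map_ne_zero _).2 hτ0
  set σ := -1 / τ with hσ
  have hN : 0 < normSq τ := normSq_pos.2 hτ0
  have hσim : σ.im = τ.im / normSq τ := by rw [hσ]; simp [neg_div]
  have hσ0 : 0 < σ.im := by rw [hσim]; exact div_pos hτ hN
  set C := Real.cosh t with hC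
  set S := Real.sinh t with hS
  have hCS : C ^ 2 = S ^ 2 + 1 := Real.cosh_sq t
  have h6 : √6 ^ 2 = 6 := Real.sq_sqrt (by norm_num)
  have h6c : ((√6 : ℝ) : ℂ) ^ 2 = 6 := by rw [← ofReal_pow, h6]; norm_num
  have hCSc : (C : ℂ) ^ 2 = (S : ℂ) ^ 2 + 1 := by exact_mod_cast hCS
  set α : ℂ := ((12 : ℝ) : ℂ) * (σ * (C ^ 2 : ℝ) - (starRingEnd ℂ) σ * (S ^ 2 : ℝ)) with hα
  set δ : ℂ := ((8 : ℝ) : ℂ) * (σ * (S ^ 2 : ℝ) - (starRingEnd ℂ) σ * (C ^ 2 : ℝ)) with hδ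
  set β : ℂ := ((-4 * √6 * C * S : ℝ) : ℂ) * (σ - (starRingEnd ℂ) σ) with hβ
  have hαim : α.im = 12 * σ.im * (C ^ 2 + S ^ 2) := by
    rw [hα, Complex.im_ofReal_mul, Complex.sub_im, Complex.im_mul_ofReal, Complex.im_mul_ofReal,
      conj_im]
    ring
  have hδim : δ.im = 8 * σ.im * (C ^ 2 + S ^ 2) := by
    rw [hδ, Complex.im_ofReal_mul, Complex.sub_im, Complex.im_mul_ofReal, Complex.im_mul_ofReal,
      conj_im]
    ring
  have hβim : β.im = -8 * √6 * C * S * σ.im := by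
    rw [hβ, Complex.im_ofReal_mul, Complex.sub_im, conj_im]
    ring
  have hα0 : 0 < α.im := by
    rw [hαim, hCS]; positivity
  have hpos : β.im ^ 2 < α.im * δ.im := by
    have h1 : α.im * δ.im - β.im ^ 2 = 96 * σ.im ^ 2 := by
      rw [hαim, hδim, hβim]
      linear_combination (96 * σ.im ^ 2 * (C ^ 2 - S ^ 2 + 1)) * hCS
        - 64 * C ^ 2 * S ^ 2 * σ.im ^ 2 * h6
    have : 0 < 96 * σ.im ^ 2 := by positivity
    linarith
  have hg1 : ∀ a b : ℝ, gauss t σ a b =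
      cexp (π * I * (α * a ^ 2 + 2 * β * a * b + δ * b ^ 2)) := fun a b => by
    rw [gauss, ← hC, ← hS]
    congr 1
    rw [hα, hβ, hδ]
    push_cast
    linear_combination (2 * π * I * a ^ 2 * (σ * C ^ 2 - (starRingEnd ℂ) σ * S ^ 2)) * h6c
  -- By `cosh² - sinh² = 1` only `-96 σσ̄` survives: the determinant is real, negative and
  -- independent of `t`.
  have hdet : α * δ - β ^ 2 = ((-(96 / normSq τ) : ℝ) : ℂ) := by
    have h1 : α * δ - β ^ 2 = -96 * (σ * (starRingEnd ℂ) σ) := by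
      rw [hα, hβ, hδ]
      push_cast
      linear_combination (-96 * (σ * (starRingEnd ℂ) σ) * (C ^ 2 - S ^ 2 + 1)) * hCSc
        - 16 * C ^ 2 * S ^ 2 * (σ - (starRingEnd ℂ) σ) ^ 2 * h6c
    rw [h1, Complex.mul_conj, hσ, normSq_div]
    simp
    ring
  have hg2 : ∀ m n : ℤ, -π * I * (δ * m ^ 2 - 2 * β * m * n + α * n ^ 2) / (α * δ - β ^ 2) =
      2 * π * I * (τ * ((√6 * (m / 12) * C - 2 * (-n / 8) * S : ℝ) : ℂ) ^ 2
      - (starRingEnd ℂ) τ * ((2 * (-n / 8) * C - √6 * (m / 12) * S : ℝ) : ℂ) ^ 2) := fun m n => by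
    have hNc : (normSq τ : ℂ) = τ * (starRingEnd ℂ) τ := (Complex.mul_conj τ).symm
    have hσc : (starRingEnd ℂ) σ = -1 / (starRingEnd ℂ) τ := by
      rw [hσ, map_div₀, map_neg, map_one]
    rw [hdet, hα, hβ, hδ, hσc, hσ]
    push_cast
    rw [hNc]
    field_simp
    ring_nf
    simp only [h6c]
    ring
  have hg3 : ∀ m n : ℤ, cexp (2 * π * I * (m * μ + n * ν)) *
      cexp (-π * I * (δ * m ^ 2 - 2 * β * m * n + α * n ^ 2) / (α * δ - β ^ 2)) =
      e (m * μ + n * ν) * gauss t τ (m / 12) (-n / 8) := fun m n => by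
    rw [hg2, gauss, e, ← hC, ← hS]
    push_cast
    rfl
  have hs' : Summable fun p : ℤ × ℤ => e (p.1 * μ - p.2 * ν) * gauss t τ (p.1 / 12) (p.2 / 8) :=
    summable_mul_gauss_div t hτ fun p => (norm_e _).le
  -- The vector dual to `(m, n)` under `B` is `(m/12, -n/8)`; replacing `n` by `-n` moves the sign
  -- into the phase.
  have heq : (fun p : ℤ × ℤ => e (p.1 * μ + p.2 * ν) * gauss t τ (p.1 / 12) (-p.2 / 8)) =
      (fun p : ℤ × ℤ => e (p.1 * μ - p.2 * ν) * gauss t τ (p.1 / 12) (p.2 / 8)) ∘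
        (Equiv.prodCongr (Equiv.refl ℤ) (Equiv.neg ℤ)) := by
    funext p
    simp
  have h := tsum_binary_gaussian μ ν hα0 hpos ?_ ?_
  · simp_rw [hg3] at h
    rw [heq, show ∀ f : ℤ × ℤ → ℂ, tsum (f ∘ Equiv.prodCongr (Equiv.refl ℤ) (Equiv.neg ℤ)) = tsum f
      from fun f => Equiv.tsum_eq _ f] at h
    simp_rw [hg1]
    push_cast at h ⊢
    rw [h]
    congr 1
    have hαne : α ≠ 0 := fun h => by simp [h] at hα0
    have hp := cpow_half_mul_cpow_half (u := -I * α) (v := -I * (δ - β ^ 2 / α))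
      (ρ := 96 / normSq τ) (by simpa using hα0) (by positivity) (by
        have : -I * α * (-I * (δ - β ^ 2 / α)) = -(α * δ - β ^ 2) := by
          field_simp
          rw [I_sq]
          ring
        rw [this, hdet]
        push_cast
        ring)
    rw [div_mul_div_comm, hp, Real.sqrt_div (by norm_num), ← Complex.norm_def]
    push_cast
    rw [one_mul, one_div_div]
  · refine (summable_gauss t hσ0 μ ν).congr fun p => ?_
    rw [hg1]
    push_cast
    rfl
  · simp_rw [hg3]
    rw [heq, Equiv.summable_iff]
    exact hs'
end MockMaass

namespace MockMaass
open Complex Real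

/-! ### The integrated Siegel Gaussian -/

/-- The integral of `gauss` over the symmetric geodesic segment `[-T, T]`. -/
noncomputable def gint (T : ℝ) (τ : ℂ) (a b : ℝ) : ℂ := ∫ t in (-T)..T, gauss t τ a b

theorem norm_gint_le {T : ℝ} (hT : 0 ≤ T) {τ : ℂ} (hτ : 0 < τ.im) (a b : ℝ) :
    ‖gint T τ a b‖ ≤
      2 * T * Real.exp (-(8 * π * Real.exp (-2 * T) * τ.im) * (a ^ 2 + b ^ 2)) := by
  have h := intervalIntegral.norm_integral_le_of_norm_le_const (a := -T) (b := T)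
    (f := fun t => gauss t τ a b)
    (C := Real.exp (-(8 * π * Real.exp (-2 * T) * τ.im) * (a ^ 2 + b ^ 2))) (fun t ht => by
      rw [Set.uIoc_of_le (by linarith)] at ht
      exact norm_gauss_le (abs_le.2 ⟨ht.1.le, ht.2⟩) hτ a b)
  rw [sub_neg_eq_add, abs_of_nonneg (by linarith)] at h
  rw [gint]
  linarith

theorem gint_add_real (T : ℝ) (τ : ℂ) (s a b : ℝ) :
    gint T (τ + s) a b = e (s * (6 * a ^ 2 - 4 * b ^ 2)) * gint T τ a b := by
  simp_rw [gint, gauss_add_real]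
  exact intervalIntegral.integral_const_mul _ _

/-- Substitution `t ↦ -t` on the symmetric segment. Evenness in each coordinate separately
identifies the residue classes `±a` and `±b` later on. -/
theorem gint_neg_left (T : ℝ) (τ : ℂ) (a b : ℝ) : gint T τ (-a) b = gint T τ a b := by
  simp_rw [gint, gauss_neg_left]
  rw [intervalIntegral.integral_comp_neg (fun t => gauss t τ a b), neg_neg]

theorem gint_neg_right (T : ℝ) (τ : ℂ) (a b : ℝ) : gint T τ a (-b) = gint T τ a b := by
  rw [← gint_neg_left]
  simp_rw [gint, gauss_neg_neg]

/-- Dominated convergence with the bound of `norm_gauss_le`. The weights `w` and points `(a p, b p)`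
are left general so that both shifted lattices and the dual lattice with phases are covered. -/
theorem tsum_mul_gint {T : ℝ} (hT : 0 ≤ T) {τ : ℂ} (hτ : 0 < τ.im) {w : ℤ × ℤ → ℂ}
    (hw : ∀ p, ‖w p‖ ≤ 1) {a b : ℤ × ℤ → ℝ}
    (hs : ∀ c > 0, Summable fun p => Real.exp (-c * (a p ^ 2 + b p ^ 2))) :
    Summable (fun p => w p * gint T τ (a p) (b p)) ∧
      ∑' p, w p * gint T τ (a p) (b p) = ∫ t in (-T)..T, ∑' p, w p * gauss t τ (a p) (b p) := by
  have hc : 0 < 8 * π * Real.exp (-2 * T) * τ.im := by positivity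
  have h := intervalIntegral.hasSum_integral_of_dominated_convergence (μ := MeasureTheory.volume)
    (a := -T) (b := T) (F := fun p t => w p * gauss t τ (a p) (b p))
    (f := fun t => ∑' p, w p * gauss t τ (a p) (b p))
    (fun p _ => Real.exp (-(8 * π * Real.exp (-2 * T) * τ.im) * (a p ^ 2 + b p ^ 2)))
    (fun p => (continuous_const.mul (continuous_gauss τ _ _)).aestronglyMeasurable)
    (fun p => Filter.Eventually.of_forall fun t ht => ?_)
    (Filter.Eventually.of_forall fun t ht => hs _ hc)
    intervalIntegrable_const
    (Filter.Eventually.of_forall fun t ht => ?_)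
  · simp_rw [intervalIntegral.integral_const_mul] at h
    exact ⟨h.summable, h.tsum_eq⟩
  · rw [Set.uIoc_of_le (by linarith)] at ht
    rw [norm_mul]
    exact (mul_le_of_le_one_left (norm_nonneg _) (hw p)).trans
      (norm_gauss_le (abs_le.2 ⟨ht.1.le, ht.2⟩) hτ _ _)
  · rw [Set.uIoc_of_le (by linarith)] at ht
    refine (Summable.of_norm_bounded (hs _ hc) fun p => ?_).hasSum
    rw [norm_mul]
    exact (mul_le_of_le_one_left (norm_nonneg _) (hw p)).trans
      (norm_gauss_le (abs_le.2 ⟨ht.1.le, ht.2⟩) hτ _ _)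

theorem summable_exp_shift {c : ℝ} (hc : 0 < c) (μ ν : ℝ) :
    Summable fun p : ℤ × ℤ => Real.exp (-c * ((p.1 + μ) ^ 2 + (p.2 + ν) ^ 2)) := by
  have h : Summable fun p : ℤ × ℤ =>
      ((Real.exp (-c * ((p.1 + μ) ^ 2 + (p.2 + ν) ^ 2)) : ℝ) : ℂ) :=
    summable_prod_of_norm_le_exp hc 1 μ ν fun p => by
      rw [norm_real, Real.norm_of_nonneg (Real.exp_pos _).le, one_mul]
  exact_mod_cast h

theorem summable_exp_div {c : ℝ} (hc : 0 < c) :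
    Summable fun p : ℤ × ℤ => Real.exp (-c * (((p.1 : ℝ) / 12) ^ 2 + ((p.2 : ℝ) / 8) ^ 2)) := by
  refine Summable.of_nonneg_of_le (fun _ => (Real.exp_pos _).le) (fun p => ?_)
    (summable_exp_shift (c := c / 144) (by positivity) 0 0)
  apply Real.exp_le_exp.2
  nlinarith [mul_nonneg hc.le (sq_nonneg (p.2 : ℝ))]

theorem tsum_gint_neg_inv {T : ℝ} (hT : 0 ≤ T) {τ : ℂ} (hτ : 0 < τ.im) (μ ν : ℝ) :
    ∑' p : ℤ × ℤ, gint T (-1 / τ) (p.1 + μ) (p.2 + ν) =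
      (‖τ‖ / √96 : ℝ) * ∑' p : ℤ × ℤ, e (p.1 * μ - p.2 * ν) * gint T τ (p.1 / 12) (p.2 / 8) := by
  have hσ : 0 < (-1 / τ).im := by
    rw [neg_div, neg_im, one_div, inv_im, neg_div, neg_neg]
    exact div_pos hτ (normSq_pos.2 fun h => by simp [h] at hτ)
  have h1 := (tsum_mul_gint hT hσ (w := fun _ => 1) (fun _ => by simp)
    (fun c hc => summable_exp_shift hc μ ν)).2
  have h2 := (tsum_mul_gint hT hτ (w := fun p => e (p.1 * μ - p.2 * ν)) (fun _ => (norm_e _).le)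
    (fun c hc => summable_exp_div hc)).2
  simp only [one_mul] at h1
  rw [h1, h2, ← intervalIntegral.integral_const_mul]
  simp_rw [tsum_gauss_neg_inv _ hτ]

/-! ### Residue classes and Gauss sums -/

/-- Division with remainder in both coordinates. -/
def residueEquiv : ℤ × ℤ ≃ (ZMod 12 × ZMod 8) × (ℤ × ℤ) :=
  (Equiv.prodCongr (α₂ := ℤ × ZMod 12) (β₂ := ℤ × ZMod 8) (Int.divModEquiv 12)
    (Int.divModEquiv 8)).trans
    ((Equiv.prodProdProdComm _ _ _ _).trans (Equiv.prodComm _ _))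

theorem residueEquiv_symm_apply (r : ZMod 12 × ZMod 8) (p : ℤ × ℤ) :
    residueEquiv.symm (r, p) = (12 * p.1 + (r.1.val : ℤ), 8 * p.2 + (r.2.val : ℤ)) := by
  simp only [residueEquiv, Equiv.symm_trans_apply, Equiv.prodComm_symm, Equiv.prodComm_apply,
    Prod.swap, Equiv.prodProdProdComm_symm, Equiv.prodProdProdComm_apply]
  ext
  · show p.1 * 12 + _ = _
    rw [mul_comm]; rfl
  · show p.2 * 8 + _ = _
    rw [mul_comm]; rfl

theorem tsum_eq_sum_residues {f : ℤ × ℤ → ℂ} (hf : Summable f) :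
    ∑' p, f p = ∑ α : ZMod 12, ∑ β : ZMod 8,
      ∑' p : ℤ × ℤ, f (12 * p.1 + (α.val : ℤ), 8 * p.2 + (β.val : ℤ)) := by
  have hf' : Summable (f ∘ residueEquiv.symm) := residueEquiv.symm.summable_iff.2 hf
  rw [← residueEquiv.symm.tsum_eq f]
  have h2 := hf'.tsum_prod
  simp only [Function.comp_apply] at h2
  rw [h2, tsum_fintype, Fintype.sum_prod_type]
  simp_rw [residueEquiv_symm_apply]

/-- The theta series over one residue class of the dual lattice. -/
noncomputable def residueSum (T : ℝ) (τ : ℂ) (a b : ℤ) : ℂ :=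
  ∑' p : ℤ × ℤ, gint T τ (p.1 + a / 12) (p.2 + b / 8)

theorem residueSum_add_left (T : ℝ) (τ : ℂ) (a b n : ℤ) :
    residueSum T τ (a + 12 * n) b = residueSum T τ a b := by
  symm
  rw [residueSum, residueSum, ← (Equiv.prodCongr (Equiv.addRight n) (Equiv.refl ℤ)).tsum_eq]
  refine tsum_congr fun p => ?_
  simp only [Equiv.prodCongr_apply, Prod.map, Equiv.coe_addRight, Equiv.refl_apply]
  congr 1
  push_cast
  ring

theorem residueSum_add_right (T : ℝ) (τ : ℂ) (a b n : ℤ) :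
    residueSum T τ a (b + 8 * n) = residueSum T τ a b := by
  symm
  rw [residueSum, residueSum, ← (Equiv.prodCongr (Equiv.refl ℤ) (Equiv.addRight n)).tsum_eq]
  refine tsum_congr fun p => ?_
  simp only [Equiv.prodCongr_apply, Prod.map, Equiv.coe_addRight, Equiv.refl_apply]
  congr 1
  push_cast
  ring

theorem residueSum_neg_left (T : ℝ) (τ : ℂ) (a b : ℤ) :
    residueSum T τ (-a) b = residueSum T τ a b := by
  rw [residueSum, residueSum, ← (Equiv.prodCongr (Equiv.neg ℤ) (Equiv.refl ℤ)).tsum_eq]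
  refine tsum_congr fun p => ?_
  simp only [Equiv.prodCongr_apply, Prod.map, Equiv.neg_apply, Equiv.refl_apply]
  rw [← gint_neg_left]
  congr 1
  push_cast
  ring

theorem residueSum_neg_right (T : ℝ) (τ : ℂ) (a b : ℤ) :
    residueSum T τ a (-b) = residueSum T τ a b := by
  rw [residueSum, residueSum, ← (Equiv.prodCongr (Equiv.refl ℤ) (Equiv.neg ℤ)).tsum_eq]
  refine tsum_congr fun p => ?_
  simp only [Equiv.prodCongr_apply, Prod.map, Equiv.neg_apply, Equiv.refl_apply]
  rw [← gint_neg_right]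
  congr 1
  push_cast
  ring

open ZMod in
/-- The quadratic Gauss sum `∑ exp(2πi(c x - x²)/12)`. -/
noncomputable def gaussSum12 (c : ZMod 12) : ℂ := ∑ x : ZMod 12, stdAddChar (c * x - x ^ 2)

open ZMod in
/-- The quadratic Gauss sum `∑ exp(2πi(x² - c x)/8)`. -/
noncomputable def gaussSum8 (c : ZMod 8) : ℂ := ∑ x : ZMod 8, stdAddChar (x ^ 2 - c * x)

theorem stdAddChar_intCast_eq_e {N : ℕ} [NeZero N] (n : ℤ) :
    ZMod.stdAddChar (n : ZMod N) = e (n / N) := by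
  rw [ZMod.stdAddChar_coe, e]
  congr 1
  push_cast
  ring

/-- This is the sum over residues left by the two Poisson summations in `tsum_gint_R`: it factors
over the coordinates. -/
theorem gaussSum12_mul_gaussSum8 (a p : ZMod 12) (b q : ZMod 8) :
    ∑ α : ZMod 12, ∑ β : ZMod 8, ZMod.stdAddChar (a * α - α ^ 2) *
        ZMod.stdAddChar (β ^ 2 - b * β) * (ZMod.stdAddChar (p * α) *
          ZMod.stdAddChar (-(q * β))) = gaussSum12 (a + p) * gaussSum8 (b + q) := by
  rw [gaussSum12, gaussSum8, Finset.sum_mul_sum]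
  refine Finset.sum_congr rfl fun α _ => Finset.sum_congr rfl fun β _ => ?_
  rw [show (a + p) * α - α ^ 2 = (a * α - α ^ 2) + p * α by ring,
    show β ^ 2 - (b + q) * β = (β ^ 2 - b * β) + -(q * β) by ring,
    AddChar.map_add_eq_mul, AddChar.map_add_eq_mul]
  ring

/-- Here `τ/(2τ + 1) = -1/(-1/τ - 2)`. A Poisson summation leads to the dual lattice, where the
translation by `-2` gives the phase `e(-2Q) = e(-m²/12 + n²/8)`. This depends only on residues, so a
second Poisson summation applies to each class, and the finite sums that remain are Gauss sums. -/
theorem tsum_gint_R {T : ℝ} (hT : 0 ≤ T) {τ : ℂ} (hτ : 0 < τ.im) (a b : ℤ) :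
    residueSum T (τ / (2 * τ + 1)) a b = (‖2 * τ + 1‖ / 96 : ℝ) *
      ∑ α : ZMod 12, ∑ β : ZMod 8, gaussSum12 (a + α) * gaussSum8 (b + β) *
        residueSum T τ α.val β.val := by
  have hτ0 : τ ≠ 0 := fun h => by simp [h] at hτ
  have hσ : 0 < (-1 / τ).im := by
    rw [neg_div, neg_im, one_div, inv_im, neg_div, neg_neg]
    exact div_pos hτ (normSq_pos.2 hτ0)
  have hσ' : 0 < (-1 / τ + ((-2 : ℝ) : ℂ)).im := by rw [add_im, ofReal_im, add_zero]; exact hσ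
  have h21 : 2 * τ + 1 ≠ 0 := fun h => by
    have := congrArg im h
    simp at this
    exact hτ.ne' this
  have hτ' : -1 / τ + ((-2 : ℝ) : ℂ) = -((2 * τ + 1) / τ) := by push_cast; field_simp; ring
  have e1 : τ / (2 * τ + 1) = -1 / (-1 / τ + ((-2 : ℝ) : ℂ)) := by
    rw [hτ']; field_simp
  rw [residueSum, e1, tsum_gint_neg_inv hT hσ']
  set W : ℤ × ℤ → ℂ := fun p => ZMod.stdAddChar ((a * p.1 - p.1 ^ 2 : ℤ) : ZMod 12) *
    ZMod.stdAddChar ((p.2 ^ 2 - b * p.2 : ℤ) : ZMod 8) with hW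
  have hWe : ∀ p : ℤ × ℤ, e (p.1 * (a / 12) - p.2 * (b / 8)) *
      gint T (-1 / τ + ((-2 : ℝ) : ℂ)) (p.1 / 12) (p.2 / 8) =
      W p * gint T (-1 / τ) (p.1 / 12) (p.2 / 8) := fun p => by
    rw [gint_add_real, ← mul_assoc, ← e_add, hW]
    simp only
    rw [stdAddChar_intCast_eq_e, stdAddChar_intCast_eq_e, ← e_add]
    congr 2
    push_cast
    ring
  have hW1 : ∀ p, ‖W p‖ ≤ 1 := fun p => by
    rw [hW]
    simp only
    rw [stdAddChar_intCast_eq_e, stdAddChar_intCast_eq_e, ← e_add, norm_e]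
  simp_rw [hWe]
  rw [tsum_eq_sum_residues (tsum_mul_gint hT hσ hW1 (fun c hc => summable_exp_div hc)).1]
  have hstep : ∀ (α : ZMod 12) (β : ZMod 8), ∑' p : ℤ × ℤ,
      W (12 * p.1 + (α.val : ℤ), 8 * p.2 + (β.val : ℤ)) *
        gint T (-1 / τ) ((12 * p.1 + (α.val : ℤ) : ℤ) / 12) ((8 * p.2 + (β.val : ℤ) : ℤ) / 8) =
      (‖τ‖ / √96 : ℝ) * ∑' p : ℤ × ℤ, (ZMod.stdAddChar ((a : ZMod 12) * α - α ^ 2) *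
        ZMod.stdAddChar (β ^ 2 - (b : ZMod 8) * β) * (ZMod.stdAddChar ((p.1 : ZMod 12) * α) *
          ZMod.stdAddChar (-((p.2 : ZMod 8) * β)))) * gint T τ (p.1 / 12) (p.2 / 8) := fun α β => by
    have h1 : ∀ p : ℤ × ℤ, W (12 * p.1 + (α.val : ℤ), 8 * p.2 + (β.val : ℤ)) *
        gint T (-1 / τ) ((12 * p.1 + (α.val : ℤ) : ℤ) / 12) ((8 * p.2 + (β.val : ℤ) : ℤ) / 8) =
        (ZMod.stdAddChar ((a : ZMod 12) * α - α ^ 2) * ZMod.stdAddChar (β ^ 2 - (b : ZMod 8) * β)) *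
          gint T (-1 / τ) (p.1 + (α.val : ℝ) / 12) (p.2 + (β.val : ℝ) / 8) := fun p => by
      rw [hW]
      simp only
      have c12 : ((12 : ℤ) : ZMod 12) = 0 := by decide
      have c8 : ((8 : ℤ) : ZMod 8) = 0 := by decide
      congr 2
      · rw [Int.cast_sub, Int.cast_mul, Int.cast_pow, Int.cast_add, Int.cast_mul, c12]
        simp
      · rw [Int.cast_sub, Int.cast_mul, Int.cast_pow, Int.cast_add, Int.cast_mul, c8]
        simp
      · push_cast; ring
      · push_cast; ring
    simp_rw [h1]
    rw [tsum_mul_left, tsum_gint_neg_inv hT hτ, mul_left_comm, ← tsum_mul_left]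
    congr 1
    refine tsum_congr fun p => ?_
    rw [← mul_assoc]
    congr 2
    have h2 : ZMod.stdAddChar ((p.1 : ZMod 12) * α) = e (p.1 * ((α.val : ℝ) / 12)) := by
      have : (p.1 : ZMod 12) * α = ((p.1 * (α.val : ℤ) : ℤ) : ZMod 12) := by simp
      rw [this, stdAddChar_intCast_eq_e]
      congr 1
      push_cast
      ring
    have h3 : ZMod.stdAddChar (-((p.2 : ZMod 8) * β)) = e (-(p.2 * ((β.val : ℝ) / 8))) := by
      have : -((p.2 : ZMod 8) * β) = ((-(p.2 * (β.val : ℤ)) : ℤ) : ZMod 8) := by simp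
      rw [this, stdAddChar_intCast_eq_e]
      congr 1
      push_cast
      ring
    rw [h2, h3, ← e_add, sub_eq_add_neg]
  simp_rw [hstep]
  have hs : ∀ (α : ZMod 12) (β : ZMod 8), Summable fun p : ℤ × ℤ =>
      (ZMod.stdAddChar ((a : ZMod 12) * α - α ^ 2) *
        ZMod.stdAddChar (β ^ 2 - (b : ZMod 8) * β) * (ZMod.stdAddChar ((p.1 : ZMod 12) * α) *
          ZMod.stdAddChar (-((p.2 : ZMod 8) * β)))) * gint T τ (p.1 / 12) (p.2 / 8) := fun α β =>
    (tsum_mul_gint hT hτ (fun p => by simp) (fun c hc => summable_exp_div hc)).1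
  simp_rw [← Finset.mul_sum]
  have hcomb : ∑ α : ZMod 12, ∑ β : ZMod 8, ∑' p : ℤ × ℤ, (ZMod.stdAddChar ((a : ZMod 12) * α - α ^ 2) *
        ZMod.stdAddChar (β ^ 2 - (b : ZMod 8) * β) * (ZMod.stdAddChar ((p.1 : ZMod 12) * α) *
          ZMod.stdAddChar (-((p.2 : ZMod 8) * β)))) * gint T τ (p.1 / 12) (p.2 / 8) =
      ∑' p : ℤ × ℤ, gaussSum12 (a + p.1) * gaussSum8 (b + p.2) *
        gint T τ (p.1 / 12) (p.2 / 8) := by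
    rw [Finset.sum_congr rfl fun α _ => (Summable.tsum_finsetSum fun β _ => hs α β).symm,
      ← Summable.tsum_finsetSum fun α _ => summable_sum fun β _ => hs α β]
    refine tsum_congr fun p => ?_
    simp only [← Finset.sum_mul, gaussSum12_mul_gaussSum8]
  have hs2 : Summable fun p : ℤ × ℤ => gaussSum12 (a + p.1) * gaussSum8 (b + p.2) *
        gint T τ (p.1 / 12) (p.2 / 8) := by
    refine (summable_sum fun α (_ : α ∈ Finset.univ) =>
      summable_sum fun β (_ : β ∈ Finset.univ) => hs α β).congr fun p => ?_
    simp only [← Finset.sum_mul, gaussSum12_mul_gaussSum8]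
  -- The coefficients depend only on `p` modulo 12 and 8, so the dual lattice sum regroups into
  -- residue sums. The prefactor is `(|2τ + 1|/|τ|)/√96 · |τ|/√96`.
  rw [hcomb, tsum_eq_sum_residues hs2, ← mul_assoc]
  congr 1
  · rw [← ofReal_mul]
    congr 1
    have h96 : √96 * √96 = 96 := Real.mul_self_sqrt (by norm_num)
    rw [hτ', norm_neg, norm_div, div_mul_div_comm, h96,
      div_mul_cancel₀ _ (norm_ne_zero_iff.2 hτ0)]
  · refine Finset.sum_congr rfl fun α _ => Finset.sum_congr rfl fun β _ => ?_
    rw [residueSum, ← tsum_mul_left]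
    refine tsum_congr fun p => ?_
    have c12 : (12 : ZMod 12) = 0 := by decide
    have c8 : (8 : ZMod 8) = 0 := by decide
    congr 2
    · congr 2
      push_cast
      rw [c12]
      simp
    · congr 2
      push_cast
      rw [c8]
      simp
    · push_cast; ring
    · push_cast; ring
end MockMaass

/-! ### Arithmetic of the 48th roots of unity and values of the Gauss sums. -/

namespace MockMaass
open Complex Real

theorem zeta_pow_eq_exp (k : ℕ) : zeta 48 ^ k = cexp ((k * π / 24 : ℝ) * I) := by
  rw [zeta, ← Complex.exp_nat_mul]
  congr 1
  push_cast
  ring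

theorem zeta_pow_twelve : zeta 48 ^ 12 = I := by
  refine Eq.trans ?_ Complex.exp_pi_div_two_mul_I
  rw [zeta_pow_eq_exp]
  congr 1
  push_cast
  ring

theorem zeta_pow_twentyfour : zeta 48 ^ 24 = -1 := by
  rw [show 24 = 12 * 2 by norm_num, pow_mul, zeta_pow_twelve, I_sq]

/-- The number `ζ₄₈⁸` satisfies `x³ = -1` and is not `-1`. The relation is the 48th cyclotomic
equation, hence enough to decide every identity in `ℚ(ζ₄₈)`. -/
theorem zeta_pow_sixteen : zeta 48 ^ 16 = zeta 48 ^ 8 - 1 := by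
  have h8 : (zeta 48 ^ 8 + 1) * (zeta 48 ^ 16 - zeta 48 ^ 8 + 1) = 0 := by
    linear_combination zeta_pow_twentyfour
  rcases mul_eq_zero.1 h8 with h | h
  · exfalso
    have h1 := congrArg re h
    rw [zeta_pow_eq_exp, add_re, Complex.exp_ofReal_mul_I_re,
      show ((8 : ℕ) : ℝ) * π / 24 = π / 3 by push_cast; ring, Real.cos_pi_div_three] at h1
    norm_num at h1
  · linear_combination h

theorem zeta_sixteen : zeta 16 = zeta 48 ^ 3 := by
  rw [zeta, zeta_pow_eq_exp]
  congr 1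
  push_cast
  ring

/-- The two exponents belong to supplementary angles, so the sines cancel. This writes the real
surds as polynomials in `ζ₄₈`. -/
theorem sub_zeta_pow {a b : ℕ} (hab : a + b = 24) :
    zeta 48 ^ a - zeta 48 ^ b = ((2 * Real.cos (a * π / 24) : ℝ) : ℂ) := by
  have hb : ((b : ℝ) * π / 24 : ℝ) = π - a * π / 24 := by
    have : (b : ℝ) = 24 - a := by rw [eq_sub_iff_add_eq, add_comm]; exact_mod_cast hab
    rw [this]; ring
  rw [zeta_pow_eq_exp, zeta_pow_eq_exp, hb]
  apply Complex.ext
  · rw [sub_re, Complex.exp_ofReal_mul_I_re, Complex.exp_ofReal_mul_I_re, Real.cos_pi_sub, ofReal_re]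
    ring
  · rw [sub_im, Complex.exp_ofReal_mul_I_im, Complex.exp_ofReal_mul_I_im, Real.sin_pi_sub, ofReal_im]
    ring

theorem r_eq_zeta : r = 1 + (zeta 48 ^ 6 - zeta 48 ^ 18) := by
  rw [sub_zeta_pow (by norm_num), r, show ((6 : ℕ) : ℝ) * π / 24 = π / 4 by push_cast; ring,
    Real.cos_pi_div_four, mul_div_cancel₀ _ (by norm_num : (2 : ℝ) ≠ 0)]
  push_cast
  ring

/-- With `√(2 - √2) = 2 sin(π/8) = 2 cos(9π/24)` and `√3 = 2 cos(4π/24)`, the scale factor is `√(2 -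
√2) · √3 / 6`. -/
theorem sqrt_scale_eq_zeta : ((√((2 - √2) / 12) : ℝ) : ℂ) =
    (zeta 48 ^ 9 - zeta 48 ^ 15) * (zeta 48 ^ 4 - zeta 48 ^ 20) / 6 := by
  rw [sub_zeta_pow (by norm_num), sub_zeta_pow (by norm_num),
    show ((4 : ℕ) : ℝ) * π / 24 = π / 6 by push_cast; ring,
    show ((9 : ℕ) : ℝ) * π / 24 = π / 2 - π / 8 by push_cast; ring,
    Real.cos_pi_div_two_sub, Real.cos_pi_div_six, Real.sin_pi_div_eight]
  have h3 : √3 * √3 = 3 := Real.mul_self_sqrt (by norm_num)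
  have h12 : √12 = 2 * √3 := by
    rw [show (12 : ℝ) = 2 ^ 2 * 3 by norm_num, Real.sqrt_mul (by norm_num),
      Real.sqrt_sq (by norm_num)]
  have h30 : √3 ≠ 0 := by positivity
  have : √((2 - √2) / 12) = 2 * (√(2 - √2) / 2) * (2 * (√3 / 2)) / 6 := by
    rw [Real.sqrt_div' _ (by norm_num), h12]
    field_simp
    linear_combination (-2 * √(2 - √2)) * h3
  rw [this]
  push_cast
  ring

theorem stdAddChar_twelve (k : ℕ) : ZMod.stdAddChar (k : ZMod 12) = zeta 48 ^ (4 * k) := by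
  have h := ZMod.stdAddChar_coe (N := 12) (k : ℤ)
  rw [zeta_pow_eq_exp]
  push_cast at h ⊢
  rw [h]
  congr 1
  ring

theorem stdAddChar_eight (k : ℕ) : ZMod.stdAddChar (k : ZMod 8) = zeta 48 ^ (6 * k) := by
  have h := ZMod.stdAddChar_coe (N := 8) (k : ℤ)
  rw [zeta_pow_eq_exp]
  push_cast at h ⊢
  rw [h]
  congr 1
  ring

/-- Completing the square by `x ↦ x + s`. -/
theorem gaussSum12_two_mul (s : ZMod 12) :
    gaussSum12 (2 * s) = gaussSum12 0 * ZMod.stdAddChar (s ^ 2) := by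
  rw [gaussSum12, ← Equiv.sum_comp (Equiv.addRight s), gaussSum12, Finset.sum_mul]
  refine Finset.sum_congr rfl fun x _ => ?_
  rw [← AddChar.map_add_eq_mul]
  congr 1
  simp only [Equiv.coe_addRight]
  ring

/-- The translation `x ↦ x + 6` permutes the summands and multiplies each by the character value at
`6`, which is `-1`. -/
theorem gaussSum12_odd (s : ZMod 12) : gaussSum12 (2 * s + 1) = 0 := by
  have h : gaussSum12 (2 * s + 1) = -gaussSum12 (2 * s + 1) := by
    conv_lhs => rw [gaussSum12, ← Equiv.sum_comp (Equiv.addRight 6)]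
    rw [gaussSum12, ← Finset.sum_neg_distrib]
    refine Finset.sum_congr rfl fun x _ => ?_
    have h6 : ZMod.stdAddChar (6 : ZMod 12) = -1 := by
      rw [← zeta_pow_twentyfour]
      exact stdAddChar_twelve 6
    have h12 : (12 : ZMod 12) = 0 := by decide
    have : (2 * s + 1) * (x + 6) - (x + 6) ^ 2 = ((2 * s + 1) * x - x ^ 2) + 6 := by
      linear_combination (s - x - 3) * h12
    simp only [Equiv.coe_addRight]
    rw [this, AddChar.map_add_eq_mul, h6, mul_neg_one]
  exact self_eq_neg.1 h

theorem gaussSum8_two_mul (s : ZMod 8) :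
    gaussSum8 (2 * s) = gaussSum8 0 * ZMod.stdAddChar (-s ^ 2) := by
  rw [gaussSum8, ← Equiv.sum_comp (Equiv.addRight s), gaussSum8, Finset.sum_mul]
  refine Finset.sum_congr rfl fun x _ => ?_
  rw [← AddChar.map_add_eq_mul]
  congr 1
  simp only [Equiv.coe_addRight]
  ring

theorem gaussSum8_odd (s : ZMod 8) : gaussSum8 (2 * s + 1) = 0 := by
  have h : gaussSum8 (2 * s + 1) = -gaussSum8 (2 * s + 1) := by
    conv_lhs => rw [gaussSum8, ← Equiv.sum_comp (Equiv.addRight 4)]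
    rw [gaussSum8, ← Finset.sum_neg_distrib]
    refine Finset.sum_congr rfl fun x _ => ?_
    have h4 : ZMod.stdAddChar (4 : ZMod 8) = -1 := by
      rw [← zeta_pow_twentyfour]
      exact stdAddChar_eight 4
    have h8 : (8 : ZMod 8) = 0 := by decide
    have : (x + 4) ^ 2 - (2 * s + 1) * (x + 4) = (x ^ 2 - (2 * s + 1) * x) + 4 := by
      linear_combination (x - s + 1 ) * h8
    simp only [Equiv.coe_addRight]
    rw [this, AddChar.map_add_eq_mul, h4, mul_neg_one]
  exact self_eq_neg.1 h

theorem sum_zmod_twelve (F : ZMod 12 → ℂ) : ∑ x, F x =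
    F 0 + F 1 + F 2 + F 3 + F 4 + F 5 + F 6 + F 7 + F 8 + F 9 + F 10 + F 11 := by
  have h : ∀ F : Fin 12 → ℂ, ∑ x, F x =
      F 0 + F 1 + F 2 + F 3 + F 4 + F 5 + F 6 + F 7 + F 8 + F 9 + F 10 + F 11 := fun F => by
    simp [Fin.sum_univ_succ]
    ring
  exact h F

theorem sum_zmod_eight (F : ZMod 8 → ℂ) : ∑ x, F x =
    F 0 + F 1 + F 2 + F 3 + F 4 + F 5 + F 6 + F 7 := by
  have h : ∀ F : Fin 8 → ℂ, ∑ x, F x =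
      F 0 + F 1 + F 2 + F 3 + F 4 + F 5 + F 6 + F 7 := fun F => by
    simp [Fin.sum_univ_succ]
    ring
  exact h F

theorem gaussSum12_table : gaussSum12 1 = 0 ∧ gaussSum12 3 = 0 ∧ gaussSum12 5 = 0 ∧
    gaussSum12 7 = 0 ∧ gaussSum12 9 = 0 ∧ gaussSum12 11 = 0 ∧
    gaussSum12 2 = gaussSum12 0 * zeta 48 ^ 4 ∧ gaussSum12 4 = gaussSum12 0 * zeta 48 ^ 16 ∧
    gaussSum12 6 = gaussSum12 0 * -zeta 48 ^ 12 ∧ gaussSum12 8 = gaussSum12 0 * zeta 48 ^ 16 ∧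
    gaussSum12 10 = gaussSum12 0 * zeta 48 ^ 4 := by
  have h36 : zeta 48 ^ 36 = -zeta 48 ^ 12 := by
    linear_combination zeta 48 ^ 12 * zeta_pow_twentyfour
  refine ⟨gaussSum12_odd 0, gaussSum12_odd 1, gaussSum12_odd 2, gaussSum12_odd 3,
    gaussSum12_odd 4, gaussSum12_odd 5, ?_, ?_, ?_, ?_, ?_⟩
  · rw [← stdAddChar_twelve 1]; exact gaussSum12_two_mul 1
  · rw [← stdAddChar_twelve 4]; exact gaussSum12_two_mul 2
  · rw [← h36, ← stdAddChar_twelve 9]; exact gaussSum12_two_mul 3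
  · rw [← stdAddChar_twelve 4]; exact gaussSum12_two_mul 4
  · rw [← stdAddChar_twelve 1]; exact gaussSum12_two_mul 5

theorem gaussSum8_table : gaussSum8 1 = 0 ∧ gaussSum8 3 = 0 ∧ gaussSum8 5 = 0 ∧
    gaussSum8 7 = 0 ∧ gaussSum8 2 = gaussSum8 0 * -zeta 48 ^ 18 ∧
    gaussSum8 4 = gaussSum8 0 * -1 ∧ gaussSum8 6 = gaussSum8 0 * -zeta 48 ^ 18 := by
  have h42 : zeta 48 ^ 42 = -zeta 48 ^ 18 := by
    linear_combination zeta 48 ^ 18 * zeta_pow_twentyfour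
  refine ⟨gaussSum8_odd 0, gaussSum8_odd 1, gaussSum8_odd 2, gaussSum8_odd 3, ?_, ?_, ?_⟩
  · rw [← h42, ← stdAddChar_eight 7]; exact gaussSum8_two_mul 1
  · rw [← zeta_pow_twentyfour, ← stdAddChar_eight 4]; exact gaussSum8_two_mul 2
  · rw [← h42, ← stdAddChar_eight 7]; exact gaussSum8_two_mul 3

theorem gaussSum12_zero : gaussSum12 0 =
    2 * (1 - 2 * zeta 48 ^ 20 - 2 * zeta 48 ^ 8 + zeta 48 ^ 12) := by
  have h : ∀ k : ℕ, ZMod.stdAddChar (k : ZMod 12) = zeta 48 ^ (4 * k) := stdAddChar_twelve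
  rw [gaussSum12, sum_zmod_twelve]
  have h0 : ∀ x k : ZMod 12, 0 * x - x ^ 2 = k → ZMod.stdAddChar (0 * x - x ^ 2) = ZMod.stdAddChar k :=
    fun _ _ h => by rw [h]
  have e0 := h 0
  have e11 := h 11
  have e8 := h 8
  have e3 := h 3
  norm_num at e0 e11 e8 e3
  rw [h0 0 0 (by decide), h0 1 11 (by decide), h0 2 8 (by decide), h0 3 3 (by decide),
    h0 4 8 (by decide), h0 5 11 (by decide), h0 6 0 (by decide), h0 7 11 (by decide),
    h0 8 8 (by decide), h0 9 3 (by decide), h0 10 8 (by decide), h0 11 11 (by decide),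
    AddChar.map_zero_eq_one, e11, e8, e3]
  linear_combination (4 * zeta 48 ^ 20 + 4 * zeta 48 ^ 8) * zeta_pow_twentyfour

theorem gaussSum8_zero : gaussSum8 0 = 4 * zeta 48 ^ 6 := by
  have h : ∀ k : ℕ, ZMod.stdAddChar (k : ZMod 8) = zeta 48 ^ (6 * k) := stdAddChar_eight
  rw [gaussSum8, sum_zmod_eight]
  have h0 : ∀ x k : ZMod 8, x ^ 2 - 0 * x = k → ZMod.stdAddChar (x ^ 2 - 0 * x) = ZMod.stdAddChar k :=
    fun _ _ h => by rw [h]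
  have e1 := h 1
  have e4 := h 4
  norm_num at e1 e4
  rw [h0 0 0 (by decide), h0 1 1 (by decide), h0 2 4 (by decide), h0 3 1 (by decide),
    h0 4 0 (by decide), h0 5 1 (by decide), h0 6 4 (by decide), h0 7 1 (by decide),
    AddChar.map_zero_eq_one, e1, e4]
  linear_combination 2 * zeta_pow_twentyfour

/-- Gauss sums at odd arguments vanish, which leaves six terms. Only even `a` are listed, since the
cosets of interest have first coordinates `2j/12` and `(2j + 6)/12`. -/
theorem sum_gaussSum12 (F : ZMod 12 → ℂ) :
    (∑ x, gaussSum12 (0 + x) * F x = gaussSum12 0 * (F 0 + zeta 48 ^ 4 * (F 2 + F 10)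
      + zeta 48 ^ 16 * (F 4 + F 8) - zeta 48 ^ 12 * F 6)) ∧
    (∑ x, gaussSum12 (2 + x) * F x = gaussSum12 0 * (F 10 + zeta 48 ^ 4 * (F 0 + F 8)
      + zeta 48 ^ 16 * (F 2 + F 6) - zeta 48 ^ 12 * F 4)) ∧
    (∑ x, gaussSum12 (4 + x) * F x = gaussSum12 0 * (F 8 + zeta 48 ^ 4 * (F 10 + F 6)
      + zeta 48 ^ 16 * (F 0 + F 4) - zeta 48 ^ 12 * F 2)) ∧
    (∑ x, gaussSum12 (6 + x) * F x = gaussSum12 0 * (F 6 + zeta 48 ^ 4 * (F 8 + F 4)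
      + zeta 48 ^ 16 * (F 10 + F 2) - zeta 48 ^ 12 * F 0)) ∧
    (∑ x, gaussSum12 (8 + x) * F x = gaussSum12 0 * (F 4 + zeta 48 ^ 4 * (F 6 + F 2)
      + zeta 48 ^ 16 * (F 8 + F 0) - zeta 48 ^ 12 * F 10)) ∧
    (∑ x, gaussSum12 (10 + x) * F x = gaussSum12 0 * (F 2 + zeta 48 ^ 4 * (F 4 + F 0)
      + zeta 48 ^ 16 * (F 6 + F 10) - zeta 48 ^ 12 * F 8)) := by
  obtain ⟨h1, h3, h5, h7, h9, h11, h2, h4, h6, h8, h10⟩ := gaussSum12_table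
  have key : ∀ a : ZMod 12, ∑ x, gaussSum12 (a + x) * F x = gaussSum12 0 * (F (-a) +
      zeta 48 ^ 4 * (F (2 - a) + F (10 - a)) + zeta 48 ^ 16 * (F (4 - a) + F (8 - a))
      - zeta 48 ^ 12 * F (6 - a)) := fun a => by
    rw [← Equiv.sum_comp (Equiv.subRight a)]
    simp only [Equiv.subRight_apply, add_sub_cancel]
    rw [sum_zmod_twelve, h1, h3, h5, h7, h9, h11, h2, h4, h6, h8, h10, zero_sub]
    ring
  refine ⟨?_, ?_, ?_, ?_, ?_, ?_⟩
  -- The indices such as `10 - a` in `ZMod 12` reduce definitionally.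
  all_goals rw [key]; rfl

theorem sum_gaussSum8 (F : ZMod 8 → ℂ) :
    (∑ x, gaussSum8 (1 + x) * F x = gaussSum8 0 * (F 7 - zeta 48 ^ 18 * (F 1 + F 5) - F 3)) ∧
    (∑ x, gaussSum8 (5 + x) * F x = gaussSum8 0 * (F 3 - zeta 48 ^ 18 * (F 5 + F 1) - F 7)) := by
  obtain ⟨h1, h3, h5, h7, h2, h4, h6⟩ := gaussSum8_table
  have key : ∀ a : ZMod 8, ∑ x, gaussSum8 (a + x) * F x = gaussSum8 0 * (F (-a) -
      zeta 48 ^ 18 * (F (2 - a) + F (6 - a)) - F (4 - a)) := fun a => by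
    rw [← Equiv.sum_comp (Equiv.subRight a)]
    simp only [Equiv.subRight_apply, add_sub_cancel]
    rw [sum_zmod_eight, h1, h3, h5, h7, h2, h4, h6, zero_sub]
    ring
  refine ⟨?_, ?_⟩
  all_goals rw [key]; rfl
end MockMaass

/-! ### The matrix `Ω_R` and the action of `R` on class sums. -/

namespace MockMaass
open Complex Real

/-- A normal form without radicals, in which all entries are reduced modulo the cyclotomic relation;
the Gauss sum coefficients can be compared with it. -/
theorem OmegaR_eq : OmegaR = (1 / 6 : ℂ) •
    !![1 + zeta 48 ^ 2 - 2 * zeta 48 ^ 8 + zeta 48 ^ 10,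
        2 * (1 + 2 * zeta 48 ^ 2 + zeta 48 ^ 8 - zeta 48 ^ 10),
        2 * (1 - 2 * zeta 48 ^ 2 + zeta 48 ^ 8 + zeta 48 ^ 10),
        1 - zeta 48 ^ 2 - 2 * zeta 48 ^ 8 - zeta 48 ^ 10;
      1 + 2 * zeta 48 ^ 2 + zeta 48 ^ 8 - zeta 48 ^ 10,
        2 - zeta 48 ^ 2 - zeta 48 ^ 8 + 2 * zeta 48 ^ 10,
        2 + zeta 48 ^ 2 - zeta 48 ^ 8 - 2 * zeta 48 ^ 10,
        1 - 2 * zeta 48 ^ 2 + zeta 48 ^ 8 + zeta 48 ^ 10;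
      1 - 2 * zeta 48 ^ 2 + zeta 48 ^ 8 + zeta 48 ^ 10,
        2 + zeta 48 ^ 2 - zeta 48 ^ 8 - 2 * zeta 48 ^ 10,
        2 - zeta 48 ^ 2 - zeta 48 ^ 8 + 2 * zeta 48 ^ 10,
        1 + 2 * zeta 48 ^ 2 + zeta 48 ^ 8 - zeta 48 ^ 10;
      1 - zeta 48 ^ 2 - 2 * zeta 48 ^ 8 - zeta 48 ^ 10,
        2 * (1 - 2 * zeta 48 ^ 2 + zeta 48 ^ 8 + zeta 48 ^ 10),
        2 * (1 + 2 * zeta 48 ^ 2 + zeta 48 ^ 8 - zeta 48 ^ 10),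
        1 + zeta 48 ^ 2 - 2 * zeta 48 ^ 8 + zeta 48 ^ 10] := by
  rw [OmegaR, sqrt_scale_eq_zeta, r_eq_zeta, zeta_sixteen]
  have hz := zeta_pow_sixteen
  -- From here on `hz` is the only fact about `ζ₄₈` that is used.
  generalize zeta 48 = z at *
  ext i j
  fin_cases i <;> fin_cases j <;> simp <;> grind

/-- The combination of residue classes that underlies `H_j`. -/
noncomputable def classSum (T : ℝ) (τ : ℂ) (j : ℕ) : ℂ :=
  residueSum T τ (2 * j) 1 + residueSum T τ (2 * j + 6) 5

theorem residueSum_symm (T : ℝ) (τ : ℂ) (a b : ℤ) :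
    residueSum T τ (12 - a) b = residueSum T τ a b ∧
      residueSum T τ a (8 - b) = residueSum T τ a b := by
  constructor
  · rw [← residueSum_neg_left T τ a b, ← residueSum_add_left T τ (-a) b 1]
    congr 1
    ring
  · rw [← residueSum_neg_right T τ a b, ← residueSum_add_right T τ a (-b) 1]
    congr 1
    ring

/-- Vanishing of the odd Gauss sums and the symmetries `a ↦ -a`, `b ↦ -b` leave the eight classes
with `a ∈ {0, 2, 4, 6}`, `b ∈ {1, 3}`. The coefficients depend on `a + α` modulo 12 and `b + β`
modulo 8, so they commute with translation by `(6, 4)`, that is by `λ`. The four `λ`-invariant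
combinations are therefore mapped to each other. -/
theorem classSum_R {T : ℝ} (hT : 0 ≤ T) {τ : ℂ} (hτ : 0 < τ.im) (j : Fin 4) :
    classSum T (τ / (2 * τ + 1)) j =
      (‖2 * τ + 1‖ : ℝ) * ∑ k : Fin 4, OmegaR j k * classSum T τ k := by
  have hz := zeta_pow_sixteen
  have h8 : ∀ b, residueSum T τ 8 b = residueSum T τ 4 b := fun b => (residueSum_symm T τ 4 b).1
  have h10 : ∀ b, residueSum T τ 10 b = residueSum T τ 2 b := fun b => (residueSum_symm T τ 2 b).1
  have h12 : ∀ b, residueSum T τ 12 b = residueSum T τ 0 b := fun b => (residueSum_symm T τ 0 b).1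
  have h5 : ∀ a, residueSum T τ a 5 = residueSum T τ a 3 := fun a => (residueSum_symm T τ a 3).2
  have h7 : ∀ a, residueSum T τ a 7 = residueSum T τ a 1 := fun a => (residueSum_symm T τ a 1).2
  have w : ∀ a, residueSum T τ a (1 : ZMod 8).val = residueSum T τ a 1 ∧
      residueSum T τ a (3 : ZMod 8).val = residueSum T τ a 3 ∧
      residueSum T τ a (5 : ZMod 8).val = residueSum T τ a 3 ∧
      residueSum T τ a (7 : ZMod 8).val = residueSum T τ a 1 := fun a => ⟨rfl, rfl, h5 a, h7 a⟩
  -- The inner sum over the second coordinate is evaluated first, so that both Gauss sums can be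
  -- treated separately.
  set G8 : ℤ → ZMod 12 → ℂ := fun b α => ∑ β : ZMod 8, gaussSum8 (b + β) *
    residueSum T τ α.val β.val with hG8
  have hfac : ∀ a b : ℤ, residueSum T (τ / (2 * τ + 1)) a b = (‖2 * τ + 1‖ / 96 : ℝ) *
      ∑ α : ZMod 12, gaussSum12 (a + α) * G8 b α := fun a b => by
    rw [tsum_gint_R hT hτ, hG8]
    simp_rw [Finset.mul_sum, mul_assoc]
  have hG1 : ∀ α, G8 1 α = 4 * zeta 48 ^ 6 * (residueSum T τ α.val 1 -
      zeta 48 ^ 18 * (residueSum T τ α.val 1 + residueSum T τ α.val 3)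
        - residueSum T τ α.val 3) := fun α => by
    rw [hG8]
    simp only
    rw [Int.cast_one, (sum_gaussSum8 fun β => residueSum T τ α.val β.val).1, gaussSum8_zero,
      (w _).1, (w _).2.1, (w _).2.2.1, (w _).2.2.2]
  have hG5 : ∀ α, G8 5 α = 4 * zeta 48 ^ 6 * (residueSum T τ α.val 3 -
      zeta 48 ^ 18 * (residueSum T τ α.val 3 + residueSum T τ α.val 1)
        - residueSum T τ α.val 1) := fun α => by
    rw [hG8]
    simp only
    rw [Int.cast_ofNat, (sum_gaussSum8 fun β => residueSum T τ α.val β.val).2, gaussSum8_zero,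
      (w _).1, (w _).2.1, (w _).2.2.1, (w _).2.2.2]
  have hv : ∀ b, residueSum T τ (0 : ZMod 12).val b = residueSum T τ 0 b ∧
    residueSum T τ (2 : ZMod 12).val b = residueSum T τ 2 b ∧
    residueSum T τ (4 : ZMod 12).val b = residueSum T τ 4 b ∧
    residueSum T τ (6 : ZMod 12).val b = residueSum T τ 6 b ∧
    residueSum T τ (8 : ZMod 12).val b = residueSum T τ 4 b ∧
    residueSum T τ (10 : ZMod 12).val b = residueSum T τ 2 b := fun b =>
    ⟨rfl, rfl, rfl, rfl, h8 b, h10 b⟩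
  have hS := fun b => sum_gaussSum12 (G8 b)
  have s01 := hfac 0 1
  rw [Int.cast_zero, (hS 1).1] at s01
  have s21 := hfac 2 1
  rw [Int.cast_ofNat, (hS 1).2.1] at s21
  have s41 := hfac 4 1
  rw [Int.cast_ofNat, (hS 1).2.2.1] at s41
  have s61 := hfac 6 1
  rw [Int.cast_ofNat, (hS 1).2.2.2.1] at s61
  have s65 := hfac 6 5
  rw [Int.cast_ofNat, (hS 5).2.2.2.1] at s65
  have s85 := hfac 8 5
  rw [Int.cast_ofNat, (hS 5).2.2.2.2.1] at s85
  have s105 := hfac 10 5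
  rw [Int.cast_ofNat, (hS 5).2.2.2.2.2] at s105
  have s125 := hfac 12 5
  rw [show ((12 : ℤ) : ZMod 12) = 0 by decide, (hS 5).1] at s125
  simp only [hG1, hG5, (hv _).1, (hv _).2.1, (hv _).2.2.1, (hv _).2.2.2.1, (hv _).2.2.2.2.1,
    (hv _).2.2.2.2.2, gaussSum12_zero] at s01 s21 s41 s61 s65 s85 s105 s125
  rw [OmegaR_eq]
  simp only [classSum, Fin.sum_univ_four]
  clear hG1 hG5 hv hfac hS w
  clear_value G8
  fin_cases j
  · simp [h8, h10, h12, h5, s01, s65]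
    generalize zeta 48 = z at *
    clear s01 s21 s41 s61 s65 s85 s105 s125 h8 h10 h12 h5 h7
    grind
  · simp [h8, h10, h12, h5, s21, s85]
    generalize zeta 48 = z at *
    clear s01 s21 s41 s61 s65 s85 s105 s125 h8 h10 h12 h5 h7
    grind
  · simp [h8, h10, h12, h5, s41, s105]
    generalize zeta 48 = z at *
    clear s01 s21 s41 s61 s65 s85 s105 s125 h8 h10 h12 h5 h7
    grind
  · simp [h8, h10, h12, h5, s61, s125]
    generalize zeta 48 = z at *
    clear s01 s21 s41 s61 s65 s85 s105 s125 h8 h10 h12 h5 h7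
    grind
end MockMaass

namespace MockMaass
open Complex Real

/-! ### The completed functions as class sums -/

theorem bilin_A6 (n m : Fin 2 → ℝ) : bilin A6 n m = 12 * n 0 * m 0 - 8 * n 1 * m 1 := by
  simp [bilin, A6, dotProduct, Matrix.mulVec, Fin.sum_univ_two]
  ring

theorem inv_P6 : P6⁻¹ = !![1 / √6, 0; 0, 1 / 2] := by
  have h6 : √6 ≠ 0 := by positivity
  apply Matrix.inv_eq_right_inv
  rw [P6, Matrix.mul_fin_two, Matrix.one_fin_two]
  simp [h6]

theorem bilin_cvec (n : Fin 2 → ℝ) (t : ℝ) : bilin A6 n (cvec P6 t) =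
    -2 * (2 * n 1 * Real.cosh t - √6 * n 0 * Real.sinh t) := by
  have h6 : √6 * √6 = 6 := Real.mul_self_sqrt (by norm_num)
  have h60 : √6 ≠ 0 := by positivity
  rw [bilin_A6, cvec, inv_P6]
  simp [Matrix.mulVec, dotProduct, Fin.sum_univ_two]
  field_simp
  linear_combination (-4 * n 0 * Real.sinh t) * h6

theorem bilin_cperp (n : Fin 2 → ℝ) (t : ℝ) : bilin A6 n (cperp P6 t) =
    2 * (√6 * n 0 * Real.cosh t - 2 * n 1 * Real.sinh t) := by
  have h6 : √6 * √6 = 6 := Real.mul_self_sqrt (by norm_num)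
  have h60 : √6 ≠ 0 := by positivity
  rw [bilin_A6, cperp, inv_P6]
  simp [Matrix.mulVec, dotProduct, Fin.sum_univ_two]
  field_simp
  linear_combination (-4 * n 0 * Real.cosh t) * h6

theorem mulVec_P6_c2 : P6.mulVec c2 0 = √2 := by
  have h3 : √3 ≠ 0 := by positivity
  have h6 : √6 = √2 * √3 := by rw [← Real.sqrt_mul (by norm_num)]; norm_num
  simp [P6, c2, Matrix.mulVec, dotProduct, Fin.sum_univ_two]
  rw [h6]
  field_simp

theorem param_c2 : param P6 c2 = Real.arsinh (√2) := by
  rw [param, mulVec_P6_c2]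

/-- The reflection `n₁ ↦ -n₁` exchanges `c1` and `c2`, which makes the integration segment
symmetric. -/
theorem param_c1 : param P6 c1 = -param P6 c2 := by
  rw [param_c2, param, ← Real.arsinh_neg, ← mulVec_P6_c2]
  congr 1
  simp [P6, c1, c2, Matrix.mulVec, dotProduct, Fin.sum_univ_two]

theorem param_c2_pos : 0 < param P6 c2 := by
  rw [param_c2]
  exact Real.arsinh_pos_iff.2 (by positivity)

theorem sinh_param_c2 : Real.sinh (param P6 c2) = √2 := by rw [param_c2, Real.sinh_arsinh]

theorem cosh_param_c2 : Real.cosh (param P6 c2) = √3 := by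
  rw [param_c2, Real.cosh_arsinh, Real.sq_sqrt (by norm_num)]
  norm_num

/-- With `Q = X² - Y²` and `B(n, c(t)) = -2Y`, the exponent `2πiτQ - πB²τ₂` equals `2πi(τX² -
τ̄Y²)`. -/
theorem thetaHatTerm_eq_gint (τ : UpperHalfPlane) (n : Fin 2 → ℝ) :
    thetaHatTerm A6 P6 c1 c2 τ n = gint (param P6 c2) τ (n 0) (n 1) := by
  rw [thetaHatTerm, gint, ← intervalIntegral.integral_ofReal, param_c1,
    ← intervalIntegral.integral_const_mul]
  refine intervalIntegral.integral_congr fun t _ => ?_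
  rw [bilin_cvec, gauss, ofReal_exp, ← Complex.exp_add]
  congr 1
  have hc : ((Real.cosh t : ℝ) : ℂ) ^ 2 = ((Real.sinh t : ℝ) : ℂ) ^ 2 + 1 := by
    exact_mod_cast Real.cosh_sq t
  have h6 : ((√6 : ℝ) : ℂ) ^ 2 = 6 := by
    rw [← ofReal_pow, Real.sq_sqrt (by norm_num)]; norm_num
  have hτ : (starRingEnd ℂ) (τ : ℂ) = τ - 2 * τ.im * I := by
    apply Complex.ext <;> simp
    ring
  rw [quad_A6, hτ]
  generalize Real.cosh t = C at *
  generalize Real.sinh t = S at *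
  push_cast
  linear_combination (-2 * π * I * τ * (6 * n 0 ^ 2 - 4 * n 1 ^ 2)) * hc
    + (-2 * π * I * τ * n 0 ^ 2 * (C ^ 2 - S ^ 2)) * h6
    + (-4 * π * τ.im * (2 * n 1 * C - √6 * n 0 * S) ^ 2) * I_sq

/-- The parametrization of a shifted lattice by `ℤ²`. -/
noncomputable def shiftedLatticeEquiv (μ : Fin 2 → ℝ) : ℤ × ℤ ≃ shiftedLattice μ :=
  Equiv.ofBijective (fun p => ⟨![p.1 + μ 0, p.2 + μ 1], ![p.1, p.2], fun i => by
    fin_cases i <;> rfl⟩) (by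
    constructor
    · intro p q h
      have h' := congrArg Subtype.val h
      have h0 := congrFun h' 0
      have h1 := congrFun h' 1
      simp at h0 h1
      exact Prod.ext h0 h1
    · rintro ⟨n, m, hm⟩
      refine ⟨(m 0, m 1), Subtype.ext ?_⟩
      funext i
      fin_cases i
      · exact (hm 0).symm
      · exact (hm 1).symm)

theorem shiftedLatticeEquiv_apply_zero (μ : Fin 2 → ℝ) (p : ℤ × ℤ) :
    (shiftedLatticeEquiv μ p : Fin 2 → ℝ) 0 = p.1 + μ 0 := rfl

theorem shiftedLatticeEquiv_apply_one (μ : Fin 2 → ℝ) (p : ℤ × ℤ) :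
    (shiftedLatticeEquiv μ p : Fin 2 → ℝ) 1 = p.2 + μ 1 := rfl

theorem summable_thetaHatTerm (μ : Fin 2 → ℝ) (τ : UpperHalfPlane) :
    Summable fun n : shiftedLattice μ => thetaHatTerm A6 P6 c1 c2 τ n := by
  rw [← (shiftedLatticeEquiv μ).summable_iff]
  have h := (tsum_mul_gint param_c2_pos.le τ.im_pos (w := fun _ => 1) (fun _ => by simp)
    (fun c hc => summable_exp_shift hc (μ 0) (μ 1))).1
  refine h.congr fun p => ?_
  rw [Function.comp_apply, thetaHatTerm_eq_gint, shiftedLatticeEquiv_apply_zero,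
    shiftedLatticeEquiv_apply_one, one_mul]

theorem thetaHat_eq_tsum (μ : Fin 2 → ℝ) (τ : UpperHalfPlane) :
    thetaHat A6 P6 c1 c2 μ τ =
      √τ.im * ∑' p : ℤ × ℤ, gint (param P6 c2) τ (p.1 + μ 0) (p.2 + μ 1) := by
  rw [thetaHat, ← (shiftedLatticeEquiv μ).tsum_eq]
  simp_rw [thetaHatTerm_eq_gint, shiftedLatticeEquiv_apply_zero, shiftedLatticeEquiv_apply_one]

theorem Hhat_eq_classSum (j : Fin 4) (τ : UpperHalfPlane) :
    Hhat j τ = √τ.im * classSum (param P6 c2) τ j := by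
  rw [Hhat, thetaHat_eq_tsum, thetaHat_eq_tsum, ← mul_add, classSum, residueSum, residueSum]
  congr 2
  · refine tsum_congr fun p => ?_
    congr 1 <;> simp [muVec]
    ring
  · refine tsum_congr fun p => ?_
    congr 1 <;> simp [muVec, lamVec] <;> ring

/-- On both cosets `Q` is congruent to `j²/6 - 1/16` modulo 1, so the translation acts by one common
scalar. -/
theorem classSum_add_one (T : ℝ) (τ : ℂ) (j : Fin 4) :
    classSum T (τ + 1) j = OmegaT j j * classSum T τ j := by
  have h1 : ∀ a b : ℝ, gint T (τ + 1) a b = e (6 * a ^ 2 - 4 * b ^ 2) * gint T τ a b :=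
    fun a b => by
      have := gint_add_real T τ 1 a b
      rwa [ofReal_one, one_mul] at this
  have hT : OmegaT j j = e ((j : ℝ) ^ 2 / 6 - 1 / 16) := by
    rw [OmegaT, Matrix.diagonal_apply_eq]
    have hz : ∀ (n k : ℕ) (x : ℝ) (m : ℤ), x = k / n + m → zeta n ^ k = e x := by
      intro n k x m h
      rw [h, e_add, e_intCast, mul_one, zeta, e, ← Complex.exp_nat_mul]
      congr 1
      push_cast
      ring
    fin_cases j
    · exact hz 16 15 _ (-1) (by norm_num)
    · exact hz 48 5 _ 0 (by norm_num)
    · exact hz 48 29 _ 0 (by norm_num)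
    · exact hz 16 7 _ 1 (by norm_num)
  rw [classSum, classSum, mul_add, residueSum, residueSum, residueSum, residueSum,
    ← tsum_mul_left, ← tsum_mul_left]
  simp_rw [h1]
  congr 1
  · refine tsum_congr fun p => ?_
    rw [hT]
    congr 1
    have : (6 * ((p.1 : ℝ) + ((2 * (j : ℕ) : ℤ) : ℝ) / 12) ^ 2 - 4 * ((p.2 : ℝ) + (1 : ℤ) / 8) ^ 2) =
        ((j : ℕ) : ℝ) ^ 2 / 6 - 1 / 16 +
          ((6 * p.1 ^ 2 + 2 * p.1 * (j : ℕ) - 4 * p.2 ^ 2 - p.2 : ℤ) : ℝ) := by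
      push_cast
      ring
    rw [this, e_add, e_intCast, mul_one]
  · refine tsum_congr fun p => ?_
    rw [hT]
    congr 1
    have : (6 * ((p.1 : ℝ) + ((2 * (j : ℕ) + 6 : ℤ) : ℝ) / 12) ^ 2
        - 4 * ((p.2 : ℝ) + (5 : ℤ) / 8) ^ 2) =
        ((j : ℕ) : ℝ) ^ 2 / 6 - 1 / 16 +
          ((6 * p.1 ^ 2 + 2 * p.1 * (j : ℕ) + 6 * p.1 + (j : ℕ) - 4 * p.2 ^ 2 - 5 * p.2 : ℤ) : ℝ) := by
      push_cast
      ring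
    rw [this, e_add, e_intCast, mul_one]

theorem Hhat_T_smul (j : Fin 4) (τ : UpperHalfPlane) :
    Hhat j (ModularGroup.T • τ) = OmegaT j j * Hhat j τ := by
  have h1 : ((ModularGroup.T • τ : UpperHalfPlane) : ℂ) = τ + 1 := by
    rw [UpperHalfPlane.modular_T_smul, UpperHalfPlane.coe_vadd]
    push_cast
    ring
  have h2 : (ModularGroup.T • τ).im = τ.im := by
    rw [UpperHalfPlane.modular_T_smul, UpperHalfPlane.vadd_im]
  rw [Hhat_eq_classSum, Hhat_eq_classSum, h1, h2, classSum_add_one]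
  ring

/-- The factor `1/|2τ + 1|` from `√(Im Rτ)` cancels the factor in `classSum_R`. -/
theorem Hhat_R_smul (j : Fin 4) (τ : UpperHalfPlane) :
    Hhat j (matR • τ) = ∑ k, OmegaR j k * Hhat k τ := by
  have h1 : ((matR • τ : UpperHalfPlane) : ℂ) = τ / (2 * τ + 1) := by
    rw [UpperHalfPlane.specialLinearGroup_apply]
    simp [matR]
  have h21 : 0 < ‖2 * (τ : ℂ) + 1‖ := norm_pos_iff.2 fun h => by
    have := congrArg im h
    simp at this
    exact τ.im_ne_zero this
  have h2 : (matR • τ).im = τ.im / ‖2 * (τ : ℂ) + 1‖ ^ 2 := by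
    rw [← UpperHalfPlane.coe_im, h1, Complex.div_im, ← Complex.normSq_eq_norm_sq]
    simp
    ring
  simp_rw [Hhat_eq_classSum]
  rw [h1, h2, classSum_R param_c2_pos.le τ.im_pos, Real.sqrt_div' _ (by positivity),
    Real.sqrt_sq h21.le, ← mul_assoc, ← ofReal_mul, div_mul_cancel₀ _ h21.ne', Finset.mul_sum]
  refine Finset.sum_congr rfl fun k _ => ?_
  ring
end MockMaass

namespace MockMaass
open Complex Real

/-! ### The Bessel function and its incomplete tails -/

theorem le_cosh (t : ℝ) : t / 2 ≤ Real.cosh t := by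
  rw [Real.cosh_eq]
  have h1 := Real.add_one_le_exp t
  have h2 := Real.exp_pos (-t)
  linarith

theorem integrableOn_exp_neg_mul_cosh {a : ℝ} (ha : 0 < a) :
    MeasureTheory.IntegrableOn (fun t => Real.exp (-a * Real.cosh t)) (Set.Ioi 0) := by
  have h := exp_neg_integrableOn_Ioi 0 (half_pos ha)
  refine MeasureTheory.Integrable.mono' h ?_ (Filter.Eventually.of_forall fun t => ?_)
  · have := Real.continuous_cosh
    exact (by fun_prop : Continuous fun t => Real.exp (-a * Real.cosh t)).aestronglyMeasurable
  · rw [Real.norm_of_nonneg (Real.exp_pos _).le]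
    apply Real.exp_le_exp.2
    nlinarith [le_cosh t]

theorem besselK0_nonneg (a : ℝ) : 0 ≤ besselK0 a :=
  MeasureTheory.integral_nonneg fun _ => (Real.exp_pos _).le

theorem besselK0_anti {a b : ℝ} (ha : 0 < a) (hab : a ≤ b) : besselK0 b ≤ besselK0 a := by
  refine MeasureTheory.integral_mono (integrableOn_exp_neg_mul_cosh (ha.trans_le hab))
    (integrableOn_exp_neg_mul_cosh ha) fun t => Real.exp_le_exp.2 ?_
  nlinarith [Real.cosh_pos t]

/-- Half the odd function of `w` which for `w > 0` is minus the tail of `K₀(a)` beyond `w`. -/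
noncomputable def besselTail (a w : ℝ) : ℝ :=
  1 / 2 * (∫ v in (0 : ℝ)..w, Real.exp (-a * Real.cosh v)) - 1 / 2 * Real.sign w * besselK0 a

theorem besselTail_neg (a w : ℝ) : besselTail a (-w) = -besselTail a w := by
  have h := intervalIntegral.integral_comp_neg (a := 0) (b := w)
    (fun v => Real.exp (-a * Real.cosh v))
  simp only [Real.cosh_neg, neg_zero] at h
  rw [besselTail, besselTail, Real.sign_neg, intervalIntegral.integral_symm, ← h]
  ring

/-- On `v > w > 0` half of the exponent is at least its value at `w`, and the other half integrates
to at most `K₀(a/2)`. -/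
theorem abs_besselTail_le {a : ℝ} (ha : 0 < a) (w : ℝ) :
    |besselTail a w| ≤ Real.exp (-(a / 2) * Real.cosh w) * besselK0 (a / 2) := by
  -- Both sides behave well under `w ↦ -w`; at `w = 0` the tail is zero because `Real.sign 0 = 0`.
  wlog hw : 0 < w generalizing w
  · rcases (not_lt.1 hw).lt_or_eq with h | h
    · have := this (-w) (by linarith)
      rwa [besselTail_neg, abs_neg, Real.cosh_neg] at this
    · rw [h, besselTail, intervalIntegral.integral_same, Real.sign_zero]
      simpa using mul_nonneg (Real.exp_pos _).le (besselK0_nonneg (a / 2))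
  have hi := integrableOn_exp_neg_mul_cosh ha
  have hi2 := integrableOn_exp_neg_mul_cosh (half_pos ha)
  have hiw := hi.mono_set (Set.Ioi_subset_Ioi hw.le)
  have h1 : besselTail a w = -(1 / 2 * ∫ v in Set.Ioi w, Real.exp (-a * Real.cosh v)) := by
    have h := intervalIntegral.integral_interval_add_Ioi hi hiw
    rw [besselTail, Real.sign_of_pos hw, besselK0, ← h]
    ring
  have h2 : ∫ v in Set.Ioi w, Real.exp (-a * Real.cosh v) ≤
      Real.exp (-(a / 2) * Real.cosh w) * besselK0 (a / 2) := by
    calc ∫ v in Set.Ioi w, Real.exp (-a * Real.cosh v)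
        ≤ ∫ v in Set.Ioi w, Real.exp (-(a / 2) * Real.cosh w) *
            Real.exp (-(a / 2) * Real.cosh v) := by
          refine MeasureTheory.setIntegral_mono_on hiw
            ((hi2.mono_set (Set.Ioi_subset_Ioi hw.le)).const_mul _) measurableSet_Ioi
            fun v hv => ?_
          rw [← Real.exp_add]
          apply Real.exp_le_exp.2
          have hv' : w < v := hv
          have : Real.cosh w ≤ Real.cosh v :=
            Real.cosh_le_cosh.2 (by rw [abs_of_pos hw, abs_of_pos (hw.trans hv')]; exact hv'.le)
          nlinarith
      _ = Real.exp (-(a / 2) * Real.cosh w) *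
            ∫ v in Set.Ioi w, Real.exp (-(a / 2) * Real.cosh v) :=
          MeasureTheory.integral_const_mul _ _
      _ ≤ _ := by
          refine mul_le_mul_of_nonneg_left ?_ (Real.exp_pos _).le
          exact MeasureTheory.setIntegral_mono_set hi2
            (Filter.Eventually.of_forall fun _ => (Real.exp_pos _).le)
            (Set.Ioi_subset_Ioi hw.le).eventuallyLE
  have h3 : 0 ≤ ∫ v in Set.Ioi w, Real.exp (-a * Real.cosh v) :=
    MeasureTheory.integral_nonneg fun _ => (Real.exp_pos _).le
  rw [h1, abs_neg, abs_of_nonneg (by positivity)]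
  linarith

/-- Split at the zero of `v = 2t - θ` and add and subtract `sgn · K₀` at both ends; the factor `1/2`
is the Jacobian. -/
theorem integral_exp_neg_mul_cosh (a θ : ℝ) {t₁ t₂ : ℝ} (h : t₁ < t₂) :
    ∫ t in t₁..t₂, Real.exp (-a * Real.cosh (2 * t - θ)) =
      1 / 2 * (1 - Real.sign (2 * t₁ - θ) * Real.sign (2 * t₂ - θ)) * besselK0 a
        + besselTail a (2 * t₂ - θ) - besselTail a (2 * t₁ - θ) := by
  rw [intervalIntegral.integral_comp_mul_sub (fun v => Real.exp (-a * Real.cosh v)) two_ne_zero]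
  have hii : ∀ x y, IntervalIntegrable (fun v => Real.exp (-a * Real.cosh v))
      MeasureTheory.volume x y := fun x y => by
    have := Real.continuous_cosh
    exact (by fun_prop : Continuous fun t => Real.exp (-a * Real.cosh t)).intervalIntegrable _ _
  rw [← intervalIntegral.integral_add_adjacent_intervals (hii (2 * t₁ - θ) 0) (hii 0 _),
    intervalIntegral.integral_symm, besselTail, besselTail]
  have hlt : 2 * t₁ - θ < 2 * t₂ - θ := by linarith
  -- Strict order of the endpoints excludes two zero signs and the pair `(1, -1)`; in all other
  -- cases `1 - s₁s₂ = s₂ - s₁`.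
  have hs : 1 - Real.sign (2 * t₁ - θ) * Real.sign (2 * t₂ - θ) =
      Real.sign (2 * t₂ - θ) - Real.sign (2 * t₁ - θ) := by
    rcases lt_trichotomy (2 * t₁ - θ) 0 with h1 | h1 | h1
    · rw [Real.sign_of_neg h1]; ring
    · rw [h1] at hlt ⊢
      rw [Real.sign_zero, Real.sign_of_pos hlt]; ring
    · rw [Real.sign_of_pos h1, Real.sign_of_pos (h1.trans hlt)]; ring
  rw [hs, smul_eq_mul]
  ring

theorem sign_mul' (x y : ℝ) : Real.sign (x * y) = Real.sign x * Real.sign y := by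
  rcases lt_trichotomy x 0 with hx | rfl | hx
  · rcases lt_trichotomy y 0 with hy | rfl | hy
    · rw [Real.sign_of_neg hx, Real.sign_of_neg hy, Real.sign_of_pos (mul_pos_of_neg_of_neg hx hy)]
      norm_num
    · simp [Real.sign_zero]
    · rw [Real.sign_of_neg hx, Real.sign_of_pos hy, Real.sign_of_neg (mul_neg_of_neg_of_pos hx hy)]
      norm_num
  · simp [Real.sign_zero]
  · rcases lt_trichotomy y 0 with hy | rfl | hy
    · rw [Real.sign_of_pos hx, Real.sign_of_neg hy, Real.sign_of_neg (mul_neg_of_pos_of_neg hx hy)]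
      norm_num
    · simp [Real.sign_zero]
    · rw [Real.sign_of_pos hx, Real.sign_of_pos hy, Real.sign_of_pos (mul_pos hx hy)]
      norm_num

theorem sign_sinh (x : ℝ) : Real.sign (Real.sinh x) = Real.sign x := by
  rcases lt_trichotomy x 0 with hx | rfl | hx
  · rw [Real.sign_of_neg hx, Real.sign_of_neg (Real.sinh_neg_iff.2 hx)]
  · rw [Real.sinh_zero]
  · rw [Real.sign_of_pos hx, Real.sign_of_pos (Real.sinh_pos_iff.2 hx)]

/-! ### Hyperbolic polar coordinates -/

/-- First coordinate of the boost by `t` of `(√6 n₁, 2 n₂)`. -/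
noncomputable def boostX (n : Fin 2 → ℝ) (t : ℝ) : ℝ :=
  √6 * n 0 * Real.cosh t - 2 * n 1 * Real.sinh t

/-- Second coordinate of the boost by `t` of `(√6 n₁, 2 n₂)`. -/
noncomputable def boostY (n : Fin 2 → ℝ) (t : ℝ) : ℝ :=
  2 * n 1 * Real.cosh t - √6 * n 0 * Real.sinh t

/-- Twice the hyperbolic angle of `(√6 n₁, 2 n₂)`. -/
noncomputable def hypAngle (n : Fin 2 → ℝ) : ℝ :=
  Real.arsinh (2 * (√6 * n 0) * (2 * n 1) / |quad A6 n|)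

theorem boost_sq_sub (n : Fin 2 → ℝ) (t : ℝ) : boostX n t ^ 2 - boostY n t ^ 2 = quad A6 n := by
  have h6 : √6 ^ 2 = 6 := Real.sq_sqrt (by norm_num)
  rw [boostX, boostY, quad_A6]
  linear_combination (6 * n 0 ^ 2 - 4 * n 1 ^ 2) * Real.cosh_sq t
    + n 0 ^ 2 * (Real.cosh t ^ 2 - Real.sinh t ^ 2) * h6

/-- The pair `(X² + Y², 2XY)` satisfies `(X² + Y²)² - (2XY)² = Q²` and is positive in the first
entry for either sign of `Q`. Doubling the angle thus avoids separate parametrizations of the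
regions `Q > 0` and `Q < 0`. -/
theorem boost_polar {n : Fin 2 → ℝ} (hn : quad A6 n ≠ 0) (t : ℝ) :
    boostX n t ^ 2 + boostY n t ^ 2 = |quad A6 n| * Real.cosh (2 * t - hypAngle n) ∧
      2 * boostX n t * boostY n t = -(|quad A6 n| * Real.sinh (2 * t - hypAngle n)) := by
  have hq : 0 < |quad A6 n| := abs_pos.2 hn
  have h6 : √6 ^ 2 = 6 := Real.sq_sqrt (by norm_num)
  have hs : |quad A6 n| * Real.sinh (hypAngle n) = 2 * (√6 * n 0) * (2 * n 1) := by
    rw [hypAngle, Real.sinh_arsinh]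
    field_simp
  have hc : |quad A6 n| * Real.cosh (hypAngle n) = (√6 * n 0) ^ 2 + (2 * n 1) ^ 2 := by
    have h1 : (|quad A6 n| * Real.cosh (hypAngle n)) ^ 2 =
        ((√6 * n 0) ^ 2 + (2 * n 1) ^ 2) ^ 2 := by
      have h2 : |quad A6 n| ^ 2 = ((√6 * n 0) ^ 2 - (2 * n 1) ^ 2) ^ 2 := by
        rw [sq_abs, quad_A6, mul_pow, h6]
        ring
      rw [mul_pow, Real.cosh_sq, mul_add, ← mul_pow, hs, mul_one, h2]
      ring
    exact (pow_left_inj₀ (mul_nonneg hq.le (Real.cosh_pos _).le) (by positivity) two_ne_zero).1 h1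
  rw [Real.cosh_sub, Real.sinh_sub, mul_sub, mul_sub]
  have e1 : ∀ u v : ℝ, |quad A6 n| * (u * v) = u * (|quad A6 n| * v) := fun u v => by ring
  simp only [e1, hs, hc, Real.cosh_two_mul, Real.sinh_two_mul, boostX, boostY]
  constructor
  · ring
  · ring

theorem sign_two_mul_sub_hypAngle {n : Fin 2 → ℝ} (hn : quad A6 n ≠ 0) (t : ℝ) :
    Real.sign (2 * t - hypAngle n) = -(Real.sign (boostX n t) * Real.sign (boostY n t)) := by
  have h := congrArg Real.sign (boost_polar hn t).2
  rw [Real.sign_neg, sign_mul', sign_mul', sign_mul', sign_sinh,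
    Real.sign_of_pos (abs_pos.2 hn), Real.sign_of_pos (by norm_num : (0 : ℝ) < 2)] at h
  linarith

theorem sign_mul_self_of_mul_pos {x y : ℝ} (h : 0 < x * y) : Real.sign x * Real.sign y = 1 := by
  rw [← sign_mul', Real.sign_of_pos h]

/-- Since `|sinh t| < cosh t`, the dominant coordinate keeps its sign under every boost. It serves
`X` where `Q > 0` and, with the roles exchanged, `Y` where `Q < 0`. -/
theorem boost_mul_pos {x y t₁ t₂ : ℝ} (h : y ^ 2 < x ^ 2) :
    0 < (x * Real.cosh t₁ - y * Real.sinh t₁) * (x * Real.cosh t₂ - y * Real.sinh t₂) := by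
  have key : ∀ t : ℝ, 0 < x * (x * Real.cosh t - y * Real.sinh t) := fun t => by
    have h1 : |y * Real.sinh t| < |x * Real.cosh t| := by
      rw [abs_mul, abs_mul, abs_of_pos (Real.cosh_pos t)]
      have h2 : |Real.sinh t| < Real.cosh t := by
        rw [← abs_of_pos (Real.cosh_pos t), ← sq_lt_sq, Real.cosh_sq]
        linarith
      exact mul_lt_mul'' (sq_lt_sq.1 h) h2 (abs_nonneg _) (abs_nonneg _)
    have hx : x ≠ 0 := fun h0 => by rw [h0] at h; nlinarith [sq_nonneg y]
    have h3 : |x * (y * Real.sinh t)| < x * (x * Real.cosh t) := by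
      have h4 : x * (x * Real.cosh t) = |x| * |x * Real.cosh t| := by
        rw [abs_mul x (Real.cosh t), abs_of_pos (Real.cosh_pos t), ← mul_assoc, ← mul_assoc,
          abs_mul_abs_self]
      rw [h4, abs_mul]
      exact mul_lt_mul_of_pos_left h1 (abs_pos.2 hx)
    have := (abs_lt.1 h3).2
    linarith
  have h1 := mul_pos (key t₁) (key t₂)
  have hx : 0 < x ^ 2 := (sq_nonneg y).trans_lt h
  have : x * (x * Real.cosh t₁ - y * Real.sinh t₁) * (x * (x * Real.cosh t₂ - y * Real.sinh t₂)) =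
      x ^ 2 * ((x * Real.cosh t₁ - y * Real.sinh t₁) * (x * Real.cosh t₂ - y * Real.sinh t₂)) := by
    ring
  rw [this] at h1
  exact pos_of_mul_pos_right h1 hx.le

theorem bilin_c1_c2 (n : Fin 2 → ℝ) :
    bilin A6 n c1 = -2 * boostY n (param P6 c1) ∧ bilin A6 n c2 = -2 * boostY n (param P6 c2) := by
  obtain ⟨h1, h2⟩ := cvec_param_c1_c2
  constructor
  · conv_lhs => rw [← h1]
    exact bilin_cvec n _
  · conv_lhs => rw [← h2]
    exact bilin_cvec n _

/-- The sum of the two summands of `Θ`, in polar coordinates. -/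
theorem thetaPosTerm_add_thetaNegTerm {n : Fin 2 → ℝ} (hn : quad A6 n ≠ 0) (τ : UpperHalfPlane) :
    (0 < quad A6 n → thetaNegTerm A6 P6 c1 c2 τ n = 0) ∧
    (quad A6 n < 0 → thetaPosTerm A6 c1 c2 τ n = 0) ∧
    thetaPosTerm A6 c1 c2 τ n + thetaNegTerm A6 P6 c1 c2 τ n =
      ((1 - Real.sign (2 * param P6 c1 - hypAngle n) *
        Real.sign (2 * param P6 c2 - hypAngle n) : ℝ) : ℂ) *
        (besselK0 (2 * π * |quad A6 n| * τ.im) : ℂ) * e (quad A6 n * τ.re) := by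
  have h6 : √6 ^ 2 = 6 := Real.sq_sqrt (by norm_num)
  have sY : Real.sign (bilin A6 n c1) * Real.sign (bilin A6 n c2) =
      Real.sign (boostY n (param P6 c1)) * Real.sign (boostY n (param P6 c2)) := by
    rw [(bilin_c1_c2 n).1, (bilin_c1_c2 n).2, sign_mul', sign_mul',
      Real.sign_of_neg (by norm_num : (-2 : ℝ) < 0)]
    ring
  have sX : Real.sign (bilin A6 n (cperp P6 (param P6 c1))) *
      Real.sign (bilin A6 n (cperp P6 (param P6 c2))) =
      Real.sign (boostX n (param P6 c1)) * Real.sign (boostX n (param P6 c2)) := by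
    rw [bilin_cperp, bilin_cperp, sign_mul', sign_mul',
      Real.sign_of_pos (by norm_num : (0 : ℝ) < 2), boostX, boostX]
    ring
  -- The sign of `2t - θ` is `-sgn X sgn Y`. In each region one of the two products of signs is 1,
  -- which annihilates one theta summand and leaves the full sign factor in the other.
  have hsgn : Real.sign (2 * param P6 c1 - hypAngle n) * Real.sign (2 * param P6 c2 - hypAngle n) =
      (Real.sign (boostX n (param P6 c1)) * Real.sign (boostX n (param P6 c2))) *
      (Real.sign (boostY n (param P6 c1)) * Real.sign (boostY n (param P6 c2))) := by
    rw [sign_two_mul_sub_hypAngle hn, sign_two_mul_sub_hypAngle hn]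
    ring
  have hneg : 0 < quad A6 n →
      Real.sign (boostX n (param P6 c1)) * Real.sign (boostX n (param P6 c2)) = 1 := fun h => by
    apply sign_mul_self_of_mul_pos
    apply boost_mul_pos
    rw [quad_A6] at h
    rw [mul_pow, mul_pow, h6]
    linarith
  have hpos : quad A6 n < 0 →
      Real.sign (boostY n (param P6 c1)) * Real.sign (boostY n (param P6 c2)) = 1 := fun h => by
    apply sign_mul_self_of_mul_pos
    apply boost_mul_pos
    rw [quad_A6] at h
    rw [mul_pow, mul_pow, h6]
    linarith
  have z1 : 0 < quad A6 n → thetaNegTerm A6 P6 c1 c2 τ n = 0 := fun h => by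
    rw [thetaNegTerm, sX, hneg h]
    simp
  have z2 : quad A6 n < 0 → thetaPosTerm A6 c1 c2 τ n = 0 := fun h => by
    rw [thetaPosTerm, sY, hpos h]
    simp
  refine ⟨z1, z2, ?_⟩
  rcases lt_or_gt_of_ne hn with h | h
  · rw [z2 h, zero_add, thetaNegTerm, hsgn, hpos h, sX, mul_one, abs_of_neg h]
    congr 4
    ring
  · rw [z1 h, add_zero, thetaPosTerm, hsgn, hneg h, sY, one_mul, abs_of_pos h]

/-- The correction term between the summands of `Θ̂` and `Θ` attached to an endpoint `t`. -/
noncomputable def tailTerm (τ : UpperHalfPlane) (t : ℝ) (n : Fin 2 → ℝ) : ℂ :=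
  e (quad A6 n * τ.re) * (besselTail (2 * π * |quad A6 n| * τ.im) (2 * t - hypAngle n) : ℂ)

/-- The real exponent is `-2πτ₂(Q + 2Y²) = -2πτ₂(X² + Y²) = -2πτ₂|Q| cosh(2t - θ)`, whose integral
is known from `integral_exp_neg_mul_cosh`. -/
theorem thetaHatTerm_eq_add_tailTerm {n : Fin 2 → ℝ} (hn : quad A6 n ≠ 0) (τ : UpperHalfPlane) :
    thetaHatTerm A6 P6 c1 c2 τ n =
      1 / 2 * (thetaPosTerm A6 c1 c2 τ n + thetaNegTerm A6 P6 c1 c2 τ n)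
        + tailTerm τ (param P6 c2) n - tailTerm τ (param P6 c1) n := by
  have hlt : param P6 c1 < param P6 c2 := by
    rw [param_c1]; linarith [param_c2_pos]
  have h := integral_exp_neg_mul_cosh (2 * π * |quad A6 n| * τ.im) (hypAngle n) hlt
  have hre : Complex.exp (2 * π * I * (quad A6 n : ℂ) * (τ : ℂ)) =
      e (quad A6 n * τ.re) * ((Real.exp (-2 * π * quad A6 n * τ.im) : ℝ) : ℂ) := by
    rw [e, ofReal_exp, ← Complex.exp_add]
    congr 1
    have : (τ : ℂ) = τ.re + τ.im * I := (Complex.re_add_im (τ : ℂ)).symm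
    rw [this]
    push_cast
    linear_combination (2 * π * quad A6 n * τ.im) * I_sq
  have hint : Real.exp (-2 * π * quad A6 n * τ.im) * (∫ t in (param P6 c1)..(param P6 c2),
      Real.exp (-π * bilin A6 n (cvec P6 t) ^ 2 * τ.im)) =
      ∫ t in (param P6 c1)..(param P6 c2),
        Real.exp (-(2 * π * |quad A6 n| * τ.im) * Real.cosh (2 * t - hypAngle n)) := by
    rw [← intervalIntegral.integral_const_mul]
    refine intervalIntegral.integral_congr fun t _ => ?_
    rw [← Real.exp_add]
    congr 1
    have h1 := (boost_polar hn t).1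
    have h2 := boost_sq_sub n t
    have h3 : bilin A6 n (cvec P6 t) = -2 * boostY n t := bilin_cvec n t
    rw [h3]
    linear_combination (-2 * π * τ.im) * h1 + 2 * π * τ.im * h2
  rw [thetaHatTerm, hre, mul_assoc, ← ofReal_mul, hint, h, (thetaPosTerm_add_thetaNegTerm hn τ).2.2,
    tailTerm, tailTerm]
  push_cast
  ring
end MockMaass

namespace MockMaass
open Complex Real

/-! ### The cosets `μ_j` and `μ_j + λ` -/

/-- The representative `μ_j` or `μ_j + λ`. -/
noncomputable def cosetRep (j : Fin 4) (s : Bool) : Fin 2 → ℝ :=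
  if s then muVec j + lamVec else muVec j

theorem exists_of_mem_coset {j : Fin 4} {s : Bool} {n : Fin 2 → ℝ}
    (hn : n ∈ shiftedLattice (cosetRep j s)) :
    ∃ m k : ℤ, n 0 = m / 6 ∧ n 1 = (2 * k + 1) / 8 := by
  obtain ⟨p, hp⟩ := hn
  have h0 := hp 0
  have h1 := hp 1
  cases s
  · refine ⟨6 * p 0 + (j : ℕ), 4 * p 1, ?_, ?_⟩
    · rw [h0]; simp [cosetRep, muVec]; ring
    · rw [h1]; simp [cosetRep, muVec]; ring
  · refine ⟨6 * p 0 + (j : ℕ) + 3, 4 * p 1 + 2, ?_, ?_⟩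
    · rw [h0]; simp [cosetRep, muVec, lamVec]; ring
    · rw [h1]; simp [cosetRep, muVec, lamVec]; ring

/-- On these cosets `48Q = 8m² - 3(2k + 1)²` is an odd integer. The uniform lower bound keeps the
arguments of `K₀` away from its singularity at 0. -/
theorem le_abs_quad_of_mem_coset {j : Fin 4} {s : Bool} {n : Fin 2 → ℝ}
    (hn : n ∈ shiftedLattice (cosetRep j s)) : 1 / 48 ≤ |quad A6 n| := by
  obtain ⟨m, k, h0, h1⟩ := exists_of_mem_coset hn
  have hz : 8 * m ^ 2 - 3 * (2 * k + 1) ^ 2 ≠ 0 := fun h => by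
    have : 2 * (4 * m ^ 2 - 6 * k ^ 2 - 6 * k - 1) = 1 := by linarith
    omega
  have h2 : (1 : ℝ) ≤ |((8 * m ^ 2 - 3 * (2 * k + 1) ^ 2 : ℤ) : ℝ)| := by
    exact_mod_cast Int.one_le_abs hz
  have h3 : quad A6 n = ((8 * m ^ 2 - 3 * (2 * k + 1) ^ 2 : ℤ) : ℝ) / 48 := by
    rw [quad_A6, h0, h1]
    push_cast
    ring
  rw [h3, abs_div, abs_of_pos (by norm_num : (0 : ℝ) < 48)]
  gcongr

theorem quad_ne_zero_of_mem_coset {j : Fin 4} {s : Bool} {n : Fin 2 → ℝ}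
    (hn : n ∈ shiftedLattice (cosetRep j s)) : quad A6 n ≠ 0 := fun h => by
  have := le_abs_quad_of_mem_coset hn
  rw [h, abs_zero] at this
  norm_num at this

theorem shiftedLattice_diff_zero (j : Fin 4) (s : Bool) :
    shiftedLattice (cosetRep j s) \ {0} = shiftedLattice (cosetRep j s) := by
  refine Set.sdiff_singleton_eq_self fun h => quad_ne_zero_of_mem_coset h ?_
  simp [quad_A6]

/-- The reflections that fix `c₂` (for `ε = 1`) and `c₁` (for `ε = -1`). -/
def reflect (ε : ℝ) (n : Fin 2 → ℝ) : Fin 2 → ℝ :=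
  ![-5 * n 0 + 4 * ε * n 1, -6 * ε * n 0 + 5 * n 1]

theorem reflect_reflect {ε : ℝ} (hε : ε ^ 2 = 1) (n : Fin 2 → ℝ) :
    reflect ε (reflect ε n) = n := by
  funext i
  fin_cases i
  · simp [reflect]
    linear_combination (-24 * n 0) * hε
  · simp [reflect]
    linear_combination (-24 * n 1) * hε

theorem quad_reflect {ε : ℝ} (hε : ε ^ 2 = 1) (n : Fin 2 → ℝ) :
    quad A6 (reflect ε n) = quad A6 n := by
  rw [quad_A6, quad_A6]
  simp [reflect]
  linear_combination (96 * n 1 ^ 2 - 144 * n 0 ^ 2) * hε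

/-- The reflections are integral and move `μ_j` to `μ_j + λ` modulo `ℤ²`. This is why the two cosets
are combined in `H_j`. -/
theorem reflect_mem {ε : ℤ} (hε : ε = 1 ∨ ε = -1) (j : Fin 4) (s : Bool) {n : Fin 2 → ℝ}
    (hn : n ∈ shiftedLattice (cosetRep j s)) :
    reflect ε n ∈ shiftedLattice (cosetRep j !s) := by
  obtain ⟨p, hp⟩ := hn
  have h0 := hp 0
  have h1 := hp 1
  rcases hε with rfl | rfl <;> cases s <;>
    simp [cosetRep, muVec, lamVec] at h0 h1
  · refine ⟨![-5 * p 0 + 4 * p 1 - (j : ℕ), -6 * p 0 + 5 * p 1 - (j : ℕ)], fun i => ?_⟩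
    fin_cases i <;> simp [cosetRep, muVec, lamVec, reflect, h0, h1] <;> ring
  · refine ⟨![-5 * p 0 + 4 * p 1 - (j : ℕ), -6 * p 0 + 5 * p 1 - (j : ℕ)], fun i => ?_⟩
    fin_cases i <;> simp [cosetRep, muVec, reflect, h0, h1] <;> ring
  · refine ⟨![-5 * p 0 - 4 * p 1 - (j : ℕ) - 1, 6 * p 0 + 5 * p 1 + (j : ℕ)], fun i => ?_⟩
    fin_cases i <;> simp [cosetRep, muVec, lamVec, reflect, h0, h1] <;> ring
  · refine ⟨![-5 * p 0 - 4 * p 1 - (j : ℕ) - 5, 6 * p 0 + 5 * p 1 + (j : ℕ) + 6], fun i => ?_⟩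
    fin_cases i <;> simp [cosetRep, muVec, reflect, h0, h1] <;> ring

/-- In the boosted coordinates at `t = εT` the reflection is `(X, Y) ↦ (-X, Y)`. It changes the sign
of `2t - θ` and preserves `Q`, and the tail is odd. -/
theorem tailTerm_reflect {ε : ℝ} (hε : ε = 1 ∨ ε = -1) (τ : UpperHalfPlane) {n : Fin 2 → ℝ}
    (hn : quad A6 n ≠ 0) :
    tailTerm τ (ε * param P6 c2) (reflect ε n) = -tailTerm τ (ε * param P6 c2) n := by
  have hε2 : ε ^ 2 = 1 := by rcases hε with h | h <;> rw [h] <;> norm_num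
  have hn' : quad A6 (reflect ε n) ≠ 0 := by rwa [quad_reflect hε2]
  have h3 : √6 = √2 * √3 := by rw [← Real.sqrt_mul (by norm_num)]; norm_num
  have h22 : √2 ^ 2 = 2 := Real.sq_sqrt (by norm_num)
  have h33 : √3 ^ 2 = 3 := Real.sq_sqrt (by norm_num)
  have hs : Real.sinh (ε * param P6 c2) = ε * √2 := by
    rcases hε with h | h
    · rw [h, one_mul, one_mul, sinh_param_c2]
    · rw [h, neg_one_mul, neg_one_mul, Real.sinh_neg, sinh_param_c2]
  have hc : Real.cosh (ε * param P6 c2) = √3 := by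
    rcases hε with h | h
    · rw [h, one_mul, cosh_param_c2]
    · rw [h, neg_one_mul, Real.cosh_neg, cosh_param_c2]
  have hX : boostX (reflect ε n) (ε * param P6 c2) = -boostX n (ε * param P6 c2) := by
    rw [boostX, boostX, hs, hc, h3]
    simp only [reflect, Matrix.cons_val_zero, Matrix.cons_val_one]
    linear_combination (4 * √2 * n 1 * ε + -4 * √2 * n 0) * h33 + 12 * √2 * n 0 * hε2
  have hY : boostY (reflect ε n) (ε * param P6 c2) = boostY n (ε * param P6 c2) := by
    rw [boostY, boostY, hs, hc, h3]
    simp only [reflect, Matrix.cons_val_zero, Matrix.cons_val_one]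
    linear_combination (6 * √3 * n 0 * ε - 4 * ε ^ 2 * n 1 * √3) * h22 - 8 * √3 * n 1 * hε2
  have hw : 2 * (ε * param P6 c2) - hypAngle (reflect ε n) =
      -(2 * (ε * param P6 c2) - hypAngle n) := by
    have h1 := (boost_polar hn (ε * param P6 c2)).2
    have h2 := (boost_polar hn' (ε * param P6 c2)).2
    rw [hX, hY, quad_reflect hε2] at h2
    apply Real.sinh_injective
    rw [Real.sinh_neg]
    have hq : |quad A6 n| ≠ 0 := abs_ne_zero.2 hn
    apply mul_left_cancel₀ hq
    linarith
  rw [tailTerm, tailTerm, hw, besselTail_neg, quad_reflect hε2]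
  push_cast
  ring

theorem tsum_tailTerm {ε : ℤ} (hε : ε = 1 ∨ ε = -1) (j : Fin 4) (τ : UpperHalfPlane) :
    ∑' n : shiftedLattice (cosetRep j true), tailTerm τ (ε * param P6 c2) n =
      -∑' n : shiftedLattice (cosetRep j false), tailTerm τ (ε * param P6 c2) n := by
  have hε2 : ε ^ 2 = 1 := by rcases hε with h | h <;> rw [h] <;> norm_num
  have hεr : (ε : ℝ) = 1 ∨ (ε : ℝ) = -1 := by
    rcases hε with h | h
    · left; rw [h]; norm_num
    · right; rw [h]; norm_num
  let E : shiftedLattice (cosetRep j false) ≃ shiftedLattice (cosetRep j true) :=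
    { toFun := fun n => ⟨reflect ε n, reflect_mem hε j false n.2⟩
      invFun := fun n => ⟨reflect ε n, reflect_mem hε j true n.2⟩
      left_inv := fun n => Subtype.ext (reflect_reflect (by exact_mod_cast hε2) _)
      right_inv := fun n => Subtype.ext (reflect_reflect (by exact_mod_cast hε2) _) }
  rw [← E.tsum_eq, ← tsum_neg]
  exact tsum_congr fun n => tailTerm_reflect hεr τ (quad_ne_zero_of_mem_coset n.2)

/-- The bound for the tail is `exp(-πτ₂(X² + Y²)) K₀(π|Q|τ₂)`: a Gaussian times a factor bounded
through `|Q| ≥ 1/48`. -/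
theorem summable_tailTerm (j : Fin 4) (s : Bool) (τ : UpperHalfPlane) (t : ℝ) :
    Summable fun n : shiftedLattice (cosetRep j s) => tailTerm τ t n := by
  rw [← (shiftedLatticeEquiv _).summable_iff]
  have hτ := τ.im_pos
  refine Summable.of_norm_bounded ((summable_exp_shift
    (c := 4 * π * τ.im * Real.exp (-2 * |t|)) (by positivity) (cosetRep j s 0)
    (cosetRep j s 1)).mul_right (besselK0 (π * τ.im / 48))) fun p => ?_
  rw [Function.comp_apply, ← shiftedLatticeEquiv_apply_zero, ← shiftedLatticeEquiv_apply_one]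
  have hmem := (shiftedLatticeEquiv (cosetRep j s) p).2
  generalize (shiftedLatticeEquiv (cosetRep j s) p : Fin 2 → ℝ) = n at hmem ⊢
  have hq := le_abs_quad_of_mem_coset hmem
  have hqp : 0 < |quad A6 n| := by linarith
  have h6 : √6 ^ 2 = 6 := Real.sq_sqrt (by norm_num)
  rw [tailTerm, norm_mul, norm_e, one_mul, norm_real, Real.norm_eq_abs]
  refine (abs_besselTail_le (by positivity) _).trans
    (mul_le_mul (Real.exp_le_exp.2 ?_) (besselK0_anti (by positivity) ?_) (besselK0_nonneg _)
      (Real.exp_pos _).le)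
  · have h1 := (boost_polar (abs_pos.1 hqp) t).1
    have h2 := exp_neg_mul_le_boost t (√6 * n 0) (2 * n 1)
    have h3 : Real.exp (-2 * |t|) * (4 * (n 0 ^ 2 + n 1 ^ 2)) ≤
        Real.exp (-2 * |t|) * ((√6 * n 0) ^ 2 + (2 * n 1) ^ 2) := by
      refine mul_le_mul_of_nonneg_left ?_ (Real.exp_pos _).le
      rw [mul_pow, h6]
      nlinarith [sq_nonneg (n 0)]
    have h4 := mul_le_mul_of_nonneg_left (h3.trans h2) (by positivity : 0 ≤ π * τ.im)
    have h5 : π * τ.im * (boostX n t ^ 2 + boostY n t ^ 2) =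
      (2 * π * |quad A6 n| * τ.im / 2) * Real.cosh (2 * t - hypAngle n) := by rw [h1]; ring
    rw [boostX, boostY] at h5
    linarith
  · have := mul_le_mul_of_nonneg_left hq (by positivity : 0 ≤ π * τ.im)
    linarith

/-- The sum of the two summands is twice a completed summand minus tails, all summable. At each `n`
at most one of the two is nonzero, so both series are dominated by their sum. -/
theorem summable_thetaTerms (j : Fin 4) (s : Bool) (τ : UpperHalfPlane) :
    (Summable fun n : shiftedLattice (cosetRep j s) => thetaPosTerm A6 c1 c2 τ n) ∧
      (Summable fun n : shiftedLattice (cosetRep j s) => thetaNegTerm A6 P6 c1 c2 τ n) := by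
  have hsum : Summable fun n : shiftedLattice (cosetRep j s) =>
      thetaPosTerm A6 c1 c2 τ n + thetaNegTerm A6 P6 c1 c2 τ n := by
    refine ((((summable_thetaHatTerm (cosetRep j s) τ).sub
      (summable_tailTerm j s τ (param P6 c2))).add
      (summable_tailTerm j s τ (param P6 c1))).mul_left 2).congr fun n => ?_
    rw [thetaHatTerm_eq_add_tailTerm (quad_ne_zero_of_mem_coset n.2)]
    ring
  constructor
  · refine Summable.of_norm_bounded hsum.norm fun n => ?_
    have hq := quad_ne_zero_of_mem_coset n.2
    obtain ⟨h1, h2, -⟩ := thetaPosTerm_add_thetaNegTerm hq τ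
    rcases lt_or_gt_of_ne hq with h | h
    · rw [h2 h, norm_zero]; exact norm_nonneg _
    · rw [h1 h, add_zero]
  · refine Summable.of_norm_bounded hsum.norm fun n => ?_
    have hq := quad_ne_zero_of_mem_coset n.2
    obtain ⟨h1, h2, -⟩ := thetaPosTerm_add_thetaNegTerm hq τ
    rcases lt_or_gt_of_ne hq with h | h
    · rw [h2 h, zero_add]
    · rw [h1 h, norm_zero]; exact norm_nonneg _

theorem theta_cosetRep (j : Fin 4) (s : Bool) (τ : UpperHalfPlane) :
    theta A6 P6 c1 c2 (cosetRep j s) τ = √τ.im * ∑' n : shiftedLattice (cosetRep j s),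
      (1 / 2) * (thetaPosTerm A6 c1 c2 τ n + thetaNegTerm A6 P6 c1 c2 τ n) := by
  have hlt : 0 < param P6 c2 - param P6 c1 := by
    rw [param_c1]; linarith [param_c2_pos]
  have hno : ¬ ∃ m : Fin 2 → ℤ, ∀ i, cosetRep j s i = (m i : ℝ) := by
    rintro ⟨m, hm⟩
    have h := hm 1
    cases s
    · simp [cosetRep, muVec] at h
      have h8 : (8 * m 1 : ℤ) = 1 := by
        have : (8 * m 1 : ℝ) = 1 := by linarith
        exact_mod_cast this
      omega
    · simp [cosetRep, muVec, lamVec] at h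
      have h8 : (8 * m 1 : ℤ) = 5 := by
        have : (8 * m 1 : ℝ) = 5 := by linarith
        exact_mod_cast this
      omega
  obtain ⟨hp, hn⟩ := summable_thetaTerms j s τ
  rw [theta, if_neg hno, add_zero, Real.sign_of_pos hlt, shiftedLattice_diff_zero, ← mul_add,
    ← hp.tsum_add hn, tsum_mul_left]
  push_cast
  ring

theorem H_eq_sum_tsum (j : Fin 4) (τ : UpperHalfPlane) :
    H j τ = √τ.im * ∑ s : Bool, ∑' n : shiftedLattice (cosetRep j s),
      (1 / 2) * (thetaPosTerm A6 c1 c2 τ n + thetaNegTerm A6 P6 c1 c2 τ n) := by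
  have h0 := theta_cosetRep j false τ
  have h1 := theta_cosetRep j true τ
  rw [Fintype.sum_bool, mul_add, ← h0, ← h1, add_comm]
  rfl

/-- At each endpoint the tails of the two cosets cancel by `tsum_tailTerm`. -/
theorem H_eq_Hhat (j : Fin 4) (τ : UpperHalfPlane) : H j τ = Hhat j τ := by
  have h : ∀ s, ∑' n : shiftedLattice (cosetRep j s), thetaHatTerm A6 P6 c1 c2 τ n =
      (∑' n : shiftedLattice (cosetRep j s),
        (1 / 2) * (thetaPosTerm A6 c1 c2 τ n + thetaNegTerm A6 P6 c1 c2 τ n))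
      + ∑' n : shiftedLattice (cosetRep j s), tailTerm τ (param P6 c2) n
      - ∑' n : shiftedLattice (cosetRep j s), tailTerm τ (param P6 c1) n := fun s => by
    obtain ⟨hp, hn⟩ := summable_thetaTerms j s τ
    have h1 := (hp.add hn).mul_left (1 / 2)
    have h2 := summable_tailTerm j s τ (param P6 c2)
    have h3 := summable_tailTerm j s τ (param P6 c1)
    rw [← h1.tsum_add h2, ← (h1.add h2).tsum_sub h3]
    exact tsum_congr fun n => thetaHatTerm_eq_add_tailTerm (quad_ne_zero_of_mem_coset n.2) τ
  have e2 := tsum_tailTerm (Or.inl rfl) j τ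
  have e1 := tsum_tailTerm (Or.inr rfl) j τ
  rw [Int.cast_one, one_mul] at e2
  rw [Int.cast_neg, Int.cast_one, neg_one_mul, ← param_c1] at e1
  have hh : Hhat j τ = √τ.im * ((∑' n : shiftedLattice (cosetRep j false),
      thetaHatTerm A6 P6 c1 c2 τ n) + ∑' n : shiftedLattice (cosetRep j true),
      thetaHatTerm A6 P6 c1 c2 τ n) := by
    rw [mul_add]; rfl
  rw [H_eq_sum_tsum, hh, Fintype.sum_bool, h, h, e1, e2]
  ring
end MockMaass

namespace MockMaass
open Complex Real MeasureTheory

/-! ### Integrals of exponentials of real-linear forms on the upper half-plane -/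

section ExpIntegral

variable {Ω : Type*} [MeasurableSpace Ω] {μ : Measure Ω} {h k : Ω → ℝ}

/-- `exp(-h Im z + i k Re z)`. -/
noncomputable def expPhase (h k : Ω → ℝ) (z : ℂ) (a : Ω) : ℂ :=
  cexp (-(h a * z.im : ℝ) + I * (k a * z.re : ℝ))

/-- Weights for which all exponential integrals over the upper half-plane converge. -/
structure IsExpWeight (μ : Measure Ω) (h : Ω → ℝ) (w : Ω → ℂ) : Prop where
  aesm : AEStronglyMeasurable w μ
  integrable : ∀ y > 0, Integrable (fun a => Real.exp (-(h a * y)) * ‖w a‖) μ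

/-- `∫ w exp(-h Im z + i k Re z)`. -/
noncomputable def expIntegral (μ : Measure Ω) (h k : Ω → ℝ) (w : Ω → ℂ) (z : ℂ) : ℂ :=
  ∫ a, expPhase h k z a * w a ∂μ

theorem norm_expPhase {α : Type*} {h k : α → ℝ} (z : ℂ) (a : α) :
    ‖expPhase h k z a‖ = Real.exp (-(h a * z.im)) := by
  rw [expPhase, Complex.norm_exp]
  simp

/-- Half of the exponential absorbs the factor `x`. This is what lets each derivative cost only a
smaller `y`. -/
theorem mul_exp_neg_mul_le (x : ℝ) {y : ℝ} (hy : 0 < y) :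
    x * Real.exp (-(x * y)) ≤ 2 / y * Real.exp (-(x * (y / 2))) := by
  have h1 : x * y / 2 ≤ Real.exp (x * y / 2) := by linarith [Real.add_one_le_exp (x * y / 2)]
  have h2 : Real.exp (-(x * y)) = Real.exp (-(x * (y / 2))) * Real.exp (-(x * y / 2)) := by
    rw [← Real.exp_add]; congr 1; ring
  have h3 : x * Real.exp (-(x * y / 2)) ≤ 2 / y := by
    rw [Real.exp_neg, ← div_eq_mul_inv, div_le_div_iff₀ (Real.exp_pos _) hy]
    linarith
  rw [h2]
  nlinarith [Real.exp_pos (-(x * (y / 2)))]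

/-- Closure under factors bounded by `h` makes differentiation repeatable: each partial derivative
multiplies the weight by `ik` or `-h`. -/
theorem IsExpWeight.mul {w : Ω → ℂ} (hw : IsExpWeight μ h w) {m : Ω → ℂ} (hm : Measurable m)
    (hmh : ∀ a, ‖m a‖ ≤ h a) : IsExpWeight μ h fun a => m a * w a := by
  refine ⟨hm.aestronglyMeasurable.mul hw.aesm, fun y hy => ?_⟩
  have hi := (hw.integrable (y / 2) (half_pos hy)).const_mul (2 / y)
  have hi' := hw.integrable y hy
  have hmeas : AEStronglyMeasurable (fun a => Real.exp (-(h a * y)) * ‖m a * w a‖) μ := by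
    have := hi'.aestronglyMeasurable.mul hm.norm.aestronglyMeasurable
    refine this.congr (Filter.Eventually.of_forall fun a => ?_)
    simp only [Pi.mul_apply, norm_mul]
    ring
  refine hi.mono' hmeas (Filter.Eventually.of_forall fun a => ?_)
  rw [norm_mul, norm_norm, norm_mul, Real.norm_of_nonneg (Real.exp_pos _).le]
  have h1 := mul_exp_neg_mul_le (h a) hy
  have h2 := mul_le_mul_of_nonneg_right (hmh a) (Real.exp_pos (-(h a * y))).le
  calc Real.exp (-(h a * y)) * (‖m a‖ * ‖w a‖)
      = (‖m a‖ * Real.exp (-(h a * y))) * ‖w a‖ := by ring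
    _ ≤ (2 / y * Real.exp (-(h a * (y / 2)))) * ‖w a‖ :=
        mul_le_mul_of_nonneg_right (h2.trans h1) (norm_nonneg _)
    _ = _ := by ring

theorem IsExpWeight.integrable_expPhase_mul {w : Ω → ℂ} (hw : IsExpWeight μ h w)
    (hh : Measurable h) (hk : Measurable k) {z : ℂ} (hz : 0 < z.im) :
    Integrable (fun a => expPhase h k z a * w a) μ := by
  have hm : Measurable (expPhase h k z) := by unfold expPhase; fun_prop
  refine (hw.integrable z.im hz).mono' (hm.aestronglyMeasurable.mul hw.aesm)
    (Filter.Eventually.of_forall fun a => ?_)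
  rw [norm_mul, norm_expPhase]

theorem hasFDerivAt_expPhase {α : Type*} {h k : α → ℝ} (a : α) (z : ℂ) :
    HasFDerivAt (fun z => expPhase h k z a)
      (reCLM.smulRight (expPhase h k z a * (I * k a)) +
        imCLM.smulRight (expPhase h k z a * (-h a : ℂ))) z := by
  have h1 : HasFDerivAt (fun z : ℂ => (-(h a * z.im : ℝ) + I * (k a * z.re : ℝ) : ℂ))
      (reCLM.smulRight (I * k a) + imCLM.smulRight (-h a : ℂ)) z := by
    have : (fun z : ℂ => (-(h a * z.im : ℝ) + I * (k a * z.re : ℝ) : ℂ)) =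
        (reCLM.smulRight (I * k a) + imCLM.smulRight (-h a : ℂ) : ℂ →L[ℝ] ℂ) := by
      funext z
      simp
      ring
    rw [this]
    exact ContinuousLinearMap.hasFDerivAt _
  refine (h1.cexp).congr_fderiv ?_
  ext v
  simp [expPhase]
  ring

theorem hasFDerivAt_expIntegral (hh : Measurable h) (hk : Measurable k)
    (hkh : ∀ a, |k a| ≤ h a) {w : Ω → ℂ} (hw : IsExpWeight μ h w) {z : ℂ} (hz : 0 < z.im) :
    HasFDerivAt (expIntegral μ h k w)
      (reCLM.smulRight (expIntegral μ h k (fun a => I * k a * w a) z) +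
        imCLM.smulRight (expIntegral μ h k (fun a => (-h a : ℂ) * w a) z)) z := by
  have hk' : IsExpWeight μ h fun a => I * k a * w a :=
    hw.mul (by fun_prop) fun a => by simpa using hkh a
  have hh' : IsExpWeight μ h fun a => (-h a : ℂ) * w a :=
    hw.mul (by fun_prop) fun a => by
      rw [norm_neg, norm_real, Real.norm_of_nonneg ((abs_nonneg _).trans (hkh a))]
  have hmz : ∀ z, AEStronglyMeasurable (fun a => expPhase h k z a * w a) μ := fun z => by
    have hm : Measurable (expPhase h k z) := by unfold expPhase; fun_prop
    exact hm.aestronglyMeasurable.mul hw.aesm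
  have ik := hk'.integrable_expPhase_mul hh hk hz
  have ih := hh'.integrable_expPhase_mul hh hk hz
  set Lr : ℂ →L[ℝ] (ℂ →L[ℝ] ℂ) := ContinuousLinearMap.smulRightL ℝ ℂ ℂ reCLM with hLr
  set Li : ℂ →L[ℝ] (ℂ →L[ℝ] ℂ) := ContinuousLinearMap.smulRightL ℝ ℂ ℂ imCLM with hLi
  have key := hasFDerivAt_integral_of_dominated_of_fderiv_le (𝕜 := ℝ) (μ := μ) (x₀ := z)
    -- On this neighbourhood the derivative is dominated by its size at height `Im z / 2`.
    (s := {z' : ℂ | z.im / 2 < z'.im})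
    (F := fun z a => expPhase h k z a * w a)
    (F' := fun z a => Lr (expPhase h k z a * (I * k a * w a)) +
        Li (expPhase h k z a * ((-h a : ℂ) * w a)))
    (bound := fun a => Real.exp (-(h a * (z.im / 2))) * ‖I * k a * w a‖ +
      Real.exp (-(h a * (z.im / 2))) * ‖(-h a : ℂ) * w a‖)
    ((isOpen_lt continuous_const continuous_im).mem_nhds (by simp; linarith))
    (Filter.Eventually.of_forall hmz)
    (hw.integrable_expPhase_mul hh hk hz)
    ((Lr.continuous.comp_aestronglyMeasurable ik.aestronglyMeasurable).add
      (Li.continuous.comp_aestronglyMeasurable ih.aestronglyMeasurable))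
    (Filter.Eventually.of_forall fun a z' hz' => ?_)
    ((hk'.integrable _ (half_pos hz)).add (hh'.integrable _ (half_pos hz)))
    (Filter.Eventually.of_forall fun a z' _ => ?_)
  · refine key.congr_fderiv ?_
    rw [integral_add (Lr.integrable_comp ik) (Li.integrable_comp ih), Lr.integral_comp_comm ik,
      Li.integral_comp_comm ih]
    rfl
  · have hz'' : z.im / 2 < z'.im := hz'
    have hh0 : 0 ≤ h a := (abs_nonneg _).trans (hkh a)
    have he : ‖expPhase h k z' a‖ ≤ Real.exp (-(h a * (z.im / 2))) := by
      rw [norm_expPhase]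
      apply Real.exp_le_exp.2
      nlinarith
    have hr : ∀ c : ℂ, ‖Lr c‖ ≤ ‖c‖ := fun c => by
      have : Lr c = reCLM.smulRight c := rfl
      rw [this, ContinuousLinearMap.norm_smulRight_apply, reCLM_norm, one_mul]
    have hi : ∀ c : ℂ, ‖Li c‖ ≤ ‖c‖ := fun c => by
      have : Li c = imCLM.smulRight c := rfl
      rw [this, ContinuousLinearMap.norm_smulRight_apply, imCLM_norm, one_mul]
    refine (norm_add_le _ _).trans (add_le_add ((hr _).trans ?_) ((hi _).trans ?_))
    · rw [norm_mul]; gcongr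
    · rw [norm_mul]; gcongr
  · refine ((hasFDerivAt_expPhase a z').mul_const (w a)).congr_fderiv ?_
    have e1 : ∀ c : ℂ, Lr c = reCLM.smulRight c := fun _ => rfl
    have e2 : ∀ c : ℂ, Li c = imCLM.smulRight c := fun _ => rfl
    rw [e1, e2]
    ext
    simp
    ring

theorem contDiffOn_expIntegral (hh : Measurable h) (hk : Measurable k)
    (hkh : ∀ a, |k a| ≤ h a) {w : Ω → ℂ} (hw : IsExpWeight μ h w) :
    ContDiffOn ℝ ∞ (expIntegral μ h k w) {z : ℂ | 0 < z.im} := by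
  have hU : IsOpen {z : ℂ | 0 < z.im} := isOpen_lt continuous_const continuous_im
  rw [contDiffOn_infty]
  intro n
  induction n generalizing w with
  | zero =>
    rw [Nat.cast_zero, contDiffOn_zero]
    exact fun z hz =>
      (hasFDerivAt_expIntegral hh hk hkh hw hz).continuousAt.continuousWithinAt
  | succ n ih =>
    have hk' : IsExpWeight μ h fun a => I * k a * w a :=
      hw.mul (by fun_prop) fun a => by simpa using hkh a
    have hh' : IsExpWeight μ h fun a => (-h a : ℂ) * w a :=
      hw.mul (by fun_prop) fun a => by
        rw [norm_neg, norm_real, Real.norm_of_nonneg ((abs_nonneg _).trans (hkh a))]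
    rw [Nat.cast_succ, contDiffOn_succ_iff_fderiv_of_isOpen hU]
    refine ⟨fun z hz =>
      (hasFDerivAt_expIntegral hh hk hkh hw hz).differentiableAt.differentiableWithinAt,
      fun h => absurd h (by simp), ?_⟩
    have h1 := (ContinuousLinearMap.contDiff (n := n)
      (ContinuousLinearMap.smulRightL ℝ ℂ ℂ reCLM)).comp_contDiffOn (ih hk')
    have h2 := (ContinuousLinearMap.contDiff (n := n)
      (ContinuousLinearMap.smulRightL ℝ ℂ ℂ imCLM)).comp_contDiffOn (ih hh')
    exact (h1.add h2).congr fun z hz => (hasFDerivAt_expIntegral hh hk hkh hw hz).fderiv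

theorem IsExpWeight.mul_h {w : Ω → ℂ} (hw : IsExpWeight μ h w) (hh : Measurable h)
    (hkh : ∀ a, |k a| ≤ h a) : IsExpWeight μ h fun a => (-h a : ℂ) * w a :=
  hw.mul (by fun_prop) fun a => by
    rw [norm_neg, norm_real, Real.norm_of_nonneg ((abs_nonneg _).trans (hkh a))]

theorem IsExpWeight.mul_k {w : Ω → ℂ} (hw : IsExpWeight μ h w) (hk : Measurable k)
    (hkh : ∀ a, |k a| ≤ h a) : IsExpWeight μ h fun a => I * k a * w a :=
  hw.mul (by fun_prop) fun a => by simpa using hkh a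

theorem hasFDerivAt_sqrt_im {z : ℂ} (hz : 0 < z.im) :
    HasFDerivAt (fun z : ℂ => ((√z.im : ℝ) : ℂ))
      (imCLM.smulRight ((1 / (2 * √z.im) : ℝ) : ℂ)) z := by
  have h1 : HasFDerivAt (fun z : ℂ => √z.im) ((1 / (2 * √z.im)) • imCLM) z :=
    (imCLM.hasFDerivAt (x := z)).sqrt hz.ne'
  refine (ofRealCLM.hasFDerivAt.comp z h1).congr_fderiv ?_
  ext v
  simp
  ring

theorem hasFDerivAt_inv_sqrt_im {z : ℂ} (hz : 0 < z.im) :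
    HasFDerivAt (fun z : ℂ => ((1 / (2 * √z.im) : ℝ) : ℂ))
      (imCLM.smulRight ((-(1 / (4 * z.im * √z.im)) : ℝ) : ℂ)) z := by
  have hs : √z.im ≠ 0 := (Real.sqrt_pos.2 hz).ne'
  have h0 : HasDerivAt (fun y : ℝ => 1 / (2 * √y)) (-(1 / (4 * z.im * √z.im))) z.im := by
    have h1 := ((Real.hasDerivAt_sqrt hz.ne').const_mul 2).inv (by positivity)
    refine (h1.congr_deriv ?_).congr_of_eventuallyEq (Filter.Eventually.of_forall fun y => ?_)
    · have := Real.sq_sqrt hz.le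
      field_simp
      rw [this]
      ring
    · simp
  have h1 := h0.comp_hasFDerivAt z (imCLM.hasFDerivAt (x := z))
  refine (ofRealCLM.hasFDerivAt.comp z h1).congr_fderiv ?_
  ext v
  simp
  ring

/-- The Laplacian of `√(Im z) F(z)` in terms of the partial derivatives of `F`. -/
theorem laplacian_sqrt_im_mul {F Fx Fy : ℂ → ℂ} {Fxx Fxy Fyx Fyy : ℂ} {z : ℂ} (hz : 0 < z.im)
    (hF : ContDiffOn ℝ ∞ F {z : ℂ | 0 < z.im})
    (h1 : ∀ z : ℂ, 0 < z.im → HasFDerivAt F (reCLM.smulRight (Fx z) + imCLM.smulRight (Fy z)) z)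
    (hx : HasFDerivAt Fx (reCLM.smulRight Fxx + imCLM.smulRight Fxy) z)
    (hy : HasFDerivAt Fy (reCLM.smulRight Fyx + imCLM.smulRight Fyy) z)
    (hker : (z.im : ℂ) * (Fxx + Fyy) + Fy z = 0) :
    -((z.im : ℂ) ^ 2) * Laplacian.laplacian (fun z => (√z.im : ℂ) * F z) z =
      1 / 4 * ((√z.im : ℂ) * F z) := by
  have hU : IsOpen {z : ℂ | 0 < z.im} := isOpen_lt continuous_const continuous_im
  have d0 : ∀ z' : ℂ, 0 < z'.im → HasFDerivAt (fun z => (√z.im : ℂ) * F z)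
      (reCLM.smulRight ((√z'.im : ℂ) * Fx z') + imCLM.smulRight
        (((1 / (2 * √z'.im) : ℝ) : ℂ) * F z' + (√z'.im : ℂ) * Fy z')) z' := fun z' hz' => by
    refine ((hasFDerivAt_sqrt_im hz').mul (h1 z' hz')).congr_fderiv ?_
    ext v
    simp
    ring
  have hev : ∀ v : ℂ, (fun z' => fderiv ℝ (fun z => (√z.im : ℂ) * F z) z' v) =ᶠ[nhds z]
      fun z' => v.re * ((√z'.im : ℂ) * Fx z') + v.im *
        (((1 / (2 * √z'.im) : ℝ) : ℂ) * F z' + (√z'.im : ℂ) * Fy z') := fun v => by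
    filter_upwards [hU.mem_nhds hz] with z' hz'
    rw [(d0 z' hz').fderiv]
    simp [mul_add]
  have hdd : DifferentiableAt ℝ (fderiv ℝ (fun z => (√z.im : ℂ) * F z)) z := by
    have hs : ContDiffOn ℝ ∞ (fun z : ℂ => ((√z.im : ℝ) : ℂ)) {z : ℂ | 0 < z.im} :=
      ofRealCLM.contDiff.comp_contDiffOn
        (ContDiffOn.sqrt imCLM.contDiff.contDiffOn fun z hz => ne_of_gt hz)
    have := ((hs.mul hF).fderiv_of_isOpen (m := 1) hU (by norm_cast)).differentiableOn (by norm_num)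
    exact this.differentiableAt (hU.mem_nhds hz)
  have hsnd : ∀ v : ℂ, fderiv ℝ (fderiv ℝ (fun z => (√z.im : ℂ) * F z)) z v v =
      fderiv ℝ (fun z' => fderiv ℝ (fun z => (√z.im : ℂ) * F z) z' v) z v := fun v => by
    rw [fderiv_clm_apply hdd (differentiableAt_const v)]
    simp
  have e1 : fderiv ℝ (fderiv ℝ (fun z => (√z.im : ℂ) * F z)) z 1 1 = (√z.im : ℂ) * Fxx := by
    have h : HasFDerivAt (fun z' : ℂ => (√z'.im : ℂ) * Fx z') _ z := (hasFDerivAt_sqrt_im hz).mul hx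
    rw [hsnd, (hev 1).fderiv_eq]
    simp only [one_re, one_im, ofReal_one, ofReal_zero, one_mul, zero_mul, add_zero]
    rw [h.fderiv]
    simp
  have e2 : fderiv ℝ (fderiv ℝ (fun z => (√z.im : ℂ) * F z)) z I I =
      ((-(1 / (4 * z.im * √z.im)) : ℝ) : ℂ) * F z + 2 * ((1 / (2 * √z.im) : ℝ) : ℂ) * Fy z +
      (√z.im : ℂ) * Fyy := by
    have h : HasFDerivAt (fun z' : ℂ => ((1 / (2 * √z'.im) : ℝ) : ℂ) * F z' + (√z'.im : ℂ) * Fy z')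
      _ z := ((hasFDerivAt_inv_sqrt_im hz).mul (h1 z hz)).add ((hasFDerivAt_sqrt_im hz).mul hy)
    rw [hsnd, (hev I).fderiv_eq]
    simp only [I_re, I_im, ofReal_one, ofReal_zero, one_mul, zero_mul, zero_add]
    rw [h.fderiv]
    simp
    ring
  -- With `y = Im z`, the Laplacian of `√y F` is `√y ΔF + F_y/√y - F/(4y√y)`. After multiplication
  -- by `-y²` the last term is the eigenvalue term, and the others form `-y√y (y ΔF + F_y)`, which
  -- `hker` kills.
  rw [InnerProductSpace.laplacian_eq_iteratedFDeriv_complexPlane]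
  simp only [iteratedFDeriv_two_apply, Matrix.cons_val_zero, Matrix.cons_val_one]
  rw [e1, e2]
  have hs : ((√z.im : ℝ) : ℂ) ≠ 0 := by
    exact_mod_cast (Real.sqrt_pos.2 hz).ne'
  have hs2 : (z.im : ℂ) = ((√z.im : ℝ) : ℂ) ^ 2 := by
    exact_mod_cast (Real.sq_sqrt hz.le).symm
  clear e1 e2 hsnd hdd hev d0 h1 hx hy hF
  push_cast
  generalize ((√z.im : ℝ) : ℂ) = s at *
  rw [hs2] at hker ⊢
  field_simp
  linear_combination (-4 * s ^ 2) * hker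

/-- `√(Im z) ∫ w exp(-h Im z + i k Re z)` is an eigenfunction of the hyperbolic Laplacian as soon as
the remainder from differentiating under the integral sign vanishes. -/
theorem laplacian_sqrt_mul_expIntegral (hh : Measurable h) (hk : Measurable k)
    (hkh : ∀ a, |k a| ≤ h a) {w : Ω → ℂ} (hw : IsExpWeight μ h w) {z : ℂ} (hz : 0 < z.im)
    (hker : ∫ a, expPhase h k z a * ((z.im * (h a ^ 2 - k a ^ 2) - h a : ℝ) * w a) ∂μ = 0) :
    -((z.im : ℂ) ^ 2) * Laplacian.laplacian (fun z => (√z.im : ℂ) * expIntegral μ h k w z) z =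
      1 / 4 * ((√z.im : ℂ) * expIntegral μ h k w z) := by
  have hw1 := hw.mul_h hh hkh
  have hw2 := hw.mul_k hk hkh
  have i1 := hw1.integrable_expPhase_mul hh hk hz
  have i11 := (hw1.mul_h hh hkh).integrable_expPhase_mul hh hk hz
  have i22 := (hw2.mul_k hk hkh).integrable_expPhase_mul hh hk hz
  refine laplacian_sqrt_im_mul hz (contDiffOn_expIntegral hh hk hkh hw)
    (fun z hz => hasFDerivAt_expIntegral hh hk hkh hw hz)
    (hasFDerivAt_expIntegral hh hk hkh hw2 hz) (hasFDerivAt_expIntegral hh hk hkh hw1 hz) ?_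
  rw [← hker]
  have e := integral_add ((i22.add i11).const_mul (z.im : ℂ)) i1
  rw [integral_const_mul, integral_add' i22 i11] at e
  refine e.symm.trans (integral_congr_ae (Filter.Eventually.of_forall fun a => ?_))
  simp only [Pi.add_apply]
  push_cast
  linear_combination (expPhase h k z a * z.im * k a ^ 2 * w a) * I_sq

end ExpIntegral
end MockMaass

namespace MockMaass
open Complex Real MeasureTheory

/-! ### Series of Bessel functions -/

theorem cosh_mul_exp_neg_le {c : ℝ} (hc : 0 < c) {t : ℝ} :
    Real.cosh t * Real.exp (-(Real.cosh t * c)) ≤ 2 / c * Real.exp (-(c / 4) * t) := by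
  refine (mul_exp_neg_mul_le _ hc).trans ?_
  gcongr
  nlinarith [le_cosh t]

theorem isExpWeight_one_cosh {a : ℝ} (ha : 0 < a) :
    IsExpWeight (volume.restrict (Set.Ioi (0 : ℝ))) (fun t => a * Real.cosh t) fun _ => 1 := by
  refine ⟨aestronglyMeasurable_const, fun y hy => ?_⟩
  refine (integrableOn_exp_neg_mul_cosh (mul_pos ha hy)).congr
    (Filter.Eventually.of_forall fun t => ?_)
  simp only [norm_one, mul_one]
  congr 1
  ring

/-- The differential equation of `K₀`, in integrated form. -/
theorem integral_bessel_kernel {a y : ℝ} (ha : 0 < a) (hy : 0 < y) :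
    ∫ t in Set.Ioi (0 : ℝ), (y * (a * Real.sinh t) ^ 2 - a * Real.cosh t) *
      Real.exp (-(a * Real.cosh t * y)) = 0 := by
  have hm : Measurable fun t => a * Real.cosh t := Real.measurable_cosh.const_mul a
  have hkh : ∀ t : ℝ, |a * Real.sinh t| ≤ a * Real.cosh t := fun t => by
    rw [abs_mul, abs_of_pos ha]
    refine mul_le_mul_of_nonneg_left (abs_le_of_sq_le_sq ?_ (Real.cosh_pos t).le) ha.le
    nlinarith [Real.cosh_sq t]
  have hw := isExpWeight_one_cosh ha
  have h1 := (hw.mul_h hm hkh).integrable y hy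
  have h2 := ((hw.mul_k (Real.measurable_sinh.const_mul a) hkh).mul_k
    (Real.measurable_sinh.const_mul a) hkh).integrable y hy
  have hint : IntegrableOn (fun t => (y * (a * Real.sinh t) ^ 2 - a * Real.cosh t) *
      Real.exp (-(a * Real.cosh t * y))) (Set.Ioi 0) := by
    refine ((h2.const_mul y).sub h1).congr (Filter.Eventually.of_forall fun t => ?_)
    have e1 : ‖((a * Real.cosh t : ℝ) : ℂ)‖ = a * Real.cosh t := by
      rw [norm_real, Real.norm_of_nonneg (mul_pos ha (Real.cosh_pos t)).le]
    have e2 : ‖((a * Real.sinh t : ℝ) : ℂ)‖ ^ 2 = (a * Real.sinh t) ^ 2 := by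
      rw [norm_real, Real.norm_eq_abs, sq_abs]
    simp only [norm_mul, norm_I, norm_one, norm_neg, Pi.sub_apply]
    rw [e1]
    linear_combination (y * Real.exp (-(a * Real.cosh t * y))) * e2
  -- The integrand is an exact derivative, of a function that vanishes at `0` and at infinity.
  have hd : ∀ t ∈ Set.Ici (0 : ℝ), HasDerivAt
      (fun t => -(a * Real.sinh t) * Real.exp (-(a * Real.cosh t * y)))
      ((y * (a * Real.sinh t) ^ 2 - a * Real.cosh t) * Real.exp (-(a * Real.cosh t * y))) t :=
    fun t _ => by
    refine ((((Real.hasDerivAt_sinh t).const_mul a).neg).mul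
      ((((Real.hasDerivAt_cosh t).const_mul a).mul_const y).neg.exp)).congr_deriv ?_
    simp only [Pi.neg_apply]
    ring
  have hlim : Filter.Tendsto (fun t => -(a * Real.sinh t) * Real.exp (-(a * Real.cosh t * y)))
      Filter.atTop (nhds 0) := by
    have hb : Filter.Tendsto (fun t => a * (2 / (a * y) * Real.exp (-(a * y / 4) * t)))
        Filter.atTop (nhds 0) := by
      have h0 : Filter.Tendsto (fun t : ℝ => a * y / 4 * t) Filter.atTop Filter.atTop :=
        Filter.tendsto_id.const_mul_atTop (by positivity)
      have := ((Real.tendsto_exp_neg_atTop_nhds_zero.comp h0).const_mul (2 / (a * y))).const_mul a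
      simpa [Function.comp_def] using this
    refine squeeze_zero_norm (fun t => ?_) hb
    rw [norm_mul, norm_neg, Real.norm_eq_abs, Real.norm_of_nonneg (Real.exp_pos _).le]
    have h3 := mul_le_mul_of_nonneg_left (cosh_mul_exp_neg_le (mul_pos ha hy) (t := t)) ha.le
    have h4 := mul_le_mul_of_nonneg_right (hkh t) (Real.exp_pos (-(a * Real.cosh t * y))).le
    refine h4.trans (le_trans (le_of_eq ?_) h3)
    rw [show a * Real.cosh t * y = Real.cosh t * (a * y) by ring]
    ring
  rw [integral_Ioi_of_hasDerivAt_of_tendsto' hd hint hlim]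
  simp

section BesselSeries

variable {ι : Type*} [Countable ι] [MeasurableSpace ι] [DiscreteMeasurableSpace ι] {a b c : ι → ℝ}

/-- The series and the integral for `K₀` are merged into one integral over counting measure times
Lebesgue measure, so differentiation under the integral also covers termwise differentiation. By
Tonelli, integrability is the convergence of `∑ |c_p| K₀(a_p y)`. -/
theorem isExpWeight_bessel (ha : ∀ p, 0 < a p)
    (hs : ∀ y > 0, Summable fun p => |c p| * besselK0 (a p * y)) :
    IsExpWeight (Measure.count.prod (volume.restrict (Set.Ioi (0 : ℝ))))
      (fun q : ι × ℝ => a q.1 * Real.cosh q.2) fun q => (c q.1 : ℂ) := by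
  have hma : Measurable a := Measurable.of_discrete
  have hmc : Measurable c := Measurable.of_discrete
  have hcosh := Real.measurable_cosh
  refine ⟨(by fun_prop : Measurable fun q : ι × ℝ => (c q.1 : ℂ)).aestronglyMeasurable,
    fun y hy => ?_⟩
  have hm : Measurable fun q : ι × ℝ =>
      Real.exp (-(a q.1 * Real.cosh q.2 * y)) * ‖(c q.1 : ℂ)‖ := by fun_prop
  have hK : ∀ p, ∫ t in Set.Ioi (0 : ℝ), Real.exp (-(a p * Real.cosh t * y)) =
      besselK0 (a p * y) := fun p => by
    rw [besselK0]
    congr 1 with t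
    congr 1
    ring
  rw [integrable_prod_iff hm.aestronglyMeasurable]
  constructor
  · refine Filter.Eventually.of_forall fun p => ?_
    have := (isExpWeight_one_cosh (ha p)).integrable y hy
    simp only [norm_one, mul_one] at this
    exact this.mul_const ‖(c p : ℂ)‖
  · rw [integrable_count_iff]
    refine (hs y hy).congr fun p => ?_
    have : ∀ t : ℝ, ‖Real.exp (-(a p * Real.cosh t * y)) * ‖(c p : ℂ)‖‖ =
        Real.exp (-(a p * Real.cosh t * y)) * |c p| := fun t => by
      rw [norm_mul, norm_norm, norm_real, Real.norm_of_nonneg (Real.exp_pos _).le, Real.norm_eq_abs]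
    simp only [this]
    rw [integral_mul_const, hK, norm_mul, Real.norm_of_nonneg (besselK0_nonneg _),
      norm_abs_eq_norm, Real.norm_eq_abs, mul_comm]

/-- `∑ c_p K₀(a_p Im z) exp(i b_p Re z)`. -/
noncomputable def besselSeries (a b c : ι → ℝ) (z : ℂ) : ℂ :=
  ∑' p, (c p : ℂ) * (besselK0 (a p * z.im) : ℂ) * cexp (I * (b p * z.re : ℝ))

theorem expIntegral_bessel (ha : ∀ p, 0 < a p)
    (hs : ∀ y > 0, Summable fun p => |c p| * besselK0 (a p * y)) {z : ℂ} (hz : 0 < z.im) :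
    expIntegral (Measure.count.prod (volume.restrict (Set.Ioi (0 : ℝ))))
      (fun q : ι × ℝ => a q.1 * Real.cosh q.2) (fun q => b q.1) (fun q => (c q.1 : ℂ)) z =
      besselSeries a b c z := by
  have hma : Measurable a := Measurable.of_discrete
  have hmb : Measurable b := Measurable.of_discrete
  have hcosh := Real.measurable_cosh
  have hint := (isExpWeight_bessel ha hs).integrable_expPhase_mul
    (k := fun q : ι × ℝ => b q.1) (by fun_prop) (by fun_prop) hz
  rw [expIntegral, integral_prod _ hint, integral_countable hint.integral_prod_left, besselSeries]
  refine tsum_congr fun p => ?_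
  rw [Measure.real, Measure.count_singleton, ENNReal.toReal_one, one_smul]
  have h1 : ∀ t : ℝ, expPhase (fun q : ι × ℝ => a q.1 * Real.cosh q.2) (fun q => b q.1) z (p, t) =
      ((Real.exp (-(a p * z.im) * Real.cosh t) : ℝ) : ℂ) * cexp (I * (b p * z.re : ℝ)) := fun t => by
    rw [expPhase, Complex.exp_add, ofReal_exp]
    congr 2
    push_cast
    ring
  simp only [h1]
  rw [integral_mul_const, integral_mul_const, integral_complex_ofReal, besselK0]
  ring

theorem contDiffOn_besselSeries (ha : ∀ p, 0 < a p) (hab : ∀ p, |b p| = a p)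
    (hs : ∀ y > 0, Summable fun p => |c p| * besselK0 (a p * y)) :
    ContDiffOn ℝ ∞ (fun z : ℂ => (√z.im : ℂ) * besselSeries a b c z) {z : ℂ | 0 < z.im} := by
  have hma : Measurable a := Measurable.of_discrete
  have hmb : Measurable b := Measurable.of_discrete
  have hcosh := Real.measurable_cosh
  have hF := contDiffOn_expIntegral (h := fun q : ι × ℝ => a q.1 * Real.cosh q.2)
    (k := fun q : ι × ℝ => b q.1) (by fun_prop) (by fun_prop) (fun q => by
      rw [hab]; exact le_mul_of_one_le_right (ha _).le (Real.one_le_cosh _))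
    (isExpWeight_bessel ha hs)
  have hsq : ContDiffOn ℝ ∞ (fun z : ℂ => ((√z.im : ℝ) : ℂ)) {z : ℂ | 0 < z.im} :=
    ofRealCLM.contDiff.comp_contDiffOn
      (ContDiffOn.sqrt imCLM.contDiff.contDiffOn fun z hz => ne_of_gt hz)
  exact (hsq.mul hF).congr fun z hz => by rw [expIntegral_bessel ha hs hz]

/-- As `|b_p| = a_p`, one has `h² - k² = (a_p sinh t)²`, and for each `p` the remainder integral
vanishes by `integral_bessel_kernel`. -/
theorem laplacian_besselSeries (ha : ∀ p, 0 < a p) (hab : ∀ p, |b p| = a p)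
    (hs : ∀ y > 0, Summable fun p => |c p| * besselK0 (a p * y)) {z : ℂ} (hz : 0 < z.im) :
    -((z.im : ℂ) ^ 2) * Laplacian.laplacian (fun z => (√z.im : ℂ) * besselSeries a b c z) z =
      1 / 4 * ((√z.im : ℂ) * besselSeries a b c z) := by
  have hma : Measurable a := Measurable.of_discrete
  have hmb : Measurable b := Measurable.of_discrete
  have hcosh := Real.measurable_cosh
  have hU : IsOpen {z : ℂ | 0 < z.im} := isOpen_lt continuous_const continuous_im
  set h : ι × ℝ → ℝ := fun q => a q.1 * Real.cosh q.2 with hh_def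
  set k : ι × ℝ → ℝ := fun q => b q.1 with hk_def
  set w : ι × ℝ → ℂ := fun q => (c q.1 : ℂ) with hw_def
  have hh : Measurable h := by fun_prop
  have hk : Measurable k := by fun_prop
  have hkh : ∀ q, |k q| ≤ h q := fun q => by
    simp only [hh_def, hk_def]
    rw [hab]; exact le_mul_of_one_le_right (ha _).le (Real.one_le_cosh _)
  have hw : IsExpWeight (Measure.count.prod (volume.restrict (Set.Ioi (0 : ℝ)))) h w :=
    isExpWeight_bessel ha hs
  have hev : (fun z : ℂ => (√z.im : ℂ) * besselSeries a b c z) =ᶠ[nhds z] fun z =>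
      (√z.im : ℂ) * expIntegral (Measure.count.prod (volume.restrict (Set.Ioi (0 : ℝ)))) h k w z := by
    filter_upwards [hU.mem_nhds hz] with z' hz'
    rw [expIntegral_bessel ha hs hz']
  rw [(InnerProductSpace.laplacian_congr_nhds hev).eq_of_nhds, ← expIntegral_bessel ha hs hz]
  refine laplacian_sqrt_mul_expIntegral hh hk hkh hw hz ?_
  have hw1 := hw.mul_h hh hkh
  have hw2 := hw.mul_k hk hkh
  have i1 := hw1.integrable_expPhase_mul hh hk hz
  have i11 := (hw1.mul_h hh hkh).integrable_expPhase_mul hh hk hz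
  have i22 := (hw2.mul_k hk hkh).integrable_expPhase_mul hh hk hz
  have hint : Integrable (fun q => expPhase h k z q *
      ((z.im * (h q ^ 2 - k q ^ 2) - h q : ℝ) * w q))
      (Measure.count.prod (volume.restrict (Set.Ioi (0 : ℝ)))) := by
    refine (((i22.add i11).const_mul (z.im : ℂ)).add i1).congr
      (Filter.Eventually.of_forall fun q => ?_)
    simp only [Pi.add_apply]
    push_cast
    linear_combination (expPhase h k z q * z.im * k q ^ 2 * w q) * I_sq
  rw [integral_prod _ hint]
  refine integral_eq_zero_of_ae (Filter.Eventually.of_forall fun p => ?_)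
  have h1 : ∀ t : ℝ, expPhase h k z (p, t) *
      ((z.im * (h (p, t) ^ 2 - k (p, t) ^ 2) - h (p, t) : ℝ) * w (p, t)) =
      (((z.im * (a p * Real.sinh t) ^ 2 - a p * Real.cosh t) *
        Real.exp (-(a p * Real.cosh t * z.im)) : ℝ) : ℂ) *
        (cexp (I * (b p * z.re : ℝ)) * c p) := fun t => by
    have h2 : h (p, t) ^ 2 - k (p, t) ^ 2 = (a p * Real.sinh t) ^ 2 := by
      simp only [hh_def, hk_def]
      rw [← sq_abs (b p), hab, mul_pow, mul_pow, Real.cosh_sq]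
      ring
    rw [h2, expPhase, Complex.exp_add]
    simp only [hh_def, hk_def, hw_def]
    push_cast
    ring
  simp only [h1, Pi.zero_apply]
  rw [integral_mul_const]
  refine mul_eq_zero_of_left (integral_complex_ofReal.trans ?_) _
  rw [integral_bessel_kernel (ha p) hz, ofReal_zero]

end BesselSeries

/-! ### Smoothness of `H_j` and the eigenvalue equation -/

/-- `n_p ∈ ℤ² + μ`, with `μ = μ_j` or `μ = μ_j + λ`. -/
noncomputable def cosetPoint (j : Fin 4) (s : Bool) (p : ℤ × ℤ) : Fin 2 → ℝ :=
  shiftedLatticeEquiv (cosetRep j s) p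

/-- Half the sign factor of the summand of `Θ` at `n`. -/
noncomputable def signWeight (n : Fin 2 → ℝ) : ℝ :=
  1 / 2 * (1 - Real.sign (2 * param P6 c1 - hypAngle n) * Real.sign (2 * param P6 c2 - hypAngle n))

/-- The series of Bessel functions over one coset, without the factor `√(Im z)`. -/
noncomputable def cosetSeries (j : Fin 4) (s : Bool) : ℂ → ℂ :=
  besselSeries (fun p => 2 * π * |quad A6 (cosetPoint j s p)|)
    (fun p => 2 * π * quad A6 (cosetPoint j s p)) (fun p => signWeight (cosetPoint j s p))

theorem quad_cosetPoint_ne_zero (j : Fin 4) (s : Bool) (p : ℤ × ℤ) :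
    quad A6 (cosetPoint j s p) ≠ 0 :=
  quad_ne_zero_of_mem_coset (shiftedLatticeEquiv (cosetRep j s) p).2

theorem half_mul_thetaTerms (j : Fin 4) (s : Bool) (p : ℤ × ℤ) (τ : UpperHalfPlane) :
    (1 / 2) * (thetaPosTerm A6 c1 c2 τ (cosetPoint j s p) +
      thetaNegTerm A6 P6 c1 c2 τ (cosetPoint j s p)) =
    (signWeight (cosetPoint j s p) : ℂ) *
      (besselK0 (2 * π * |quad A6 (cosetPoint j s p)| * τ.im) : ℂ) *
      cexp (I * (2 * π * quad A6 (cosetPoint j s p) * (τ : ℂ).re : ℝ)) := by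
  rw [(thetaPosTerm_add_thetaNegTerm (quad_cosetPoint_ne_zero j s p) τ).2.2, e, signWeight]
  rw [UpperHalfPlane.coe_re]
  push_cast
  rw [show (2 * π * I * (quad A6 (cosetPoint j s p) * τ.re) : ℂ) =
    I * (2 * π * quad A6 (cosetPoint j s p) * τ.re) by ring]
  ring

theorem H_eq_cosetSeries (j : Fin 4) (τ : UpperHalfPlane) :
    H j τ = √(τ : ℂ).im * cosetSeries j true τ + √(τ : ℂ).im * cosetSeries j false τ := by
  have h : ∀ s, ∑' n : shiftedLattice (cosetRep j s),
      (1 / 2) * (thetaPosTerm A6 c1 c2 τ n + thetaNegTerm A6 P6 c1 c2 τ n) =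
      cosetSeries j s τ := fun s => by
    rw [← (shiftedLatticeEquiv (cosetRep j s)).tsum_eq, cosetSeries, besselSeries]
    exact tsum_congr fun p => half_mul_thetaTerms j s p τ
  rw [H_eq_sum_tsum, Fintype.sum_bool, h, h, mul_add]
  rfl

/-- Absolute convergence of the theta series at `τ = iy`, where the phases have modulus 1. -/
theorem summable_signWeight (j : Fin 4) (s : Bool) {y : ℝ} (hy : 0 < y) :
    Summable fun p => |signWeight (cosetPoint j s p)| *
      besselK0 (2 * π * |quad A6 (cosetPoint j s p)| * y) := by
  set τ : UpperHalfPlane := ⟨I * y, by simpa using hy⟩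
  have him : τ.im = y := by
    change (I * (y : ℂ)).im = y
    simp
  obtain ⟨hp, hn⟩ := summable_thetaTerms j s τ
  have h := ((shiftedLatticeEquiv (cosetRep j s)).summable_iff.2
    ((hp.add hn).mul_left (1 / 2))).norm
  refine h.congr fun p => ?_
  have h1 := half_mul_thetaTerms j s p τ
  rw [Function.comp_apply]
  refine (congrArg norm h1).trans ?_
  rw [norm_mul, norm_mul, norm_real, norm_real, Real.norm_of_nonneg (besselK0_nonneg _), him,
    Real.norm_eq_abs, mul_comm I, norm_exp_ofReal_mul_I, mul_one]

theorem contDiffOn_cosetSeries (j : Fin 4) (s : Bool) :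
    ContDiffOn ℝ ∞ (fun z : ℂ => (√z.im : ℂ) * cosetSeries j s z) {z : ℂ | 0 < z.im} :=
  contDiffOn_besselSeries
    (fun p => mul_pos two_pi_pos (abs_pos.2 (quad_cosetPoint_ne_zero j s p)))
    (fun p => by rw [abs_mul, abs_of_pos two_pi_pos]) fun _ hy => summable_signWeight j s hy

theorem laplacian_cosetSeries (j : Fin 4) (s : Bool) {z : ℂ} (hz : 0 < z.im) :
    -((z.im : ℂ) ^ 2) * Laplacian.laplacian (fun z => (√z.im : ℂ) * cosetSeries j s z) z =
      1 / 4 * ((√z.im : ℂ) * cosetSeries j s z) :=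
  laplacian_besselSeries
    (fun p => mul_pos two_pi_pos (abs_pos.2 (quad_cosetPoint_ne_zero j s p)))
    (fun p => by rw [abs_mul, abs_of_pos two_pi_pos]) (fun _ hy => summable_signWeight j s hy) hz

theorem H_comp_ofComplex (j : Fin 4) {z : ℂ} (hz : 0 < z.im) :
    (H j ∘ UpperHalfPlane.ofComplex) z =
      √z.im * cosetSeries j true z + √z.im * cosetSeries j false z := by
  rw [Function.comp_apply, H_eq_cosetSeries, UpperHalfPlane.ofComplex_apply_of_im_pos hz]

theorem contDiffOn_H (j : Fin 4) :
    ContDiffOn ℝ ∞ (H j ∘ UpperHalfPlane.ofComplex) {z : ℂ | 0 < z.im} :=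
  ((contDiffOn_cosetSeries j true).add (contDiffOn_cosetSeries j false)).congr
    fun _ hz => H_comp_ofComplex j hz

theorem hypLaplacian_H (j : Fin 4) (τ : UpperHalfPlane) : hypLaplacian (H j) τ = 1 / 4 * H j τ := by
  have hU : IsOpen {z : ℂ | 0 < z.im} := isOpen_lt continuous_const continuous_im
  have hτ : 0 < (τ : ℂ).im := τ.im_pos
  have hev : (H j ∘ UpperHalfPlane.ofComplex) =ᶠ[nhds (τ : ℂ)]
      (fun z : ℂ => (√z.im : ℂ) * cosetSeries j true z) +
        fun z : ℂ => (√z.im : ℂ) * cosetSeries j false z := by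
    filter_upwards [hU.mem_nhds hτ] with z hz
    exact H_comp_ofComplex j hz
  have hc : ∀ s, ContDiffAt ℝ 2 (fun z : ℂ => (√z.im : ℂ) * cosetSeries j s z) τ := fun s =>
    ((contDiffOn_cosetSeries j s).contDiffAt (hU.mem_nhds hτ)).of_le (by norm_cast)
  rw [hypLaplacian, (InnerProductSpace.laplacian_congr_nhds hev).eq_of_nhds,
    (hc true).laplacian_add (hc false), mul_add, H_eq_cosetSeries, mul_add,
    ← laplacian_cosetSeries j true hτ, ← laplacian_cosetSeries j false hτ]
  rfl
end MockMaass

namespace MockMaass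
open Complex Real

/-! ### Linear independence of the components -/

/-- At `τ = i` both `τ` and `-τ̄` equal `i`, so the Gaussian is real and positive. Hence `Ĥ_j(i) >
0`. -/
theorem gauss_I (t a b : ℝ) : gauss t I a b = (‖gauss t I a b‖ : ℂ) := by
  rw [norm_gauss, gauss, ofReal_exp]
  congr 1
  simp only [conj_I, I_im]
  push_cast
  linear_combination (2 * π * ((√6 * a * Complex.cosh t - 2 * b * Complex.sinh t) ^ 2
    + (2 * b * Complex.cosh t - √6 * a * Complex.sinh t) ^ 2)) * I_sq

theorem gint_I_pos {T : ℝ} (hT : 0 < T) (a b : ℝ) :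
    0 < (gint T I a b).re ∧ gint T I a b = ((gint T I a b).re : ℂ) := by
  have h : gint T I a b = ((∫ t in (-T)..T, ‖gauss t I a b‖ : ℝ) : ℂ) := by
    rw [gint, ← intervalIntegral.integral_ofReal]
    exact intervalIntegral.integral_congr fun t _ => gauss_I t a b
  refine ⟨?_, by rw [h, ofReal_re]⟩
  rw [h, ofReal_re]
  refine intervalIntegral.intervalIntegral_pos_of_pos ?_ (fun t => ?_) (by linarith)
  · apply Continuous.intervalIntegrable
    have h1 := Real.continuous_cosh
    have h2 := Real.continuous_sinh
    simp only [norm_gauss]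
    fun_prop
  · rw [norm_gauss]; exact Real.exp_pos _

theorem thetaHat_I_re_pos (μ : Fin 2 → ℝ) :
    0 < (thetaHat A6 P6 c1 c2 μ UpperHalfPlane.I).re := by
  have hI : 0 < I.im := by simp
  have hs := (tsum_mul_gint param_c2_pos.le hI (w := fun _ => 1) (fun _ => by simp)
    (fun c hc => summable_exp_shift hc (μ 0) (μ 1))).1
  simp only [one_mul] at hs
  rw [thetaHat_eq_tsum, UpperHalfPlane.I_im, Real.sqrt_one, ofReal_one, one_mul,
    UpperHalfPlane.coe_I, Complex.re_tsum hs]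
  exact (hasSum_re hs.hasSum).summable.tsum_pos
    (fun p => (gint_I_pos param_c2_pos _ _).1.le) 0 (gint_I_pos param_c2_pos _ _).1

theorem Hhat_I_ne_zero (j : Fin 4) : Hhat j UpperHalfPlane.I ≠ 0 := fun h => by
  have h1 := congrArg re h
  rw [Hhat, add_re, zero_re] at h1
  linarith [thetaHat_I_re_pos (muVec j), thetaHat_I_re_pos (muVec j + lamVec)]

theorem OmegaT_diag_injective : Function.Injective fun j => OmegaT j j := by
  have hz : IsPrimitiveRoot (zeta 48) 48 := Complex.isPrimitiveRoot_exp 48 (by norm_num)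
  have h : ∀ j, OmegaT j j = zeta 48 ^ (![45, 5, 29, 21] j : ℕ) := fun j => by
    rw [OmegaT, Matrix.diagonal_apply_eq, zeta_sixteen, ← pow_mul, ← pow_mul]
    fin_cases j <;> rfl
  intro i j hij
  simp only [h] at hij
  have := hz.pow_inj (by fin_cases i <;> simp) (by fin_cases j <;> simp) hij
  revert this
  clear hij
  revert i j
  decide

theorem Hhat_T_pow_smul (j : Fin 4) (n : ℕ) (τ : UpperHalfPlane) :
    Hhat j (ModularGroup.T ^ n • τ) = OmegaT j j ^ n * Hhat j τ := by
  induction n with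
  | zero => simp
  | succ n ih => rw [pow_succ', mul_smul, Hhat_T_smul, ih]; ring

/-- Evaluated at `i + n` for natural `n`, the relation becomes a Vandermonde system with the
distinct nodes `Ω_T(j, j)` and unknowns `v_j Ĥ_j(i)`. -/
theorem eq_zero_of_sum_mul_Hhat_eq_zero {v : Fin 4 → ℂ}
    (hv : ∀ τ, ∑ j, v j * Hhat j τ = 0) : v = 0 := by
  have h := Matrix.eq_zero_of_forall_pow_sum_mul_pow_eq_zero (f := fun j => OmegaT j j)
    (v := fun j => v j * Hhat j UpperHalfPlane.I) OmegaT_diag_injective fun n => by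
      rw [← hv (ModularGroup.T ^ (n : ℕ) • UpperHalfPlane.I)]
      refine Finset.sum_congr rfl fun j _ => ?_
      rw [Hhat_T_pow_smul]
      ring
  funext j
  exact (mul_eq_zero.1 (congrFun h j)).resolve_right (Hhat_I_ne_zero j)

/-! ### Generation of `Γ₀(2)` -/

/-- A set of matrices that is stable under left division by `T^{±1}` and `R^{±1}` and contains all
upper triangular matrices contains `Γ₀(2)`. -/
theorem gamma0_two_induction {P : SL(2, ℤ) → Prop} (h0 : ∀ g : SL(2, ℤ), g 1 0 = 0 → P g)
    (hT : ∀ g, P (ModularGroup.T * g) → P g) (hT' : ∀ g, P (ModularGroup.T⁻¹ * g) → P g)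
    (hR : ∀ g, P (matR * g) → P g) (hR' : ∀ g, P (matR⁻¹ * g) → P g)
    (g : SL(2, ℤ)) (hg : Even (g 1 0)) : P g := by
  have hTa : ∀ g : SL(2, ℤ), (ModularGroup.T * g) 0 0 = g 0 0 + g 1 0 ∧
      (ModularGroup.T * g) 1 0 = g 1 0 := fun g => by
    rw [Matrix.SpecialLinearGroup.coe_mul, ModularGroup.coe_T]
    simp [Matrix.mul_apply, Fin.sum_univ_two]
  have hTi : ∀ g : SL(2, ℤ), (ModularGroup.T⁻¹ * g) 0 0 = g 0 0 - g 1 0 ∧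
      (ModularGroup.T⁻¹ * g) 1 0 = g 1 0 := fun g => by
    rw [Matrix.SpecialLinearGroup.coe_mul, ModularGroup.coe_T_inv]
    simp [Matrix.mul_apply, Fin.sum_univ_two]
    ring
  have hRa : ∀ g : SL(2, ℤ), (matR * g) 0 0 = g 0 0 ∧
      (matR * g) 1 0 = g 1 0 + 2 * g 0 0 := fun g => by
    rw [Matrix.SpecialLinearGroup.coe_mul, matR]
    simp [Matrix.mul_apply, Fin.sum_univ_two]
    ring
  have hRi : ∀ g : SL(2, ℤ), (matR⁻¹ * g) 0 0 = g 0 0 ∧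
      (matR⁻¹ * g) 1 0 = g 1 0 - 2 * g 0 0 := fun g => by
    rw [Matrix.SpecialLinearGroup.coe_mul, Matrix.SpecialLinearGroup.coe_inv, matR]
    simp [Matrix.mul_apply, Fin.sum_univ_two, Matrix.adjugate_fin_two]
    ring
  induction hn : (g 0 0).natAbs + (g 1 0).natAbs using Nat.strong_induction_on generalizing g with
  | _ n ih =>
    by_cases hc : g 1 0 = 0
    · exact h0 g hc
    have hdet : g 0 0 * g 1 1 - g 0 1 * g 1 0 = 1 := by
      rw [← Matrix.det_fin_two]; exact g.det_coe
    have hodd : Odd (g 0 0) := by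
      have : Odd (g 0 0 * g 1 1) := by
        rw [show g 0 0 * g 1 1 = g 0 1 * g 1 0 + 1 by linarith]
        exact (hg.mul_left _).add_one
      exact (Int.odd_mul.1 this).1
    obtain ⟨x, hx⟩ := hg
    obtain ⟨y, hy⟩ := hodd
    obtain ⟨t1, t2⟩ := hTa g
    obtain ⟨u1, u2⟩ := hTi g
    obtain ⟨v1, v2⟩ := hRa g
    obtain ⟨w1, w2⟩ := hRi g
    generalize g 0 0 = a at *
    generalize g 1 0 = c at *
    -- Euclidean descent on `|a| + |c|`, with `a` odd and `c` even and nonzero. If `|a| < |c|`, one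
    -- of `c ± 2a` is smaller than `c`; otherwise one of `a ± c` is smaller than `a`. The sign of
    -- `ac` decides which.
    rcases lt_or_ge a.natAbs c.natAbs with hlt | hle
    · rcases le_or_gt 0 (a * c) with h | h
      · refine hR' g (ih _ ?_ _ ?_ rfl)
        · rw [w1, w2, ← hn]
          rcases le_or_gt 0 a with ha | ha
          · have : 0 ≤ c := nonneg_of_mul_nonneg_right h (by omega)
            omega
          · have : c ≤ 0 := nonpos_of_mul_nonneg_right h ha
            omega
        · rw [w2]; exact ⟨x - a, by omega⟩
      · refine hR g (ih _ ?_ _ ?_ rfl)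
        · rw [v1, v2, ← hn]
          rcases mul_neg_iff.1 h with ⟨ha, hc⟩ | ⟨ha, hc⟩ <;> omega
        · rw [v2]; exact ⟨x + a, by omega⟩
    · rcases le_or_gt 0 (a * c) with h | h
      · refine hT' g (ih _ ?_ _ ?_ rfl)
        · rw [u1, u2, ← hn]
          rcases le_or_gt 0 a with ha | ha
          · have : 0 ≤ c := nonneg_of_mul_nonneg_right h (by omega)
            omega
          · have : c ≤ 0 := nonpos_of_mul_nonneg_right h ha
            omega
        · rw [u2]; exact ⟨x, hx⟩
      · refine hT g (ih _ ?_ _ ?_ rfl)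
        · rw [t1, t2, ← hn]
          rcases mul_neg_iff.1 h with ⟨ha, hc⟩ | ⟨ha, hc⟩ <;> omega
        · rw [t2]; exact ⟨x, hx⟩

/-! ### The representation -/

/-- The column vector of the completed functions. -/
noncomputable def HhatVec (τ : UpperHalfPlane) : Fin 4 → ℂ := fun j => Hhat j τ

theorem eq_of_mulVec_HhatVec {A B : Matrix (Fin 4) (Fin 4) ℂ}
    (h : ∀ τ, A.mulVec (HhatVec τ) = B.mulVec (HhatVec τ)) : A = B := by
  rw [← sub_eq_zero]
  ext i
  refine congrFun (eq_zero_of_sum_mul_Hhat_eq_zero (v := (A - B) i) fun τ => ?_) _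
  have h1 := congrFun (h τ) i
  rw [← sub_eq_zero] at h1
  rw [← h1]
  simp only [Matrix.mulVec, dotProduct, Matrix.sub_apply, sub_mul, Finset.sum_sub_distrib]
  rfl

/-- `A` describes the action of `g` on the completed functions. -/
def TransformsBy (g : SL(2, ℤ)) (A : Matrix (Fin 4) (Fin 4) ℂ) : Prop :=
  ∀ τ, HhatVec (g • τ) = A.mulVec (HhatVec τ)

theorem TransformsBy.mul {g h : SL(2, ℤ)} {A B : Matrix (Fin 4) (Fin 4) ℂ}
    (hg : TransformsBy g A) (hh : TransformsBy h B) : TransformsBy (g * h) (A * B) := fun τ => by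
  rw [mul_smul, hg, hh, Matrix.mulVec_mulVec]

theorem TransformsBy.unique {g : SL(2, ℤ)} {A B : Matrix (Fin 4) (Fin 4) ℂ}
    (hA : TransformsBy g A) (hB : TransformsBy g B) : A = B :=
  eq_of_mulVec_HhatVec fun τ => (hA τ).symm.trans (hB τ)

/-- A row vector annihilated by `A` gives a linear relation at all points `g • τ'`, hence on the
whole half-plane. -/
theorem TransformsBy.isUnit {g : SL(2, ℤ)} {A : Matrix (Fin 4) (Fin 4) ℂ}
    (hA : TransformsBy g A) : IsUnit A := by
  rw [← Matrix.vecMul_injective_iff_isUnit]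
  intro v w hvw
  rw [← sub_eq_zero]
  refine eq_zero_of_sum_mul_Hhat_eq_zero fun τ => ?_
  have h1 : dotProduct (v - w) (HhatVec (g • g⁻¹ • τ)) = 0 := by
    rw [hA, Matrix.dotProduct_mulVec, Matrix.sub_vecMul]
    simp only at hvw
    rw [hvw, sub_self, zero_dotProduct]
  rwa [smul_inv_smul] at h1

theorem TransformsBy.inv {g : SL(2, ℤ)} {A : Matrix (Fin 4) (Fin 4) ℂ}
    (hA : TransformsBy g A) : TransformsBy g⁻¹ A⁻¹ := fun τ => by
  have h := hA (g⁻¹ • τ)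
  rw [smul_inv_smul] at h
  rw [h, Matrix.mulVec_mulVec, Matrix.nonsing_inv_mul _
    ((Matrix.isUnit_iff_isUnit_det _).1 hA.isUnit),
    Matrix.one_mulVec]

theorem transformsBy_one : TransformsBy 1 1 := fun τ => by rw [one_smul, Matrix.one_mulVec]

theorem transformsBy_T : TransformsBy ModularGroup.T OmegaT := fun τ => by
  funext j
  rw [HhatVec, Hhat_T_smul, OmegaT, Matrix.mulVec_diagonal, Matrix.diagonal_apply_eq]
  rfl

theorem transformsBy_matR : TransformsBy matR OmegaR := fun τ => funext fun j => Hhat_R_smul j τ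

theorem exists_transformsBy_T_zpow (n : ℤ) : ∃ d : Fin 4 → ℂ,
    TransformsBy (ModularGroup.T ^ n) (Matrix.diagonal d) := by
  have hinv := transformsBy_T.inv
  rw [OmegaT, Matrix.inv_diagonal] at hinv
  induction n with
  | zero =>
    refine ⟨1, ?_⟩
    rw [zpow_zero, show Matrix.diagonal (1 : Fin 4 → ℂ) = 1 from Matrix.diagonal_one]
    exact transformsBy_one
  | succ n ih =>
    obtain ⟨d, hd⟩ := ih
    rw [zpow_add_one]
    have h := hd.mul transformsBy_T
    rw [OmegaT, Matrix.diagonal_mul_diagonal] at h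
    exact ⟨_, h⟩
  | pred n ih =>
    obtain ⟨d, hd⟩ := ih
    rw [zpow_sub_one]
    have h := hd.mul hinv
    rw [Matrix.diagonal_mul_diagonal] at h
    exact ⟨_, h⟩

/-- Such a `g` acts on the half-plane as a power of `T`; the sign `±1` is invisible to the action.
-/
theorem exists_transformsBy_of_c_eq_zero {g : SL(2, ℤ)} (hg : g 1 0 = 0) : ∃ d : Fin 4 → ℂ,
    TransformsBy g (Matrix.diagonal d) := by
  obtain ⟨n, hn⟩ := ModularGroup.exists_eq_T_zpow_of_c_eq_zero hg
  obtain ⟨d, hd⟩ := exists_transformsBy_T_zpow n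
  exact ⟨d, fun τ => by rw [hn, hd]⟩

theorem exists_transformsBy {g : SL(2, ℤ)} (hg : Even (g 1 0)) : ∃ A, TransformsBy g A := by
  have key : ∀ (h : SL(2, ℤ)) (B), TransformsBy h B → ∀ g, (∃ A, TransformsBy (h * g) A) →
      ∃ A, TransformsBy g A := fun h B hB g ⟨A, hA⟩ =>
    ⟨B⁻¹ * A, by simpa using hB.inv.mul hA⟩
  exact gamma0_two_induction (P := fun g => ∃ A, TransformsBy g A)
    (fun g hg => let ⟨_, hd⟩ := exists_transformsBy_of_c_eq_zero hg; ⟨_, hd⟩)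
    (key _ _ transformsBy_T) (key _ _ transformsBy_T.inv) (key _ _ transformsBy_matR)
    (key _ _ transformsBy_matR.inv) g hg

theorem even_of_mem_gamma0 (M : CongruenceSubgroup.Gamma0 2) : Even ((M : SL(2, ℤ)) 1 0) := by
  have h := CongruenceSubgroup.Gamma0_mem.1 M.2
  exact (ZMod.intCast_eq_zero_iff_even).1 h

/-- The multiplier system of `(H_0, H_1, H_2, H_3)`. -/
noncomputable def multiplier : CongruenceSubgroup.Gamma0 2 →* Matrix (Fin 4) (Fin 4) ℂ where
  toFun M := (exists_transformsBy (even_of_mem_gamma0 M)).choose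
  -- The matrices are chosen arbitrarily; uniqueness forces the choice to be multiplicative.
  map_one' := (exists_transformsBy (even_of_mem_gamma0 1)).choose_spec.unique transformsBy_one
  map_mul' M N := (exists_transformsBy (even_of_mem_gamma0 (M * N))).choose_spec.unique
    ((exists_transformsBy (even_of_mem_gamma0 M)).choose_spec.mul
      (exists_transformsBy (even_of_mem_gamma0 N)).choose_spec)

theorem transformsBy_multiplier (M : CongruenceSubgroup.Gamma0 2) :
    TransformsBy M (multiplier M) :=
  (exists_transformsBy (even_of_mem_gamma0 M)).choose_spec

/-! ### Growth at the cusps -/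

/-- For `Im τ ≥ 1` every term is dominated by its Gaussian bound at height 1. -/
theorem norm_tsum_mul_gint_le {T : ℝ} (hT : 0 ≤ T) {w : ℤ × ℤ → ℂ} (hw : ∀ p, ‖w p‖ ≤ 1)
    {a b : ℤ × ℤ → ℝ} (hs : ∀ c > 0, Summable fun p => Real.exp (-c * (a p ^ 2 + b p ^ 2))) :
    ∃ C : ℝ, ∀ τ : ℂ, 1 ≤ τ.im → ‖∑' p, w p * gint T τ (a p) (b p)‖ ≤ C := by
  have hc : 0 < 8 * π * Real.exp (-2 * T) := by positivity
  refine ⟨_, fun τ hτ => tsum_of_norm_bounded ((hs _ hc).mul_left (2 * T)).hasSum fun p => ?_⟩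
  rw [norm_mul]
  refine (mul_le_of_le_one_left (norm_nonneg _) (hw p)).trans
    ((norm_gint_le hT (by linarith) _ _).trans ?_)
  refine mul_le_mul_of_nonneg_left (Real.exp_le_exp.2 ?_) (by linarith)
  nlinarith [mul_nonneg (mul_nonneg hc.le (sub_nonneg.2 hτ))
    (add_nonneg (sq_nonneg (a p)) (sq_nonneg (b p)))]

theorem sqrt_le_self_of_one_le {x : ℝ} (hx : 1 ≤ x) : √x ≤ x :=
  Real.sqrt_le_iff.2 ⟨by linarith, by nlinarith⟩

theorem exists_norm_thetaHat_le (μ : Fin 2 → ℝ) : ∃ C : ℝ, ∀ τ : UpperHalfPlane, 1 ≤ τ.im →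
    ‖thetaHat A6 P6 c1 c2 μ τ‖ ≤ C * τ.im := by
  obtain ⟨C, hC⟩ := norm_tsum_mul_gint_le param_c2_pos.le (w := fun _ => 1) (fun _ => by simp)
    (fun c hc => summable_exp_shift hc (μ 0) (μ 1))
  refine ⟨C, fun τ hτ => ?_⟩
  have h := hC τ hτ
  simp only [one_mul] at h
  rw [thetaHat_eq_tsum, norm_mul, norm_real, Real.norm_of_nonneg (Real.sqrt_nonneg _), mul_comm]
  exact mul_le_mul h (sqrt_le_self_of_one_le hτ) (Real.sqrt_nonneg _) ((norm_nonneg _).trans h)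

/-- The factor `|τ|` from Poisson summation cancels against `√(Im Sτ) = √τ₂/|τ|`, which leaves `√τ₂`
times a bounded dual series. -/
theorem exists_norm_thetaHat_S_smul_le (μ : Fin 2 → ℝ) : ∃ C : ℝ, ∀ τ : UpperHalfPlane, 1 ≤ τ.im →
    ‖thetaHat A6 P6 c1 c2 μ (ModularGroup.S • τ)‖ ≤ C * τ.im := by
  obtain ⟨C, hC⟩ := norm_tsum_mul_gint_le param_c2_pos.le
    (w := fun p => e (p.1 * μ 0 - p.2 * μ 1)) (fun p => (norm_e _).le)
    (fun c hc => summable_exp_div hc)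
  refine ⟨1 / √96 * C, fun τ hτ => ?_⟩
  have h := hC τ hτ
  have hS : ((ModularGroup.S • τ : UpperHalfPlane) : ℂ) = -1 / τ := by
    rw [UpperHalfPlane.modular_S_smul, UpperHalfPlane.coe_mk, neg_div, one_div, inv_neg]
  have him : (ModularGroup.S • τ : UpperHalfPlane).im = τ.im / ‖(τ : ℂ)‖ ^ 2 := by
    rw [← UpperHalfPlane.coe_im, hS, neg_div, neg_im, one_div, inv_im, neg_div, neg_neg,
      normSq_eq_norm_sq, UpperHalfPlane.coe_im]
  have hn : 0 < ‖(τ : ℂ)‖ := norm_pos_iff.2 τ.ne_zero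
  rw [thetaHat_eq_tsum, hS, tsum_gint_neg_inv param_c2_pos.le τ.im_pos, him,
    Real.sqrt_div' _ (sq_nonneg _), Real.sqrt_sq hn.le, norm_mul, norm_mul, norm_real, norm_real,
    Real.norm_of_nonneg (by positivity), Real.norm_of_nonneg (by positivity)]
  have h1 := mul_le_mul_of_nonneg_left (mul_le_mul h (sqrt_le_self_of_one_le hτ)
    (Real.sqrt_nonneg _) ((norm_nonneg _).trans h)) (by positivity : 0 ≤ 1 / √96)
  rw [mul_assoc]
  refine le_trans (le_of_eq ?_) h1
  generalize ‖∑' p : ℤ × ℤ, e (p.1 * μ 0 - p.2 * μ 1) *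
    gint (param P6 c2) τ (p.1 / 12) (p.2 / 8)‖ = X
  field_simp

/-- At most linear growth of all `Ĥ_j(gτ)` at the cusp `∞`. -/
def GrowsLinearly (g : SL(2, ℤ)) : Prop :=
  ∀ j, ∃ C : ℝ, ∀ τ : UpperHalfPlane, 1 ≤ τ.im → ‖Hhat j (g • τ)‖ ≤ C * τ.im

theorem growsLinearly_of_thetaHat {g : SL(2, ℤ)} (h : ∀ μ, ∃ C : ℝ, ∀ τ : UpperHalfPlane,
    1 ≤ τ.im → ‖thetaHat A6 P6 c1 c2 μ (g • τ)‖ ≤ C * τ.im) : GrowsLinearly g := fun j => by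
  obtain ⟨C, hC⟩ := h (muVec j)
  obtain ⟨D, hD⟩ := h (muVec j + lamVec)
  refine ⟨C + D, fun τ hτ => (norm_add_le _ _).trans ?_⟩
  rw [add_mul]
  exact add_le_add (hC τ hτ) (hD τ hτ)

theorem growsLinearly_one : GrowsLinearly 1 :=
  growsLinearly_of_thetaHat fun μ => by simpa only [one_smul] using exists_norm_thetaHat_le μ

theorem growsLinearly_S : GrowsLinearly ModularGroup.S :=
  growsLinearly_of_thetaHat exists_norm_thetaHat_S_smul_le

theorem GrowsLinearly.mul_T {g : SL(2, ℤ)} (hg : GrowsLinearly g) :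
    GrowsLinearly (g * ModularGroup.T) := fun j => by
  obtain ⟨C, hC⟩ := hg j
  refine ⟨C, fun τ hτ => ?_⟩
  have him : (ModularGroup.T • τ).im = τ.im := by
    rw [UpperHalfPlane.modular_T_smul, UpperHalfPlane.vadd_im]
  have h := hC (ModularGroup.T • τ) (by rwa [him])
  rwa [him, ← mul_smul] at h

theorem GrowsLinearly.gamma0_mul {g h : SL(2, ℤ)} (hg : Even (g 1 0)) (hh : GrowsLinearly h) :
    GrowsLinearly (g * h) := fun j => by
  obtain ⟨A, hA⟩ := exists_transformsBy hg
  choose C hC using hh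
  refine ⟨∑ k, ‖A j k‖ * C k, fun τ hτ => ?_⟩
  have h1 : Hhat j ((g * h) • τ) = ∑ k, A j k * Hhat k (h • τ) := by
    rw [mul_smul]; exact congrFun (hA (h • τ)) j
  rw [h1, Finset.sum_mul]
  refine (norm_sum_le _ _).trans (Finset.sum_le_sum fun k _ => ?_)
  rw [norm_mul, mul_assoc]
  exact mul_le_mul_of_nonneg_left (hC k τ hτ) (norm_nonneg _)

/-- By the parity of the bottom row, `g` lies in `Γ₀(2)`, `Γ₀(2)S` or `Γ₀(2)ST`. Left factors from
`Γ₀(2)` act by constant matrices and `T` preserves the imaginary part, so only `1` and `S` need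
estimates. -/
theorem growsLinearly (g : SL(2, ℤ)) : GrowsLinearly g := by
  have hS : ∀ g : SL(2, ℤ), (g * ModularGroup.S⁻¹) 1 0 = -g 1 1 := fun g => by
    rw [Matrix.SpecialLinearGroup.coe_mul, Matrix.SpecialLinearGroup.coe_inv, ModularGroup.coe_S]
    simp [Matrix.mul_apply, Fin.sum_univ_two, Matrix.adjugate_fin_two]
  have hT : ∀ g : SL(2, ℤ), (g * ModularGroup.T⁻¹) 1 1 = g 1 1 - g 1 0 := fun g => by
    rw [Matrix.SpecialLinearGroup.coe_mul, ModularGroup.coe_T_inv]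
    simp [Matrix.mul_apply, Fin.sum_univ_two]
    ring
  by_cases hc : Even (g 1 0)
  · simpa using growsLinearly_one.gamma0_mul hc
  by_cases hd : Even (g 1 1)
  · have := growsLinearly_S.gamma0_mul (g := g * ModularGroup.S⁻¹) (by rw [hS]; exact hd.neg)
    simpa using this
  · have hcd : Even (g 1 1 - g 1 0) :=
      (Int.not_even_iff_odd.1 hd).sub_odd (Int.not_even_iff_odd.1 hc)
    have := (growsLinearly_S.gamma0_mul (g := g * ModularGroup.T⁻¹ * ModularGroup.S⁻¹)
      (by rw [hS, hT]; exact hcd.neg)).mul_T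
    simpa using this

/-- Smoothness and the eigenvalue come from the Bessel series, transformation and growth from the
completed functions through `H_eq_Hhat`. -/
theorem isVectorMaassForm_H :
    IsVectorMaassForm (CongruenceSubgroup.Gamma0 2) multiplier (1 / 4) H where
  smooth := contDiffOn_H
  transform M j τ := by
    simp only [H_eq_Hhat]
    exact congrFun (transformsBy_multiplier M τ) j
  diagonal M hM := by
    obtain ⟨d, hd⟩ := exists_transformsBy_of_c_eq_zero hM
    rw [(transformsBy_multiplier M).unique hd]
    exact Matrix.isDiag_diagonal d
  eigen := hypLaplacian_H
  growth j g := by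
    obtain ⟨C, hC⟩ := growsLinearly g j
    exact ⟨C, 1, 1, fun τ hτ => by rw [H_eq_Hhat, pow_one]; exact hC τ hτ⟩

theorem summable_theta_series (j : Fin 4) (s : Bool) (τ : UpperHalfPlane) :
    Summable (fun n : ↥(shiftedLattice (cosetRep j s) \ {0}) => thetaPosTerm A6 c1 c2 τ n) ∧
      Summable (fun n : ↥(shiftedLattice (cosetRep j s) \ {0}) => thetaNegTerm A6 P6 c1 c2 τ n) ∧
      Summable (fun n : ↥(shiftedLattice (cosetRep j s)) => thetaHatTerm A6 P6 c1 c2 τ n) := by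
  rw [shiftedLattice_diff_zero]
  exact ⟨(summable_thetaTerms j s τ).1, (summable_thetaTerms j s τ).2, summable_thetaHatTerm _ τ⟩

end MockMaass

theorem proposition6p3 :
    -- all series that define `Θ_μ` and `Θ̂_μ` for `μ = μ_j` and `μ = μ_j + λ` converge absolutely
    (∀ (j : Fin 4) (μ : Fin 2 → ℝ),
      (μ = MockMaass.muVec j ∨ μ = MockMaass.muVec j + MockMaass.lamVec) →
      ∀ τ : UpperHalfPlane,
        Summable (fun n : ↥(MockMaass.shiftedLattice μ \ {0}) =>
          MockMaass.thetaPosTerm MockMaass.A6 MockMaass.c1 MockMaass.c2 τ (n : Fin 2 → ℝ)) ∧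
        Summable (fun n : ↥(MockMaass.shiftedLattice μ \ {0}) =>
          MockMaass.thetaNegTerm MockMaass.A6 MockMaass.P6 MockMaass.c1 MockMaass.c2 τ
            (n : Fin 2 → ℝ)) ∧
        Summable (fun n : ↥(MockMaass.shiftedLattice μ) =>
          MockMaass.thetaHatTerm MockMaass.A6 MockMaass.P6 MockMaass.c1 MockMaass.c2 τ
            (n : Fin 2 → ℝ))) ∧
    (∀ (j : Fin 4) (τ : UpperHalfPlane), MockMaass.H j τ = MockMaass.Hhat j τ) ∧
    ∃ Ω : CongruenceSubgroup.Gamma0 2 →* Matrix (Fin 4) (Fin 4) ℂ,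
      Ω MockMaass.T = MockMaass.OmegaT ∧ Ω MockMaass.R = MockMaass.OmegaR ∧
      MockMaass.IsVectorMaassForm (CongruenceSubgroup.Gamma0 2) Ω (1 / 4) MockMaass.H := by
  refine ⟨fun j μ hμ τ => ?_, MockMaass.H_eq_Hhat, MockMaass.multiplier,
    (MockMaass.transformsBy_multiplier MockMaass.T).unique MockMaass.transformsBy_T,
    (MockMaass.transformsBy_multiplier MockMaass.R).unique MockMaass.transformsBy_matR,
    MockMaass.isVectorMaassForm_H⟩
  rcases hμ with rfl | rfl
  · exact MockMaass.summable_theta_series j false τ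
  · exact MockMaass.summable_theta_series j true τ
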